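/- Let $U\subset\mathbb{R}^m$ and $V,I\subset\mathbb{R}$ be open and connected with $0\in V$, $0\in I$, and let $G\colon U\times V\times I\to\mathbb{R}$ be $C^2$ with $G(u,0,\epsilon)=0$ for all $u\in U$, $\epsilon\in I$ and $\partial_vG(u,0,0)>0$ for all $u\in U$. Let $u_0\in U$ and let $(v_{\mathrm h},q_{\mathrm h})\colon\mathbb{R}\to V\times\mathbb{R}$ be a non-trivial solution of $$v'=q,\qquad q'=G(u_0,v,0)$$ that is homoclinic to $(0,0)$. For $\lambda\in\mathbb{C}$ consider the homogeneous fast limit problem $$\partial_x\phi=\mathcal{A}(x,\lambda)\phi,\quad \phi=(v,q)\in\mathbb{C}^2,\qquad \mathcal{A}(x,\lambda)=\begin{pmatrix}0&1\\ \partial_vG(u_0,v_{\mathrm h}(x),0)+\lambda&0\end{pmatrix}.\tag{1}$$ Let $\Lambda<0$ be such that the spectrum of $\begin{pmatrix}0&1\\ \partial_vG(u_0,0,0)+\lambda&0\end{pmatrix}$ is bounded away from the imaginary axis, uniformly in $\lambda\in\mathcal{C}_\Lambda:=\{\lambda\in\mathbb{C}:\operatorname{Re}\lambda>\Lambda\}$.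 A \emph{fast reduced Evans function} is a map $\mathcal{E}_{f,0}\colon\mathcal{C}_\Lambda\to\mathbb{C}$, $\mathcal{E}_{f,0}(\lambda)=\det(B^u(\lambda),B^s(\lambda))$, where, for $\lambda\in\mathcal{C}_\Lambda$, (1) has exponential dichotomies on $[0,\infty)$ and $(-\infty,0]$ with projections $P_+(x,\lambda)$ and $P_-(x,\lambda)$, and $B^u,B^s\colon\mathcal{C}_\Lambda\to\mathbb{C}^2$ are analytic and such that $B^u(\lambda)$ and $B^s(\lambda)$ are bases of $P_+(0,\lambda)[\mathbb{C}^2]$ and $\ker P_-(0,\lambda)$, respectively. Then a fast reduced Evans function exists, and every fast reduced Evans function $\mathcal{E}_{f,0}$ has the following properties. All zeros of $\mathcal{E}_{f,0}$ in $\mathcal{C}_\Lambda$ are real and simple. There is precisely one positive zero $\lambda_0$ of $\mathcal{E}_{f,0}$, and the $v$-component of any non-trivial bounded solution of (1) at $\lambda=\lambda_0$ has no zeros. Moreover, $0$ is a zero of $\mathcal{E}_{f,0}$, and $(v_{\mathrm h}',q_{\mathrm h}')$ spans the complex vector space of bounded solutions of (1) on $\mathbb{R}$ at $\lambda=0$.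 -/

import Mathlib

open Set Filter Topology Matrix

noncomputable section

namespace FastEvans

/-- `φ : ℝ → ℂ^ι` solves the linear system `φ' = A(x) φ` on `ℝ`. -/
def IsSolution {ι : Type*} [Fintype ι] (A : ℝ → Matrix ι ι ℂ) (φ : ℝ → ι → ℂ) : Prop :=
  ∀ x, HasDerivAt φ (A x *ᵥ φ x) x

/-- The complex vector space of bounded solutions on `ℝ` of `φ' = A(x) φ`. -/
def boundedSolutions {ι : Type*} [Fintype ι] (A : ℝ → Matrix ι ι ℂ) :
    Submodule ℂ (ℝ → ι → ℂ) where
  carrier := {φ | IsSolution A φ ∧ ∃ C : ℝ, ∀ x, ‖φ x‖ ≤ C}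
  zero_mem' := ⟨fun x => by simp, 0, fun x => by simp⟩
  add_mem' := by
    rintro φ ψ ⟨hφ, C, hC⟩ ⟨hψ, D, hD⟩
    refine ⟨fun x => ?_, C + D, fun x => (norm_add_le _ _).trans (add_le_add (hC x) (hD x))⟩
    have h := (hφ x).add (hψ x)
    rw [← mulVec_add] at h
    exact h
  smul_mem' := by
    rintro c φ ⟨hφ, C, hC⟩
    refine ⟨fun x => ?_, ‖c‖ * C, fun x => ?_⟩
    · have h := (hφ x).const_smul c
      rw [← mulVec_smul] at h
      exact h
    · simpa [norm_smul] using mul_le_mul_of_nonneg_left (hC x) (norm_nonneg c)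

/-- `T(x, y)` is the evolution operator of `φ' = A(x) φ`. -/
def IsEvolution {ι : Type*} [Fintype ι] [DecidableEq ι] (A : ℝ → Matrix ι ι ℂ)
    (T : ℝ → ℝ → Matrix ι ι ℂ) : Prop :=
  ∀ y, T y y = 1 ∧ ∀ ξ, IsSolution A (fun x => T x y *ᵥ ξ)

/-- `φ' = A(x) φ` has an exponential dichotomy on `J` with constants `K, μ > 0` and projections
`P(x)`, `x ∈ J`. The operator norm bounds are spelled out on vectors `ξ`. -/
def HasExpDichotomyOn {ι : Type*} [Fintype ι] [DecidableEq ι] (A : ℝ → Matrix ι ι ℂ)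
    (J : Set ℝ) (K μ : ℝ) (P : ℝ → Matrix ι ι ℂ) : Prop :=
  0 < K ∧ 0 < μ ∧ (∀ x ∈ J, P x * P x = P x) ∧
    ∃ T, IsEvolution A T ∧ ∀ x ∈ J, ∀ y ∈ J,
      P x * T x y = T x y * P y ∧
      (y ≤ x → ∀ ξ, ‖(T x y * P y) *ᵥ ξ‖ ≤ K * Real.exp (-μ * (x - y)) * ‖ξ‖) ∧
      (x ≤ y → ∀ ξ, ‖(T x y * (1 - P y)) *ᵥ ξ‖ ≤ K * Real.exp (-μ * (y - x)) * ‖ξ‖)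

/-- The open half plane `{ζ : Re ζ > Λ}`. -/
def halfPlane (Λ : ℝ) : Set ℂ := {ζ | Λ < ζ.re}

/-- Conditions on the reaction term `G(u, v, ε)` of the scalar fast component `v`:
`G` is `C²` on `U × V × I`, vanishes at `v = 0`, and `∂_v G(u, 0, 0)` is positive for `u ∈ U`. -/
structure ReactionTerm {m : ℕ} (U : Set (EuclideanSpace ℝ (Fin m))) (V I : Set ℝ)
    (G : EuclideanSpace ℝ (Fin m) → ℝ → ℝ → ℝ) : Prop where
  isOpen_U : IsOpen U
  isConnected_U : IsConnected U
  isOpen_V : IsOpen V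
  isConnected_V : IsConnected V
  isOpen_I : IsOpen I
  isConnected_I : IsConnected I
  zero_mem_V : (0 : ℝ) ∈ V
  zero_mem_I : (0 : ℝ) ∈ I
  contDiffOn : ContDiffOn ℝ 2
    (fun p : EuclideanSpace ℝ (Fin m) × ℝ × ℝ => G p.1 p.2.1 p.2.2) (U ×ˢ V ×ˢ I)
  vanish : ∀ u ∈ U, ∀ ε ∈ I, G u 0 ε = 0
  normally_hyperbolic : ∀ u ∈ U, 0 < deriv (fun w => G u w 0) 0

/-- `(v, q)` is a (non-trivial) solution of `v' = q`, `q' = g(v)`, `v ∈ V`,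
that is homoclinic to `(0, 0)`. -/
structure IsHomoclinic (V : Set ℝ) (g : ℝ → ℝ) (v q : ℝ → ℝ) : Prop where
  mem : ∀ x, v x ∈ V
  hasDerivAt_v : ∀ x, HasDerivAt v (q x) x
  hasDerivAt_q : ∀ x, HasDerivAt q (g (v x)) x
  v_atTop : Tendsto v atTop (𝓝 0)
  v_atBot : Tendsto v atBot (𝓝 0)
  q_atTop : Tendsto q atTop (𝓝 0)
  q_atBot : Tendsto q atBot (𝓝 0)
  nontrivial : ∃ x, (v x, q x) ≠ (0, 0)

/-- The matrix `(0, 1; ∂_v G(u, v, 0) + ζ, 0)`. -/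
def fastMatrix {m : ℕ} (G : EuclideanSpace ℝ (Fin m) → ℝ → ℝ → ℝ)
    (u : EuclideanSpace ℝ (Fin m)) (v : ℝ) (ζ : ℂ) : Matrix (Fin 2) (Fin 2) ℂ :=
  !![0, 1; ((deriv (fun w => G u w 0) v : ℝ) : ℂ) + ζ, 0]

/-- The spectrum of the asymptotic matrix `(0, 1; ∂_v G(u, 0, 0) + ζ, 0)` is bounded away from the
imaginary axis, uniformly in `ζ` with `Re ζ > Λ`. -/
def UniformlyHyperbolic {m : ℕ} (G : EuclideanSpace ℝ (Fin m) → ℝ → ℝ → ℝ)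
    (u : EuclideanSpace ℝ (Fin m)) (Λ : ℝ) : Prop :=
  ∃ δ > 0, ∀ ζ ∈ halfPlane Λ, ∀ μ ∈ spectrum ℂ (fastMatrix G u 0 ζ), δ ≤ |μ.re|

/-- `E` is a fast reduced Evans function on `{Re ζ > Λ}` of the planar family
`φ' = A(x, ζ) φ`: `E(ζ) = det (Bu(ζ), Bs(ζ))`, where `Bu`, `Bs` are analytic bases of the range of
`Pp(0, ζ)` and of the kernel of `Pm(0, ζ)`, with `Pp`, `Pm` projections of exponential dichotomies
on `[0, ∞)` and `(-∞, 0]`. (That range and that kernel do not depend on the choice of `Pp`, `Pm`.) -/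
def IsFastReducedEvans (A : ℂ → ℝ → Matrix (Fin 2) (Fin 2) ℂ) (Λ : ℝ) (E : ℂ → ℂ) : Prop :=
  ∃ (Pp Pm : ℂ → ℝ → Matrix (Fin 2) (Fin 2) ℂ) (Bu Bs : ℂ → Fin 2 → ℂ),
    (∀ ζ ∈ halfPlane Λ, ∃ K μ, HasExpDichotomyOn (A ζ) (Ici 0) K μ (Pp ζ)) ∧
    (∀ ζ ∈ halfPlane Λ, ∃ K μ, HasExpDichotomyOn (A ζ) (Iic 0) K μ (Pm ζ)) ∧
    AnalyticOnNhd ℂ Bu (halfPlane Λ) ∧ AnalyticOnNhd ℂ Bs (halfPlane Λ) ∧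
    ∀ ζ ∈ halfPlane Λ,
      Bu ζ ≠ 0 ∧ Submodule.span ℂ {Bu ζ} = LinearMap.range (Pp ζ 0).mulVecLin ∧
      Bs ζ ≠ 0 ∧ Submodule.span ℂ {Bs ζ} = LinearMap.ker (Pm ζ 0).mulVecLin ∧
      E ζ = Matrix.det (Matrix.of ![Bu ζ, Bs ζ])ᵀ

end FastEvans

end

/-! This is Sturm–Liouville theory for `v'' = (a(x) + ζ) v`, `a(x) = ∂_v G(u₀, v_h(x), 0)`, carried
out with solutions bounded on half lines instead of operators. Uniform hyperbolicity gives `∂_v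
G(u₀, 0, 0) + Λ > 0` (`UniformlyHyperbolic.add_pos`), so `a(x) + Re ζ` has a positive lower bound
for `|x| ≥ R`, uniformly on the half plane. There `Re (conj v * q)` increases along solutions, at a
rate controlling `|v|² + |q|²`. Hence solutions bounded on `[0, ∞)` exist, form a line and decay
exponentially; Wronskian estimates turn this into dichotomies (`exists_dichotomy_Ici`), and the
Lagrange identity yields analyticity in `ζ` (`differentiableAt_normalised`).

Dichotomy range and kernel are exactly the initial data of solutions bounded on `[0, ∞)` and `(-∞,
0]`, so zeros of any Evans function are the parameters with a nontrivial bounded solution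
(`EvansFrame.eq_zero_iff`). Pairing an eigenfunction with its conjugate gives reality. At a zero the
derivative is a nonzero multiple of `∫ v²` over the line, and `v` is real up to a factor, which
gives simplicity (`EvansFrame.simple`).

Differentiating the homoclinic equation shows that `(v_h', q_h')` is an eigenfunction at `0`.
Reversibility makes `v_h'` vanish exactly once, with a sign change. Normalised at `±R`, the Evans
function is therefore negative just to the right of `0`, yet positive for large real parameters, so
a positive zero exists (`exists_pos_eigenvalue`). The Picone identity shows that an eigenfunction
above one with a single zero has no zeros (`IsEigen.ne_zero_of_single_zero`), and that no eigenvalue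
lies above one with a zero-free eigenfunction (`not_isEigen_of_lt`); uniqueness follows. -/

open Set Filter Topology Matrix MeasureTheory

noncomputable section

namespace FastEvans

/-! ### Global solvability of linear differential equations. -/

section LinearODE

variable {E : Type*} [NormedAddCommGroup E] [NormedSpace ℝ E]

lemma norm_integral_le_exp {f : ℝ → E} {C K : ℝ} (hK : 0 < K)
    (hf : ∀ y, ‖f y‖ ≤ C * Real.exp (K * |y|)) (hC : 0 ≤ C) (x : ℝ) :
    ‖∫ y in (0 : ℝ)..x, f y‖ ≤ C / K * Real.exp (K * |x|) := by
  have key : ∀ s : ℝ, s ≠ 0 → ∀ u w : ℝ, ∫ y in u..w, C * Real.exp (s * y) =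
      C / s * (Real.exp (s * w) - Real.exp (s * u)) := by
    intro s hs u w
    rw [intervalIntegral.integral_const_mul,
      intervalIntegral.integral_comp_mul_left (fun y => Real.exp y) hs, integral_exp,
      smul_eq_mul]
    ring
  have hCK : 0 ≤ C / K := div_nonneg hC hK.le
  rcases le_total 0 x with hx | hx
  · have h := intervalIntegral.norm_integral_le_of_norm_le (f := f)
      (g := fun y => C * Real.exp (K * y)) hx
      (MeasureTheory.ae_of_all _ fun y hy => by simpa [abs_of_pos hy.1] using hf y)
      (Continuous.intervalIntegrable (μ := MeasureTheory.volume) (by fun_prop) _ _)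
    rw [key K hK.ne'] at h
    rw [abs_of_nonneg hx]
    refine h.trans ?_
    have : 0 ≤ C / K * Real.exp (K * 0) := by positivity
    linarith
  · have h := intervalIntegral.norm_integral_le_of_norm_le (f := f)
      (g := fun y => C * Real.exp (-K * y)) hx
      (MeasureTheory.ae_of_all _ fun y hy => by simpa [abs_of_nonpos hy.2] using hf y)
      (Continuous.intervalIntegrable (μ := MeasureTheory.volume) (by fun_prop) _ _)
    rw [key (-K) (neg_ne_zero.2 hK.ne')] at h
    rw [intervalIntegral.integral_symm, norm_neg, abs_of_nonpos hx]
    refine h.trans ?_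
    have : 0 ≤ C / K * Real.exp (-K * 0) := by positivity
    have e : K * -x = -K * x := by ring
    rw [e, div_neg]
    linarith

/-- Global solvability of the initial value problem for a bounded continuous linear field. -/
theorem exists_global_linear_solution [CompleteSpace E] (A : ℝ → E →L[ℝ] E) (hA : Continuous A)
    {M : ℝ} (hM : 0 < M) (hb : ∀ x, ‖A x‖ ≤ M) (ξ : E) :
    ∃ φ : ℝ → E, φ 0 = ξ ∧ ∀ x, HasDerivAt φ (A x (φ x)) x := by
  -- Weight for a global contraction: the unknown is `φ / w`. The rate `2 * M` makes the Picard
  -- integral lose a factor `2`, so no gluing of local solutions is needed.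
  let w : ℝ → ℝ := fun x => Real.exp (2 * M * |x|)
  have hw : Continuous w := by fun_prop
  have hwpos : ∀ x, 0 < w x := fun x => Real.exp_pos _
  let J : BoundedContinuousFunction ℝ E → ℝ → E :=
    fun ψ x => ∫ y in (0 : ℝ)..x, A y (w y • ψ y)
  have hcontAw : ∀ ψ : BoundedContinuousFunction ℝ E,
      Continuous (fun y => A y (w y • ψ y)) := fun ψ =>
    hA.clm_apply (hw.smul ψ.continuous)
  have hJ : ∀ ψ, Continuous (J ψ) := fun ψ =>
    intervalIntegral.continuous_primitive (fun _ _ => (hcontAw ψ).intervalIntegrable _ _) _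
  have hJb : ∀ ψ x, ‖J ψ x‖ ≤ ‖ψ‖ / 2 * w x := by
    intro ψ x
    have := norm_integral_le_exp (f := fun y => A y (w y • ψ y)) (C := M * ‖ψ‖)
      (K := 2 * M) (by positivity) (fun y => ?_) (by positivity) x
    · refine this.trans (le_of_eq ?_)
      simp only [w]
      field_simp
    · calc ‖A y (w y • ψ y)‖ ≤ ‖A y‖ * ‖w y • ψ y‖ := (A y).le_opNorm _
        _ ≤ M * (w y * ‖ψ‖) := by
          rw [norm_smul, Real.norm_of_nonneg (hwpos y).le]
          have := (hwpos y).le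
          gcongr
          · exact hb y
          · exact ψ.norm_coe_le_norm y
        _ = _ := by ring
  have hinv : ∀ x, (w x)⁻¹ ≤ 1 := fun x =>
    inv_le_one_of_one_le₀ (Real.one_le_exp (by positivity))
  let Φ : BoundedContinuousFunction ℝ E → BoundedContinuousFunction ℝ E := fun ψ =>
    BoundedContinuousFunction.ofNormedAddCommGroup (fun x => (w x)⁻¹ • (ξ + J ψ x))
      ((hw.inv₀ fun x => (hwpos x).ne').smul (continuous_const.add (hJ ψ)))
      (‖ξ‖ + ‖ψ‖ / 2) (by
        intro x
        rw [norm_smul, norm_inv, Real.norm_of_nonneg (hwpos x).le]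
        calc (w x)⁻¹ * ‖ξ + J ψ x‖ ≤ (w x)⁻¹ * (‖ξ‖ + ‖ψ‖ / 2 * w x) := by
              have := hwpos x
              gcongr
              exact (norm_add_le _ _).trans (by gcongr; exact hJb ψ x)
          _ = (w x)⁻¹ * ‖ξ‖ + ‖ψ‖ / 2 := by
              have := (hwpos x).ne'
              field_simp
          _ ≤ 1 * ‖ξ‖ + ‖ψ‖ / 2 := by gcongr; exact hinv x
          _ = _ := by ring)
  have hΦ : ContractingWith (1 / 2) Φ := by
    refine ⟨by rw [← NNReal.coe_lt_coe]; norm_num, LipschitzWith.of_dist_le_mul fun ψ₁ ψ₂ => ?_⟩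
    refine (BoundedContinuousFunction.dist_le (by positivity)).2 fun x => ?_
    have hsub : J ψ₁ x - J ψ₂ x = J (ψ₁ - ψ₂) x := by
      simp only [J]
      rw [← intervalIntegral.integral_sub ((hcontAw ψ₁).intervalIntegrable _ _)
        ((hcontAw ψ₂).intervalIntegrable _ _)]
      congr 1
      ext y
      rw [← map_sub, ← smul_sub]
      rfl
    have e : Φ ψ₁ x - Φ ψ₂ x = (w x)⁻¹ • J (ψ₁ - ψ₂) x := by
      rw [← hsub]
      simp only [Φ, BoundedContinuousFunction.coe_ofNormedAddCommGroup, ← smul_sub]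
      congr 1
      abel
    rw [dist_eq_norm, e, norm_smul, norm_inv, Real.norm_of_nonneg (hwpos x).le, dist_eq_norm]
    calc (w x)⁻¹ * ‖J (ψ₁ - ψ₂) x‖ ≤ (w x)⁻¹ * (‖ψ₁ - ψ₂‖ / 2 * w x) := by
          have := hwpos x
          gcongr
          exact hJb _ x
      _ = _ := by
          have := (hwpos x).ne'
          push_cast
          field_simp
  obtain ⟨ψ, hψ⟩ : ∃ ψ, Φ ψ = ψ := ⟨_, hΦ.fixedPoint_isFixedPt⟩
  have hfix : ∀ x, w x • ψ x = ξ + J ψ x := by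
    intro x
    conv_lhs => rw [← hψ]
    simp only [Φ, BoundedContinuousFunction.coe_ofNormedAddCommGroup]
    rw [smul_smul, mul_inv_cancel₀ (hwpos x).ne', one_smul]
  refine ⟨fun x => w x • ψ x, ?_, fun x => ?_⟩
  · change w 0 • ψ 0 = ξ
    rw [hfix]
    simp [J]
  · have h1 : HasDerivAt (J ψ) (A x (w x • ψ x)) x :=
      intervalIntegral.integral_hasDerivAt_right ((hcontAw ψ).intervalIntegrable _ _)
        ((hcontAw ψ).stronglyMeasurableAtFilter _ _) (hcontAw ψ).continuousAt
    have h2 := h1.const_add ξ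
    have : (fun x => w x • ψ x) = fun x => ξ + J ψ x := funext hfix
    rw [this]
    convert h2 using 2
    exact (hfix x).symm

end LinearODE

/-! ### The scalar second-order equation: Wronskians, Gronwall bounds, initial value problem. -/

/-- `(v, q)` solves `v' = q`, `q' = (a(x) + ζ) v`. -/
structure IsSol (a : ℝ → ℝ) (ζ : ℂ) (v q : ℝ → ℂ) : Prop where
  dv : ∀ x, HasDerivAt v (q x) x
  dq : ∀ x, HasDerivAt q ((a x + ζ) * v x) x

/-- The squared Euclidean length of `(v, q)`. -/
def amp (v q : ℝ → ℂ) (x : ℝ) : ℝ := ‖v x‖ ^ 2 + ‖q x‖ ^ 2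

lemma amp_nonneg (v q : ℝ → ℂ) (x : ℝ) : 0 ≤ amp v q x := by unfold amp; positivity

lemma amp_eq_zero {v q : ℝ → ℂ} {x : ℝ} : amp v q x = 0 ↔ v x = 0 ∧ q x = 0 := by
  unfold amp
  constructor
  · intro h
    have h1 := sq_nonneg ‖v x‖
    have h2 := sq_nonneg ‖q x‖
    exact ⟨norm_eq_zero.1 (pow_eq_zero_iff two_ne_zero |>.1 (by linarith)),
      norm_eq_zero.1 (pow_eq_zero_iff two_ne_zero |>.1 (by linarith))⟩
  · rintro ⟨h1, h2⟩
    simp [h1, h2]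

/-- The Wronskian of two solutions. -/
def wronsk (v₁ q₁ v₂ q₂ : ℝ → ℂ) (x : ℝ) : ℂ := v₁ x * q₂ x - q₁ x * v₂ x

namespace IsSol

variable {a : ℝ → ℝ} {ζ ζ₁ ζ₂ : ℂ} {v q v₁ q₁ v₂ q₂ : ℝ → ℂ}

lemma cont_v (h : IsSol a ζ v q) : Continuous v :=
  continuous_iff_continuousAt.2 fun x => (h.dv x).continuousAt

lemma cont_q (h : IsSol a ζ v q) : Continuous q :=
  continuous_iff_continuousAt.2 fun x => (h.dq x).continuousAt

lemma add (h₁ : IsSol a ζ v₁ q₁) (h₂ : IsSol a ζ v₂ q₂) :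
    IsSol a ζ (fun x => v₁ x + v₂ x) (fun x => q₁ x + q₂ x) :=
  ⟨fun x => (h₁.dv x).add (h₂.dv x), fun x => by
    simpa [mul_add] using (h₁.dq x).fun_add (h₂.dq x)⟩

lemma const_mul (h : IsSol a ζ v q) (k : ℂ) :
    IsSol a ζ (fun x => k * v x) (fun x => k * q x) :=
  ⟨fun x => (h.dv x).const_mul k, fun x =>
    ((h.dq x).const_mul k).congr_deriv (by ring)⟩

lemma sub (h₁ : IsSol a ζ v₁ q₁) (h₂ : IsSol a ζ v₂ q₂) :
    IsSol a ζ (fun x => v₁ x - v₂ x) (fun x => q₁ x - q₂ x) := by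
  simpa [sub_eq_add_neg] using h₁.add (h₂.const_mul (-1))

lemma conj (h : IsSol a ζ v q) :
    IsSol a (starRingEnd ℂ ζ) (fun x => starRingEnd ℂ (v x)) (fun x => starRingEnd ℂ (q x)) :=
  ⟨fun x => (h.dv x).star, fun x => (h.dq x).star.congr_deriv (by simp)⟩

lemma reflect (h : IsSol a ζ v q) :
    IsSol (fun x => a (-x)) ζ (fun x => v (-x)) (fun x => -q (-x)) :=
  ⟨fun x => ((h.dv (-x)).scomp x (hasDerivAt_neg x)).congr_deriv (by simp), fun x =>
    ((h.dq (-x)).scomp x (hasDerivAt_neg x)).neg.congr_deriv (by simp)⟩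

/-- Lagrange identity: the potential cancels and only the difference of spectral parameters
survives. Equal parameters give constancy; different ones are the source of all derivatives in `ζ`.
-/
lemma wronsk_deriv (h₁ : IsSol a ζ₁ v₁ q₁) (h₂ : IsSol a ζ₂ v₂ q₂) (x : ℝ) :
    HasDerivAt (wronsk v₁ q₁ v₂ q₂) ((ζ₂ - ζ₁) * (v₁ x * v₂ x)) x :=
  (((h₁.dv x).mul (h₂.dq x)).sub ((h₁.dq x).mul (h₂.dv x))).congr_deriv (by ring)

lemma wronsk_const (h₁ : IsSol a ζ v₁ q₁) (h₂ : IsSol a ζ v₂ q₂) (x y : ℝ) :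
    wronsk v₁ q₁ v₂ q₂ x = wronsk v₁ q₁ v₂ q₂ y :=
  is_const_of_deriv_eq_zero (fun x => (h₁.wronsk_deriv h₂ x).differentiableAt)
    (fun x => by rw [(h₁.wronsk_deriv h₂ x).deriv]; ring) x y

lemma amp_deriv (h : IsSol a ζ v q) (x : ℝ) :
    HasDerivAt (amp v q) (2 * inner ℝ (v x) (q x) +
      2 * inner ℝ (q x) ((a x + ζ) * v x)) x :=
  (h.dv x).norm_sq.add (h.dq x).norm_sq

lemma abs_amp_deriv_le {M x : ℝ} (hM : 1 + |a x| + ‖ζ‖ ≤ M) :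
    |2 * inner ℝ (v x) (q x) + 2 * inner ℝ (q x) ((a x + ζ) * v x)| ≤ M * amp v q x := by
  have h1 := abs_real_inner_le_norm (v x) (q x)
  have h2 := abs_real_inner_le_norm (q x) ((a x + ζ) * v x)
  have h3 : ‖(a x + ζ) * v x‖ ≤ (|a x| + ‖ζ‖) * ‖v x‖ := by
    rw [norm_mul]
    gcongr
    exact (norm_add_le _ _).trans (by simp)
  have h4 : ‖q x‖ * ‖(a x + ζ) * v x‖ ≤ ‖q x‖ * ((|a x| + ‖ζ‖) * ‖v x‖) := by gcongr
  have h5 : 2 * (‖v x‖ * ‖q x‖) ≤ amp v q x := by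
    unfold amp
    nlinarith [sq_nonneg (‖v x‖ - ‖q x‖)]
  have h6 : (1 + |a x| + ‖ζ‖) * (2 * (‖v x‖ * ‖q x‖)) ≤ M * amp v q x :=
    mul_le_mul hM h5 (by positivity) (by have := abs_nonneg (a x); have := norm_nonneg ζ; linarith)
  rw [abs_le] at *
  constructor <;> nlinarith

/-- Gronwall in both time directions. Uniqueness, non-vanishing of nontrivial solutions and
comparison of nearby amplitudes all rest on it. -/
lemma amp_le_exp (h : IsSol a ζ v q) {M : ℝ} (hM : ∀ x, 1 + |a x| + ‖ζ‖ ≤ M) (x y : ℝ) :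
    amp v q x ≤ Real.exp (M * |x - y|) * amp v q y := by
  have hd : ∀ (s : ℝ) x, HasDerivAt (fun x => Real.exp (s * x) * amp v q x)
      (Real.exp (s * x) * (s * amp v q x + (2 * inner ℝ (v x) (q x) +
      2 * inner ℝ (q x) ((a x + ζ) * v x)))) x := fun s x =>
    (((((hasDerivAt_id x).const_mul s).exp).mul (h.amp_deriv x))).congr_deriv (by simp; ring)
  have hb := fun x => abs_le.1 (abs_amp_deriv_le (v := v) (q := q) (hM x))
  rcases le_total y x with hxy | hxy
  · have hanti : Antitone (fun x => Real.exp (-M * x) * amp v q x) :=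
      antitone_of_deriv_nonpos (fun x => (hd _ x).differentiableAt) fun x => by
        rw [(hd _ x).deriv]
        exact mul_nonpos_of_nonneg_of_nonpos (Real.exp_pos _).le (by linarith [(hb x).2])
    have := mul_le_mul_of_nonneg_left (hanti hxy) (Real.exp_pos (M * x)).le
    simp only [← mul_assoc, ← Real.exp_add] at this
    rw [show M * x + -M * x = 0 by ring, Real.exp_zero, one_mul] at this
    rwa [abs_of_nonneg (sub_nonneg.2 hxy), show M * (x - y) = M * x + -M * y by ring]
  · have hmono : Monotone (fun x => Real.exp (M * x) * amp v q x) :=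
      monotone_of_deriv_nonneg (fun x => (hd _ x).differentiableAt) fun x => by
        rw [(hd _ x).deriv]
        exact mul_nonneg (Real.exp_pos _).le (by linarith [(hb x).1])
    have := mul_le_mul_of_nonneg_left (hmono hxy) (Real.exp_pos (-M * x)).le
    simp only [← mul_assoc, ← Real.exp_add] at this
    rw [show -M * x + M * x = 0 by ring, Real.exp_zero, one_mul] at this
    rwa [abs_of_nonpos (sub_nonpos.2 hxy), show M * -(x - y) = -M * x + M * y by ring]

lemma eq_of_eq_at {A : ℝ} (hA : ∀ x, |a x| ≤ A) (h₁ : IsSol a ζ v₁ q₁) (h₂ : IsSol a ζ v₂ q₂)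
    {y : ℝ} (hv : v₁ y = v₂ y) (hq : q₁ y = q₂ y) : v₁ = v₂ ∧ q₁ = q₂ := by
  have h0 : ∀ x, v₁ x - v₂ x = 0 ∧ q₁ x - q₂ x = 0 := fun x => by
    have h := (h₁.sub h₂).amp_le_exp (M := 1 + A + ‖ζ‖)
      (fun x => by have := hA x; gcongr) x y
    have hy : amp (fun x => v₁ x - v₂ x) (fun x => q₁ x - q₂ x) y = 0 :=
      amp_eq_zero.2 ⟨sub_eq_zero.2 hv, sub_eq_zero.2 hq⟩
    rw [hy, mul_zero] at h
    exact amp_eq_zero.1 (h.antisymm (amp_nonneg _ _ _))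
  exact ⟨funext fun x => sub_eq_zero.1 (h0 x).1, funext fun x => sub_eq_zero.1 (h0 x).2⟩

lemma exists_of_data {A : ℝ} (ha : Continuous a) (hA : ∀ x, |a x| ≤ A) (ζ : ℂ) (y : ℝ)
    (α β : ℂ) : ∃ v q, IsSol a ζ v q ∧ v y = α ∧ q y = β := by
  -- The global solver prescribes data at time `0`, hence the translation of the potential by `y`.
  let L : ℝ → (ℂ × ℂ) →L[ℝ] (ℂ × ℂ) := fun x =>
    (ContinuousLinearMap.snd ℝ ℂ ℂ).prod
      (((a (x + y) : ℂ) + ζ) • ContinuousLinearMap.fst ℝ ℂ ℂ)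
  have hL : Continuous L := by
    have h1 : Continuous fun x => (((a (x + y) : ℂ) + ζ) • ContinuousLinearMap.fst ℝ ℂ ℂ) := by
      fun_prop
    exact (ContinuousLinearMap.prodₗᵢ ℝ).continuous.comp (continuous_const.prodMk h1)
  have hA0 : 0 ≤ A := (abs_nonneg _).trans (hA 0)
  have hLb : ∀ x, ‖L x‖ ≤ 1 + A + ‖ζ‖ := fun x => by
    refine ContinuousLinearMap.opNorm_le_bound _ (by positivity) fun z => ?_
    have h1 : ‖((a (x + y) : ℂ) + ζ)‖ ≤ A + ‖ζ‖ :=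
      (norm_add_le _ _).trans (by simpa using hA (x + y))
    have h2 := norm_fst_le z
    have h3 := norm_snd_le z
    simp only [L, ContinuousLinearMap.prod_apply, _root_.smul_apply,
      ContinuousLinearMap.coe_fst', ContinuousLinearMap.coe_snd', Prod.norm_def, norm_smul]
    refine max_le ?_ ?_
    · nlinarith [norm_nonneg z, norm_nonneg ζ, Prod.norm_def z]
    · calc _ ≤ (A + ‖ζ‖) * ‖z‖ := by gcongr
        _ ≤ (1 + A + ‖ζ‖) * ‖z‖ := by gcongr; linarith
  obtain ⟨φ, h0, hφ⟩ := exists_global_linear_solution L hL (M := 1 + A + ‖ζ‖) (by positivity)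
    hLb (α, β)
  · refine ⟨fun x => (φ (x - y)).1, fun x => (φ (x - y)).2, ⟨fun x => ?_, fun x => ?_⟩, ?_, ?_⟩
    · have := (hφ (x - y)).comp_sub_const x y
      exact (ContinuousLinearMap.fst ℝ ℂ ℂ).hasFDerivAt.comp_hasDerivAt x this
    · have := (hφ (x - y)).comp_sub_const x y
      have h2 := (ContinuousLinearMap.snd ℝ ℂ ℂ).hasFDerivAt.comp_hasDerivAt x this
      refine h2.congr_deriv ?_
      simp [L]
    · simp [h0]
    · simp [h0]

end IsSol
-- The Lyapunov function and solutions bounded on a half line.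
/-- A bounded continuous potential with `c ≤ a(x) + Λ` for `|x| ≥ R`. -/
structure Coercive (a : ℝ → ℝ) (Λ A c R : ℝ) : Prop where
  cont : Continuous a
  bdd : ∀ x, |a x| ≤ A
  c_pos : 0 < c
  c_le : c ≤ 1
  R_nonneg : 0 ≤ R
  le_add : ∀ x, R ≤ |x| → c ≤ a x + Λ

lemma Coercive.reflect {a : ℝ → ℝ} {Λ A c R : ℝ} (hP : Coercive a Λ A c R) :
    Coercive (fun x => a (-x)) Λ A c R :=
  ⟨hP.cont.comp continuous_neg, fun x => hP.bdd (-x), hP.c_pos, hP.c_le, hP.R_nonneg,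
    fun x hx => hP.le_add (-x) (by rwa [abs_neg])⟩

lemma Coercive.growth {a : ℝ → ℝ} {Λ A c R : ℝ} (hP : Coercive a Λ A c R) (ζ : ℂ) (x : ℝ) :
    1 + |a x| + ‖ζ‖ ≤ 1 + A + ‖ζ‖ := by
  have := hP.bdd x
  gcongr

/-- The Lyapunov function `Re (conj v * q)`. -/
def lyap (v q : ℝ → ℂ) (x : ℝ) : ℝ := inner ℝ (v x) (q x)

/-- `(v, q)` is bounded on `[0, ∞)`. -/
def FwdBdd (v q : ℝ → ℂ) : Prop := ∃ C, ∀ x, 0 ≤ x → amp v q x ≤ C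

lemma two_abs_lyap_le (v q : ℝ → ℂ) (x : ℝ) : 2 * |lyap v q x| ≤ amp v q x := by
  have h := abs_real_inner_le_norm (v x) (q x)
  unfold lyap amp
  nlinarith [sq_nonneg (‖v x‖ - ‖q x‖)]

lemma exp_neg_mul_of_le {c x y u w : ℝ} (h : Real.exp (c * x) * u ≤ Real.exp (c * y) * w) :
    u ≤ Real.exp (-(c * (x - y))) * w := by
  have := mul_le_mul_of_nonneg_left h (Real.exp_pos (-(c * x))).le
  rw [← mul_assoc, ← mul_assoc, ← Real.exp_add, ← Real.exp_add, neg_add_cancel, Real.exp_zero,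
    one_mul] at this
  rwa [show -(c * (x - y)) = -(c * x) + c * y by ring]

section

variable {a : ℝ → ℝ} {Λ A c R : ℝ} {ζ : ℂ} {v q : ℝ → ℂ}

/-- Taking the real part discards `Im ζ`, so the sign of the derivative is governed by `Re ζ > Λ`
alone. -/
lemma IsSol.lyap_deriv (h : IsSol a ζ v q) (x : ℝ) :
    HasDerivAt (lyap v q) (‖q x‖ ^ 2 + (a x + ζ.re) * ‖v x‖ ^ 2) x :=
  ((h.dv x).inner ℝ (h.dq x)).congr_deriv (by
    rw [real_inner_self_eq_norm_sq, add_comm]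
    congr 1
    simp only [Complex.inner, ← Complex.normSq_eq_norm_sq, Complex.normSq_apply]
    simp
    ring)

lemma Coercive.mul_amp_le (hP : Coercive a Λ A c R) (hζ : ζ ∈ halfPlane Λ) (v q : ℝ → ℂ) {x : ℝ}
    (hx : R ≤ x) :
    c * amp v q x ≤ ‖q x‖ ^ 2 + (a x + ζ.re) * ‖v x‖ ^ 2 := by
  have h1 := hP.le_add x (hx.trans (le_abs_self x))
  have h2 : Λ < ζ.re := hζ
  unfold amp
  have h3 : c * ‖v x‖ ^ 2 ≤ (a x + ζ.re) * ‖v x‖ ^ 2 := by gcongr; linarith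
  have h4 : c * ‖q x‖ ^ 2 ≤ 1 * ‖q x‖ ^ 2 := by gcongr; exact hP.c_le
  linarith

/-- Past `R` the derivative of `lyap` dominates `c * amp ≥ 2 * c * |lyap|`, which absorbs the term
coming from the exponential. The choice `s = -2c` makes positive values grow exponentially, `s = 2c`
makes negative ones decay. -/
lemma IsSol.lyap_exp_mono (hP : Coercive a Λ A c R) (hζ : ζ ∈ halfPlane Λ) (h : IsSol a ζ v q)
    {s : ℝ} (hs : |s| ≤ 2 * c) : MonotoneOn (fun x => Real.exp (s * x) * lyap v q x) (Ici R) := by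
  have hd : ∀ x, HasDerivAt (fun x => Real.exp (s * x) * lyap v q x)
      (Real.exp (s * x) * (s * lyap v q x + (‖q x‖ ^ 2 + (a x + ζ.re) * ‖v x‖ ^ 2))) x := fun x =>
    ((((hasDerivAt_id x).const_mul s).exp).mul (h.lyap_deriv x)).congr_deriv (by simp; ring)
  refine monotoneOn_of_deriv_nonneg (convex_Ici R)
    (fun x _ => (hd x).continuousAt.continuousWithinAt)
    (fun x _ => (hd x).differentiableAt.differentiableWithinAt) fun x hx => ?_
  rw [interior_Ici] at hx
  rw [(hd x).deriv]
  refine mul_nonneg (Real.exp_pos _).le ?_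
  have h1 := hP.mul_amp_le hζ v q (le_of_lt hx)
  have h2 := two_abs_lyap_le v q x
  have h3 : |s * lyap v q x| ≤ c * amp v q x := by
    rw [abs_mul]
    calc |s| * |lyap v q x| ≤ 2 * c * |lyap v q x| := by gcongr
      _ = c * (2 * |lyap v q x|) := by ring
      _ ≤ _ := by have := hP.c_pos; gcongr
  have := (abs_le.1 h3).1
  linarith

lemma IsSol.lyap_mono (hP : Coercive a Λ A c R) (hζ : ζ ∈ halfPlane Λ) (h : IsSol a ζ v q) :
    MonotoneOn (lyap v q) (Ici R) := by
  simpa using h.lyap_exp_mono hP hζ (s := 0) (by simpa using hP.c_pos.le)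

/-- Amplitudes at distance at most `1` are comparable by Gronwall, so the amplitude at any point of
the interval bounds the slope of `lyap` on all of it. This converts monotonicity into pointwise
control of `amp`. -/
lemma IsSol.lyap_step (hP : Coercive a Λ A c R) (hζ : ζ ∈ halfPlane Λ) (h : IsSol a ζ v q) {x y : ℝ}
    (hx : R ≤ x) (hy : |y - x| ≤ 1) (hyx : x ≤ y) {z : ℝ} (hz : z ∈ Icc x y) :
    c * Real.exp (-(1 + A + ‖ζ‖)) * amp v q z * (y - x) ≤ lyap v q y - lyap v q x := by
  refine Convex.mul_sub_le_image_sub_of_le_deriv (convex_Icc x y)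
    (fun w _ => (h.lyap_deriv w).continuousAt.continuousWithinAt)
    (fun w _ => (h.lyap_deriv w).differentiableAt.differentiableWithinAt) (fun w hw => ?_)
    x (left_mem_Icc.2 hyx) y (right_mem_Icc.2 hyx) hyx
  rw [interior_Icc] at hw
  rw [(h.lyap_deriv w).deriv]
  refine le_trans ?_ (hP.mul_amp_le hζ v q (hx.trans hw.1.le))
  have h1 := h.amp_le_exp (hP.growth ζ) z w
  have hA : 0 ≤ A := (abs_nonneg _).trans (hP.bdd 0)
  have h2 : |z - w| ≤ 1 := by
    rw [abs_le] at *
    constructor <;> linarith [hz.1, hz.2, hw.1, hw.2]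
  have h3 : Real.exp ((1 + A + ‖ζ‖) * |z - w|) ≤ Real.exp (1 + A + ‖ζ‖) := by
    rw [Real.exp_le_exp]
    exact mul_le_of_le_one_right (by positivity) h2
  have h4 : amp v q z ≤ Real.exp (1 + A + ‖ζ‖) * amp v q w :=
    h1.trans (mul_le_mul_of_nonneg_right h3 (amp_nonneg _ _ _))
  rw [mul_assoc]
  refine mul_le_mul_of_nonneg_left ?_ hP.c_pos.le
  rw [Real.exp_neg, inv_mul_le_iff₀ (Real.exp_pos _)]
  exact h4

/-- A positive value would grow at rate `2c` and contradict boundedness. -/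
lemma IsSol.lyap_nonpos (hP : Coercive a Λ A c R) (hζ : ζ ∈ halfPlane Λ) (h : IsSol a ζ v q)
    (hb : FwdBdd v q) {x : ℝ} (hx : R ≤ x) : lyap v q x ≤ 0 := by
  by_contra! hpos
  obtain ⟨C, hC⟩ := hb
  have hc := hP.c_pos
  have hR := hP.R_nonneg
  have ht : Tendsto (fun y => Real.exp (2 * c * (y - x)) * lyap v q x) atTop atTop := by
    refine Tendsto.atTop_mul_const hpos (Real.tendsto_exp_atTop.comp ?_)
    exact Tendsto.const_mul_atTop (by positivity) (tendsto_atTop_add_const_right _ _ tendsto_id)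
  obtain ⟨y, hy1, hy2⟩ := ((ht.eventually_gt_atTop C).and (eventually_ge_atTop x)).exists
  have h1 := h.lyap_exp_mono hP hζ (s := -(2 * c)) (by rw [abs_neg, abs_of_pos (by positivity)])
    (mem_Ici.2 hx) (mem_Ici.2 (hx.trans hy2)) hy2
  have h2 := exp_neg_mul_of_le h1
  have h3 := two_abs_lyap_le v q y
  have h4 := hC y (hR.trans (hx.trans hy2))
  have h5 := le_abs_self (lyap v q y)
  have h6 : Real.exp (-(2 * c * (y - x))) * lyap v q y ≤ Real.exp (-(2 * c * (y - x))) * C := by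
    gcongr
    linarith [abs_nonneg (lyap v q y)]
  have h7 : lyap v q x ≤ Real.exp (-(2 * c * (y - x))) * C := by
    refine le_trans ?_ h6
    rwa [show -(2 * c * (y - x)) = -(-(2 * c) * (x - y)) by ring]
  rw [Real.exp_neg, ← div_eq_inv_mul, le_div_iff₀ (Real.exp_pos _)] at h7
  linarith

/-- Over `[x, x + 1]` the function `lyap` rises by at least the left side and still ends
non-positive. -/
lemma IsSol.amp_le_neg_lyap (hP : Coercive a Λ A c R) (hζ : ζ ∈ halfPlane Λ) (h : IsSol a ζ v q)
    (hneg : ∀ x, R ≤ x → lyap v q x ≤ 0) {x : ℝ} (hx : R ≤ x) :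
    c * Real.exp (-(1 + A + ‖ζ‖)) * amp v q x ≤ -lyap v q x := by
  have h1 := h.lyap_step hP hζ hx (y := x + 1) (by simp) (by simp) (z := x) (by simp)
  have h2 := hneg (x + 1) (by linarith)
  linarith

/-- The mirror argument looks back over `[x - 1, x]`, where `lyap` is already non-negative; hence
the threshold `R + 1`. -/
lemma IsSol.amp_le_lyap (hP : Coercive a Λ A c R) (hζ : ζ ∈ halfPlane Λ) (h : IsSol a ζ v q)
    (hpos : 0 ≤ lyap v q R) {x : ℝ} (hx : R + 1 ≤ x) :
    c * Real.exp (-(1 + A + ‖ζ‖)) * amp v q x ≤ lyap v q x := by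
  have h1 := h.lyap_step hP hζ (x := x - 1) (by linarith) (y := x) (by simp) (by simp) (z := x)
    (by simp)
  have h2 := h.lyap_mono hP hζ (mem_Ici.2 le_rfl) (mem_Ici.2 (show R ≤ x - 1 by linarith))
    (by linarith)
  linarith

/-- Past `R`, `-lyap` decays at rate `2c` and is comparable with `amp` from both sides. -/
lemma IsSol.amp_decay_of_lyap (hP : Coercive a Λ A c R) (hζ : ζ ∈ halfPlane Λ) (h : IsSol a ζ v q)
    (hneg : ∀ x, R ≤ x → lyap v q x ≤ 0) {x y : ℝ} (hy : R ≤ y) (hx : y ≤ x) :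
    amp v q x ≤ Real.exp (1 + A + ‖ζ‖) / c * (Real.exp (-(2 * c * (x - y))) * amp v q y) := by
  have hc := hP.c_pos
  have h1 := h.amp_le_neg_lyap hP hζ hneg (hy.trans hx)
  have h2 := h.lyap_exp_mono hP hζ (s := 2 * c) (by rw [abs_of_pos (by positivity)])
    (mem_Ici.2 hy) (mem_Ici.2 (hy.trans hx)) hx
  have h3 : -lyap v q x ≤ Real.exp (-(2 * c * (x - y))) * -lyap v q y :=
    exp_neg_mul_of_le (by simpa using h2)
  have h4 := two_abs_lyap_le v q y
  have h5 := neg_abs_le (lyap v q y)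
  have h6 : Real.exp (-(2 * c * (x - y))) * -lyap v q y ≤
      Real.exp (-(2 * c * (x - y))) * amp v q y := by
    gcongr
    linarith [abs_nonneg (lyap v q y)]
  rw [div_mul_eq_mul_div, le_div_iff₀ hc]
  rw [Real.exp_neg, mul_right_comm, ← div_eq_mul_inv, div_le_iff₀ (Real.exp_pos _)] at h1
  nlinarith [Real.exp_pos (1 + A + ‖ζ‖), mul_le_mul_of_nonneg_right (h3.trans h6)
    (Real.exp_pos (1 + A + ‖ζ‖)).le]

/-- Replacing `x` by `max x ρ` costs a fixed factor, so estimates valid past `ρ` extend to all of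
`[0, ∞)`. -/
lemma IsSol.amp_le_clip (hP : Coercive a Λ A c R) (h : IsSol a ζ v q) (x : ℝ) (hx : 0 ≤ x) {ρ : ℝ}
    (hρ : 0 ≤ ρ) :
    amp v q x ≤ Real.exp ((1 + A + ‖ζ‖) * ρ) * amp v q (max x ρ) ∧
      amp v q (max x ρ) ≤ Real.exp ((1 + A + ‖ζ‖) * ρ) * amp v q x := by
  have hA : 0 ≤ A := (abs_nonneg _).trans (hP.bdd 0)
  have h0 : |x - max x ρ| ≤ ρ := by
    rw [abs_le]
    rcases le_total x ρ with h | h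
    · rw [max_eq_right h]; constructor <;> linarith
    · rw [max_eq_left h]; constructor <;> linarith
  have h1 : Real.exp ((1 + A + ‖ζ‖) * |x - max x ρ|) ≤ Real.exp ((1 + A + ‖ζ‖) * ρ) := by
    gcongr
  refine ⟨(h.amp_le_exp (hP.growth ζ) _ _).trans
    (mul_le_mul_of_nonneg_right h1 (amp_nonneg _ _ _)),
    (h.amp_le_exp (hP.growth ζ) _ x).trans
    (mul_le_mul_of_nonneg_right ?_ (amp_nonneg _ _ _))⟩
  rwa [abs_sub_comm]

end

/-- The constant in the decay estimate for solutions bounded on `[0, ∞)`. -/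
def decayConst (A c R t : ℝ) : ℝ :=
  Real.exp ((1 + A + t) * (2 * R + 1) + 2 * c * R) / c

lemma decayConst_mono {A c R t t' : ℝ} (hc : 0 < c) (hR : 0 ≤ R) (ht : t ≤ t') :
    decayConst A c R t ≤ decayConst A c R t' := by
  unfold decayConst
  gcongr

lemma decayConst_pos {A c R t : ℝ} (hc : 0 < c) : 0 < decayConst A c R t := by
  unfold decayConst
  positivity

section

variable {a : ℝ → ℝ} {Λ A c R : ℝ} {ζ : ℂ} {v q : ℝ → ℂ}

lemma IsSol.amp_decay_of_lyap_nonpos (hP : Coercive a Λ A c R) (hζ : ζ ∈ halfPlane Λ)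
    (h : IsSol a ζ v q) (hneg : ∀ x, R ≤ x → lyap v q x ≤ 0) {x y : ℝ} (hy : 0 ≤ y) (hx : y ≤ x) :
    amp v q x ≤ decayConst A c R ‖ζ‖ * Real.exp (-(2 * c * (x - y))) * amp v q y := by
  have hc := hP.c_pos
  have hR := hP.R_nonneg
  have h1 := (h.amp_le_clip hP x (hy.trans hx) hR).1
  have h2 := (h.amp_le_clip hP y hy hR).2
  have h3 := h.amp_decay_of_lyap hP hζ hneg (le_max_right y R) (max_le_max_right R hx)
  have h4 : x - y - R ≤ max x R - max y R := by
    have := le_max_left x R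
    have : max y R ≤ y + R := max_le (by linarith) (by linarith)
    linarith
  have h5 : Real.exp (-(2 * c * (max x R - max y R))) ≤ Real.exp (-(2 * c * (x - y - R))) := by
    gcongr
  calc amp v q x ≤ Real.exp ((1 + A + ‖ζ‖) * R) * amp v q (max x R) := h1
    _ ≤ Real.exp ((1 + A + ‖ζ‖) * R) * (Real.exp (1 + A + ‖ζ‖) / c *
        (Real.exp (-(2 * c * (max x R - max y R))) * amp v q (max y R))) := by gcongr
    _ ≤ Real.exp ((1 + A + ‖ζ‖) * R) * (Real.exp (1 + A + ‖ζ‖) / c *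
        (Real.exp (-(2 * c * (x - y - R))) * (Real.exp ((1 + A + ‖ζ‖) * R) * amp v q y))) := by
      have := amp_nonneg v q (max y R)
      gcongr
    _ = Real.exp ((1 + A + ‖ζ‖) * R) * Real.exp (1 + A + ‖ζ‖) *
        Real.exp (-(2 * c * (x - y - R))) * Real.exp ((1 + A + ‖ζ‖) * R) / c * amp v q y := by
      ring
    _ = _ := by
      unfold decayConst
      rw [← Real.exp_add, ← Real.exp_add, ← Real.exp_add, div_mul_eq_mul_div _ c
        (Real.exp (-(2 * c * (x - y)))), ← Real.exp_add]
      ring_nf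

lemma IsSol.amp_decay (hP : Coercive a Λ A c R) (hζ : ζ ∈ halfPlane Λ) (h : IsSol a ζ v q)
    (hb : FwdBdd v q) {x y : ℝ} (hy : 0 ≤ y) (hx : y ≤ x) :
    amp v q x ≤ decayConst A c R ‖ζ‖ * Real.exp (-(2 * c * (x - y))) * amp v q y :=
  h.amp_decay_of_lyap_nonpos hP hζ (fun _ hx => h.lyap_nonpos hP hζ hb hx) hy hx

lemma IsSol.fwdBdd_of_lyap_nonpos (hP : Coercive a Λ A c R) (hζ : ζ ∈ halfPlane Λ)
    (h : IsSol a ζ v q) (hneg : ∀ x, R ≤ x → lyap v q x ≤ 0) : FwdBdd v q := by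
  refine ⟨decayConst A c R ‖ζ‖ * 1 * amp v q 0, fun x hx => ?_⟩
  refine (h.amp_decay_of_lyap_nonpos hP hζ hneg le_rfl hx).trans ?_
  have := amp_nonneg v q 0
  have := hP.c_pos
  have := decayConst_pos (A := A) (R := R) (t := ‖ζ‖) hP.c_pos
  gcongr
  rw [Real.exp_le_one_iff]
  have : 0 ≤ 2 * c * (x - 0) := by positivity
  linarith

/-- A zero of `v` is a zero of `lyap`, which for bounded solutions controls the whole amplitude.
This permits the normalisation `v R = 1`. -/
lemma IsSol.ne_zero_of_fwdBdd (hP : Coercive a Λ A c R) (hζ : ζ ∈ halfPlane Λ) (h : IsSol a ζ v q)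
    (hb : FwdBdd v q) {x : ℝ} (hx : R ≤ x) (hne : amp v q x ≠ 0) : v x ≠ 0 := by
  intro h0
  have h1 := h.amp_le_neg_lyap hP hζ (fun _ hx => h.lyap_nonpos hP hζ hb hx) hx
  have h2 : lyap v q x = 0 := by simp [lyap, h0]
  rw [h2, neg_zero] at h1
  have h3 := hP.c_pos
  have h4 := (amp_nonneg v q x).lt_of_ne' hne
  have : 0 < c * Real.exp (-(1 + A + ‖ζ‖)) * amp v q x := by positivity
  linarith

end

lemma IsSol.amp_ne_zero {a : ℝ → ℝ} {A : ℝ} {ζ : ℂ} {v q : ℝ → ℂ} (hA : ∀ x, |a x| ≤ A)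
    (h : IsSol a ζ v q) {y : ℝ} (hy : amp v q y ≠ 0) (x : ℝ) : amp v q x ≠ 0 := by
  intro h0
  have h1 := h.amp_le_exp (M := 1 + A + ‖ζ‖) (fun x => by have := hA x; gcongr) y x
  rw [h0, mul_zero] at h1
  exact hy (h1.antisymm (amp_nonneg _ _ _))

/-- Compactness: the unit initial data with `lyap ≤ 0` at time `R + n` form nested nonempty compact
sets, nested because `lyap` increases. Data in the intersection keep `lyap ≤ 0` forever, which
forces decay. -/
theorem exists_fwdBdd {a : ℝ → ℝ} {Λ A c R : ℝ} {ζ : ℂ} (hP : Coercive a Λ A c R)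
    (hζ : ζ ∈ halfPlane Λ) : ∃ v q, IsSol a ζ v q ∧ FwdBdd v q ∧ v R = 1 := by
  obtain ⟨v₁, q₁, h₁, hv₁, hq₁⟩ := IsSol.exists_of_data hP.cont hP.bdd ζ R 1 0
  obtain ⟨v₂, q₂, h₂, hv₂, hq₂⟩ := IsSol.exists_of_data hP.cont hP.bdd ζ R 0 1
  have hsol : ∀ ξ : ℂ × ℂ, IsSol a ζ (fun x => ξ.1 * v₁ x + ξ.2 * v₂ x)
      (fun x => ξ.1 * q₁ x + ξ.2 * q₂ x) := fun ξ => (h₁.const_mul _).add (h₂.const_mul _)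
  have hw : ∀ x, v₁ x * q₂ x - q₁ x * v₂ x = 1 := fun x => by
    have := h₁.wronsk_const h₂ x R
    simpa [wronsk, hv₁, hq₁, hv₂, hq₂] using this
  let S : ℕ → Set (ℂ × ℂ) := fun n => Metric.sphere 0 1 ∩
    {ξ | lyap (fun x => ξ.1 * v₁ x + ξ.2 * v₂ x) (fun x => ξ.1 * q₁ x + ξ.2 * q₂ x) (R + n) ≤ 0}
  have hclosed : ∀ n, IsClosed {ξ : ℂ × ℂ |
      lyap (fun x => ξ.1 * v₁ x + ξ.2 * v₂ x) (fun x => ξ.1 * q₁ x + ξ.2 * q₂ x) (R + n) ≤ 0} :=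
    fun n => isClosed_le (by unfold lyap; fun_prop) continuous_const
  have hcomp : ∀ n, IsCompact (S n) := fun n => (isCompact_sphere 0 1).inter_right (hclosed n)
  obtain ⟨ξ, hξ⟩ : (⋂ n, S n).Nonempty := by
    refine IsCompact.nonempty_iInter_of_sequence_nonempty_isCompact_isClosed S (fun n => ?_)
      (fun n => ?_) (hcomp 0) fun n => (hcomp n).isClosed
    · rintro ξ ⟨h1, h2⟩
      exact ⟨h1, ((hsol ξ).lyap_mono hP hζ (mem_Ici.2 (by simp))
        (mem_Ici.2 (by simp; positivity)) (by simp)).trans h2⟩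
    -- The combination whose `v`-component vanishes at `R + n`, so that `lyap` is zero there; it is
    -- nontrivial because the Wronskian is `1`.
    · let η : ℂ × ℂ := (v₂ (R + n), -v₁ (R + n))
      have hη : ‖η‖ ≠ 0 := by
        rw [norm_ne_zero_iff]
        intro h0
        have e1 : v₂ (R + n) = 0 := congrArg Prod.fst h0
        have e2 : v₁ (R + n) = 0 := by simpa [η] using congrArg Prod.snd h0
        have := hw (R + n)
        rw [e1, e2] at this
        simp at this
      refine ⟨((‖η‖ : ℂ)⁻¹) • η, ?_, ?_⟩
      · simp only [mem_sphere_zero_iff_norm, norm_smul, norm_inv, Complex.norm_real, norm_norm]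
        exact inv_mul_cancel₀ hη
      · have : ((‖η‖ : ℂ)⁻¹ * v₂ (R + n)) * v₁ (R + n) +
            ((‖η‖ : ℂ)⁻¹ * -v₁ (R + n)) * v₂ (R + n) = 0 := by ring
        change lyap (fun x => (‖η‖ : ℂ)⁻¹ * v₂ (R + n) * v₁ x + (‖η‖ : ℂ)⁻¹ * -v₁ (R + n) * v₂ x)
          _ _ ≤ 0
        simp only [lyap, this, inner_zero_left, le_refl]
  rw [mem_iInter] at hξ
  have hξ1 : ‖ξ‖ = 1 := by simpa using (hξ 0).1
  have hneg : ∀ x, R ≤ x →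
      lyap (fun x => ξ.1 * v₁ x + ξ.2 * v₂ x) (fun x => ξ.1 * q₁ x + ξ.2 * q₂ x) x ≤ 0 := by
    intro x hx
    obtain ⟨n, hn⟩ := exists_nat_ge (x - R)
    exact ((hsol ξ).lyap_mono hP hζ (mem_Ici.2 hx) (mem_Ici.2 (by simp))
      (by linarith)).trans (hξ n).2
  have hb := (hsol ξ).fwdBdd_of_lyap_nonpos hP hζ hneg
  have hne : amp (fun x => ξ.1 * v₁ x + ξ.2 * v₂ x) (fun x => ξ.1 * q₁ x + ξ.2 * q₂ x) R ≠ 0 := by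
    intro h0
    obtain ⟨e1, e2⟩ := amp_eq_zero.1 h0
    simp only [hv₁, hv₂, hq₁, hq₂, mul_one, mul_zero, add_zero, zero_add] at e1 e2
    have : ξ = 0 := Prod.ext e1 e2
    rw [this] at hξ1
    simp at hξ1
  have hv := (hsol ξ).ne_zero_of_fwdBdd hP hζ hb le_rfl hne
  obtain ⟨C, hC⟩ := hb
  refine ⟨_, _, (hsol ξ).const_mul (ξ.1 * v₁ R + ξ.2 * v₂ R)⁻¹, ⟨
    ‖(ξ.1 * v₁ R + ξ.2 * v₂ R)⁻¹‖ ^ 2 * C, fun x hx => ?_⟩, inv_mul_cancel₀ hv⟩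
  have := mul_le_mul_of_nonneg_left (hC x hx) (sq_nonneg ‖(ξ.1 * v₁ R + ξ.2 * v₂ R)⁻¹‖)
  refine le_trans (le_of_eq ?_) this
  simp only [amp, norm_mul]
  ring

/-! ### Dependence on the spectral parameter through the Lagrange identity. -/

lemma isOpen_halfPlane (Λ : ℝ) : IsOpen (halfPlane Λ) :=
  isOpen_lt continuous_const Complex.continuous_re

lemma norm_mul_le_amp (v₁ q₁ v₂ q₂ : ℝ → ℂ) (x : ℝ) :
    ‖v₁ x * v₂ x‖ ≤ amp v₁ q₁ x + amp v₂ q₂ x := by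
  rw [norm_mul]
  unfold amp
  nlinarith [sq_nonneg (‖v₁ x‖ - ‖v₂ x‖), sq_nonneg ‖q₁ x‖, sq_nonneg ‖q₂ x‖,
    sq_nonneg ‖v₁ x‖, sq_nonneg ‖v₂ x‖]

lemma norm_wronsk_le_amp (v₁ q₁ v₂ q₂ : ℝ → ℂ) (x : ℝ) :
    ‖wronsk v₁ q₁ v₂ q₂ x‖ ≤ amp v₁ q₁ x + amp v₂ q₂ x := by
  have h := norm_sub_le (v₁ x * q₂ x) (q₁ x * v₂ x)
  rw [norm_mul, norm_mul] at h
  unfold wronsk amp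
  nlinarith [sq_nonneg (‖v₁ x‖ - ‖q₂ x‖), sq_nonneg (‖q₁ x‖ - ‖v₂ x‖)]

/-- Lagrange identities exhibit Wronskians in the form `(ζ - ζ₀) * f ζ` with `f` an integral; a mere
limit of `f` then gives the derivative, with no differentiation under the integral. -/
lemma hasDerivAt_of_eventuallyEq_sub_mul {g f : ℂ → ℂ} {ζ₀ L : ℂ}
    (hf : Tendsto f (𝓝 ζ₀) (𝓝 L)) (hg : ∀ᶠ ζ in 𝓝 ζ₀, g ζ = (ζ - ζ₀) * f ζ) :
    HasDerivAt g L ζ₀ := by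
  rw [hasDerivAt_iff_tendsto_slope]
  refine (hf.mono_left nhdsWithin_le_nhds).congr' ?_
  have h0 : g ζ₀ = 0 := by simpa using hg.self_of_nhds
  filter_upwards [hg.filter_mono nhdsWithin_le_nhds, self_mem_nhdsWithin] with ζ h1 h2
  rw [slope_def_field, h0, h1, sub_zero, mul_div_cancel_left₀ _ (sub_ne_zero.2 h2)]

lemma eventually_norm_le (ζ₀ : ℂ) : ∀ᶠ ζ in 𝓝 ζ₀, ‖ζ‖ ≤ ‖ζ₀‖ + 1 :=
  (continuous_norm.tendsto ζ₀).eventually_le_const (by linarith)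

lemma integrableOn_exp_decay {c : ℝ} (hc : 0 < c) (C b : ℝ) :
    IntegrableOn (fun x => C * Real.exp (-(2 * c * (x - b)))) (Ioi b) := by
  have h := (integrableOn_exp_mul_Ioi (a := -(2 * c)) (by linarith) b).const_mul
    (C * Real.exp (2 * c * b))
  refine h.congr (ae_of_all _ fun x => ?_)
  simp only [mul_assoc, ← Real.exp_add]
  ring_nf

section

variable {a : ℝ → ℝ} {Λ A c R : ℝ} {ζ₁ ζ₂ : ℂ} {v₁ q₁ v₂ q₂ : ℝ → ℂ}

lemma amp_add_decay (hP : Coercive a Λ A c R) (hζ₁ : ζ₁ ∈ halfPlane Λ) (hζ₂ : ζ₂ ∈ halfPlane Λ)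
    (h₁ : IsSol a ζ₁ v₁ q₁) (h₂ : IsSol a ζ₂ v₂ q₂) (hb₁ : FwdBdd v₁ q₁) (hb₂ : FwdBdd v₂ q₂)
    {t b x : ℝ} (ht₁ : ‖ζ₁‖ ≤ t) (ht₂ : ‖ζ₂‖ ≤ t) (hb : 0 ≤ b) (hx : b ≤ x) :
    amp v₁ q₁ x + amp v₂ q₂ x ≤
      decayConst A c R t * (amp v₁ q₁ b + amp v₂ q₂ b) * Real.exp (-(2 * c * (x - b))) := by
  have e₁ := h₁.amp_decay hP hζ₁ hb₁ hb hx
  have e₂ := h₂.amp_decay hP hζ₂ hb₂ hb hx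
  have m₁ := decayConst_mono (A := A) hP.c_pos hP.R_nonneg ht₁
  have m₂ := decayConst_mono (A := A) hP.c_pos hP.R_nonneg ht₂
  have n₁ : decayConst A c R ‖ζ₁‖ * Real.exp (-(2 * c * (x - b))) * amp v₁ q₁ b ≤
      decayConst A c R t * Real.exp (-(2 * c * (x - b))) * amp v₁ q₁ b := by
    have := amp_nonneg v₁ q₁ b
    gcongr
  have n₂ : decayConst A c R ‖ζ₂‖ * Real.exp (-(2 * c * (x - b))) * amp v₂ q₂ b ≤
      decayConst A c R t * Real.exp (-(2 * c * (x - b))) * amp v₂ q₂ b := by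
    have := amp_nonneg v₂ q₂ b
    gcongr
  nlinarith

lemma amp_add_tendsto (hP : Coercive a Λ A c R) (hζ₁ : ζ₁ ∈ halfPlane Λ) (hζ₂ : ζ₂ ∈ halfPlane Λ)
    (h₁ : IsSol a ζ₁ v₁ q₁) (h₂ : IsSol a ζ₂ v₂ q₂) (hb₁ : FwdBdd v₁ q₁) (hb₂ : FwdBdd v₂ q₂) :
    Tendsto (fun x => amp v₁ q₁ x + amp v₂ q₂ x) atTop (𝓝 0) := by
  have hc := hP.c_pos
  have ht : Tendsto (fun x : ℝ => decayConst A c R (max ‖ζ₁‖ ‖ζ₂‖) * (amp v₁ q₁ 0 + amp v₂ q₂ 0) *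
      Real.exp (-(2 * c * (x - 0)))) atTop (𝓝 0) := by
    have h0 : Tendsto (fun x : ℝ => 2 * c * (x - 0)) atTop atTop :=
      Tendsto.const_mul_atTop (by positivity) (tendsto_atTop_add_const_right _ _ tendsto_id)
    simpa using (Real.tendsto_exp_neg_atTop_nhds_zero.comp h0).const_mul
      (decayConst A c R (max ‖ζ₁‖ ‖ζ₂‖) * (amp v₁ q₁ 0 + amp v₂ q₂ 0))
  refine squeeze_zero' (Eventually.of_forall fun x => ?_) ?_ ht
  · exact add_nonneg (amp_nonneg _ _ _) (amp_nonneg _ _ _)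
  · filter_upwards [eventually_ge_atTop 0] with x hx
    exact amp_add_decay hP hζ₁ hζ₂ h₁ h₂ hb₁ hb₂ (le_max_left _ _) (le_max_right _ _) le_rfl hx

lemma wronsk_tendsto (hP : Coercive a Λ A c R) (hζ₁ : ζ₁ ∈ halfPlane Λ) (hζ₂ : ζ₂ ∈ halfPlane Λ)
    (h₁ : IsSol a ζ₁ v₁ q₁) (h₂ : IsSol a ζ₂ v₂ q₂) (hb₁ : FwdBdd v₁ q₁) (hb₂ : FwdBdd v₂ q₂) :
    Tendsto (wronsk v₁ q₁ v₂ q₂) atTop (𝓝 0) :=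
  squeeze_zero_norm (fun x => norm_wronsk_le_amp v₁ q₁ v₂ q₂ x)
    (amp_add_tendsto hP hζ₁ hζ₂ h₁ h₂ hb₁ hb₂)

lemma integrableOn_mul (hP : Coercive a Λ A c R) (hζ₁ : ζ₁ ∈ halfPlane Λ) (hζ₂ : ζ₂ ∈ halfPlane Λ)
    (h₁ : IsSol a ζ₁ v₁ q₁) (h₂ : IsSol a ζ₂ v₂ q₂) (hb₁ : FwdBdd v₁ q₁) (hb₂ : FwdBdd v₂ q₂)
    {b : ℝ} (hb : 0 ≤ b) : IntegrableOn (fun x => v₁ x * v₂ x) (Ioi b) := by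
  refine Integrable.mono' (integrableOn_exp_decay hP.c_pos
    (decayConst A c R (max ‖ζ₁‖ ‖ζ₂‖) * (amp v₁ q₁ b + amp v₂ q₂ b)) b)
    (h₁.cont_v.mul h₂.cont_v).aestronglyMeasurable ?_
  filter_upwards [ae_restrict_mem measurableSet_Ioi] with x hx
  exact (norm_mul_le_amp v₁ q₁ v₂ q₂ x).trans
    (amp_add_decay hP hζ₁ hζ₂ h₁ h₂ hb₁ hb₂ (le_max_left _ _) (le_max_right _ _) hb (le_of_lt hx))

/-- Integrated Lagrange identity; the boundary term at infinity vanishes because both solutions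
decay. -/
lemma mul_integral_eq_neg_wronsk (hP : Coercive a Λ A c R) (hζ₁ : ζ₁ ∈ halfPlane Λ)
    (hζ₂ : ζ₂ ∈ halfPlane Λ) (h₁ : IsSol a ζ₁ v₁ q₁) (h₂ : IsSol a ζ₂ v₂ q₂) (hb₁ : FwdBdd v₁ q₁)
    (hb₂ : FwdBdd v₂ q₂) {b : ℝ} (hb : 0 ≤ b) :
    (ζ₂ - ζ₁) * ∫ x in Ioi b, v₁ x * v₂ x = -wronsk v₁ q₁ v₂ q₂ b := by
  have h := integral_Ioi_of_hasDerivAt_of_tendsto' (a := b)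
    (fun x _ => h₁.wronsk_deriv h₂ x)
    ((integrableOn_mul hP hζ₁ hζ₂ h₁ h₂ hb₁ hb₂ hb).const_mul (ζ₂ - ζ₁))
    (wronsk_tendsto hP hζ₁ hζ₂ h₁ h₂ hb₁ hb₂)
  rw [integral_const_mul, zero_sub] at h
  exact h

end

lemma wronsk_eq_zero_of_fwdBdd {a : ℝ → ℝ} {Λ A c R : ℝ} {ζ : ℂ} {v₁ q₁ v₂ q₂ : ℝ → ℂ}
    (hP : Coercive a Λ A c R) (hζ : ζ ∈ halfPlane Λ) (h₁ : IsSol a ζ v₁ q₁)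
    (h₂ : IsSol a ζ v₂ q₂) (hb₁ : FwdBdd v₁ q₁) (hb₂ : FwdBdd v₂ q₂) (x : ℝ) :
    wronsk v₁ q₁ v₂ q₂ x = 0 := by
  have h := wronsk_tendsto hP hζ hζ h₁ h₂ hb₁ hb₂
  refine tendsto_nhds_unique (tendsto_const_nhds.congr fun y => ?_) h
  exact h₁.wronsk_const h₂ x y

section

variable {a : ℝ → ℝ} {Λ A c R : ℝ} {ζ₀ : ℂ} {v q : ℂ → ℝ → ℂ} {b : ℝ}

lemma eventually_amp_le (hv : ContinuousAt (fun ζ => v ζ b) ζ₀)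
    (hq : ContinuousAt (fun ζ => q ζ b) ζ₀) :
    ∀ᶠ ζ in 𝓝 ζ₀, amp (v ζ) (q ζ) b ≤ amp (v ζ₀) (q ζ₀) b + 1 := by
  have h : ContinuousAt (fun ζ => amp (v ζ) (q ζ) b) ζ₀ := (hv.norm.pow 2).add (hq.norm.pow 2)
  exact h.eventually_le_const (by linarith)

lemma eventually_norm_mul_le (hP : Coercive a Λ A c R) (hs : ∀ᶠ ζ in 𝓝 ζ₀, IsSol a ζ (v ζ) (q ζ))
    (hv : ContinuousAt (fun ζ => v ζ b) ζ₀) (hq : ContinuousAt (fun ζ => q ζ b) ζ₀) (x : ℝ)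
    {w r : ℝ → ℂ} (hw : IsSol a ζ₀ w r) : ∃ C, ∀ᶠ ζ in 𝓝 ζ₀, ∀ y ∈ uIcc b x, ‖v ζ y * w y‖ ≤ C := by
  have hA : 0 ≤ A := (abs_nonneg _).trans (hP.bdd 0)
  refine ⟨Real.exp ((1 + A + (‖ζ₀‖ + 1)) * |x - b|) * (amp (v ζ₀) (q ζ₀) b + 1) +
    Real.exp ((1 + A + (‖ζ₀‖ + 1)) * |x - b|) * amp w r b, ?_⟩
  filter_upwards [hs, eventually_amp_le hv hq, eventually_norm_le ζ₀] with ζ h1 h2 h3 y hy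
  have hy' : |y - b| ≤ |x - b| := abs_sub_left_of_mem_uIcc hy
  refine (norm_mul_le_amp (v ζ) (q ζ) w r y).trans (add_le_add ?_ ?_)
  · refine (h1.amp_le_exp (hP.growth ζ) y b).trans ?_
    have := amp_nonneg (v ζ) (q ζ) b
    gcongr
  · refine (hw.amp_le_exp (hP.growth ζ₀) y b).trans ?_
    have := amp_nonneg w r b
    gcongr
    linarith

/-- This starts a bootstrap: boundedness of the integral gives continuity of the Wronskian in `ζ`,
continuity gives convergence of the integral, and convergence gives differentiability. -/
lemma eventually_wronsk_eq (hs : ∀ᶠ ζ in 𝓝 ζ₀, IsSol a ζ (v ζ) (q ζ)) (x : ℝ) {w r : ℝ → ℂ}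
    (hw : IsSol a ζ₀ w r) :
    ∀ᶠ ζ in 𝓝 ζ₀, wronsk (v ζ) (q ζ) w r x =
      wronsk (v ζ) (q ζ) w r b + (ζ - ζ₀) * -∫ y in b..x, v ζ y * w y := by
  filter_upwards [hs] with ζ h1
  have h := intervalIntegral.integral_eq_sub_of_hasDerivAt (a := b) (b := x)
    (fun y _ => h1.wronsk_deriv hw y)
    (Continuous.intervalIntegrable (continuous_const.mul (h1.cont_v.mul hw.cont_v)) _ _)
  rw [intervalIntegral.integral_const_mul] at h
  linear_combination -h

lemma tendsto_wronsk (hP : Coercive a Λ A c R) (hs : ∀ᶠ ζ in 𝓝 ζ₀, IsSol a ζ (v ζ) (q ζ))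
    (hv : ContinuousAt (fun ζ => v ζ b) ζ₀) (hq : ContinuousAt (fun ζ => q ζ b) ζ₀) (x : ℝ)
    {w r : ℝ → ℂ} (hw : IsSol a ζ₀ w r) :
    Tendsto (fun ζ => wronsk (v ζ) (q ζ) w r x) (𝓝 ζ₀) (𝓝 (wronsk (v ζ₀) (q ζ₀) w r x)) := by
  obtain ⟨C, hC⟩ := eventually_norm_mul_le hP hs hv hq x hw
  have hev := eventually_wronsk_eq (b := b) hs x hw
  have h1 : Tendsto (fun ζ => wronsk (v ζ) (q ζ) w r b) (𝓝 ζ₀)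
      (𝓝 (wronsk (v ζ₀) (q ζ₀) w r b)) :=
    (hv.mul continuousAt_const).sub (hq.mul continuousAt_const)
  have h2 : Tendsto (fun ζ => (ζ - ζ₀) * -∫ y in b..x, v ζ y * w y) (𝓝 ζ₀) (𝓝 0) := by
    refine Tendsto.zero_mul_isBoundedUnder_le ?_ ?_
    · exact tendsto_sub_nhds_zero_iff.2 tendsto_id
    · refine isBoundedUnder_of_eventually_le (a := C * |x - b|) ?_
      filter_upwards [hC] with ζ h
      simp only [Function.comp, norm_neg]
      exact intervalIntegral.norm_integral_le_of_norm_le_const fun y hy =>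
        h y (uIoc_subset_uIcc hy)
  have h0 : wronsk (v ζ₀) (q ζ₀) w r x = wronsk (v ζ₀) (q ζ₀) w r b := by
    simpa using hev.self_of_nhds
  rw [h0]
  have h3 := h1.add h2
  rw [add_zero] at h3
  exact h3.congr' (hev.mono fun ζ h => h.symm)

/-- The coordinates `v`, `q` at `x` are the Wronskians against the solutions with data `(0, 1)` and
`(-1, 0)` at `x`. -/
lemma continuousAt_solution (hP : Coercive a Λ A c R) (hs : ∀ᶠ ζ in 𝓝 ζ₀, IsSol a ζ (v ζ) (q ζ))
    (hv : ContinuousAt (fun ζ => v ζ b) ζ₀) (hq : ContinuousAt (fun ζ => q ζ b) ζ₀) (x : ℝ) :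
    ContinuousAt (fun ζ => v ζ x) ζ₀ ∧ ContinuousAt (fun ζ => q ζ x) ζ₀ := by
  obtain ⟨w₁, r₁, hw₁, e₁, e₁'⟩ := IsSol.exists_of_data hP.cont hP.bdd ζ₀ x 0 1
  obtain ⟨w₂, r₂, hw₂, e₂, e₂'⟩ := IsSol.exists_of_data hP.cont hP.bdd ζ₀ x (-1) 0
  have h1 := tendsto_wronsk hP hs hv hq x hw₁
  have h2 := tendsto_wronsk hP hs hv hq x hw₂
  simp only [wronsk, e₁, e₁', e₂, e₂', mul_one, mul_zero, sub_zero, mul_neg, zero_sub,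
    neg_neg] at h1 h2
  exact ⟨h1, h2⟩

lemma tendsto_interval_integral (hP : Coercive a Λ A c R) (hs : ∀ᶠ ζ in 𝓝 ζ₀, IsSol a ζ (v ζ) (q ζ))
    (hv : ContinuousAt (fun ζ => v ζ b) ζ₀) (hq : ContinuousAt (fun ζ => q ζ b) ζ₀) (x : ℝ)
    {w r : ℝ → ℂ} (hw : IsSol a ζ₀ w r) :
    Tendsto (fun ζ => ∫ y in b..x, v ζ y * w y) (𝓝 ζ₀) (𝓝 (∫ y in b..x, v ζ₀ y * w y)) := by
  obtain ⟨C, hC⟩ := eventually_norm_mul_le hP hs hv hq x hw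
  refine intervalIntegral.tendsto_integral_filter_of_dominated_convergence (fun _ => C) ?_ ?_
    intervalIntegrable_const ?_
  · filter_upwards [hs] with ζ h
    exact (h.cont_v.mul hw.cont_v).aestronglyMeasurable
  · filter_upwards [hC] with ζ h
    exact ae_of_all _ fun y hy => h y (uIoc_subset_uIcc hy)
  · refine ae_of_all _ fun y _ => ?_
    exact ((continuousAt_solution hP hs hv hq y).1.mul continuousAt_const)

/-- Differentiability in the spectral parameter propagates along solutions. -/
theorem differentiableAt_solution (hP : Coercive a Λ A c R)
    (hs : ∀ᶠ ζ in 𝓝 ζ₀, IsSol a ζ (v ζ) (q ζ)) (hv : DifferentiableAt ℂ (fun ζ => v ζ b) ζ₀)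
    (hq : DifferentiableAt ℂ (fun ζ => q ζ b) ζ₀) (x : ℝ) :
    DifferentiableAt ℂ (fun ζ => v ζ x) ζ₀ ∧ DifferentiableAt ℂ (fun ζ => q ζ x) ζ₀ := by
  have key : ∀ w r, IsSol a ζ₀ w r →
      DifferentiableAt ℂ (fun ζ => wronsk (v ζ) (q ζ) w r x) ζ₀ := by
    intro w r hw
    have h1 := (tendsto_interval_integral hP hs hv.continuousAt hq.continuousAt x hw).neg
    have h2 : DifferentiableAt ℂ (fun ζ => (ζ - ζ₀) * -∫ y in b..x, v ζ y * w y) ζ₀ :=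
      (hasDerivAt_of_eventuallyEq_sub_mul h1 (Eventually.of_forall fun _ => rfl)).differentiableAt
    have h3 : DifferentiableAt ℂ (fun ζ => wronsk (v ζ) (q ζ) w r b) ζ₀ :=
      (hv.mul (differentiableAt_const _)).sub (hq.mul (differentiableAt_const _))
    exact (h3.add h2).congr_of_eventuallyEq (eventually_wronsk_eq hs x hw)
  obtain ⟨w₁, r₁, hw₁, e₁, e₁'⟩ := IsSol.exists_of_data hP.cont hP.bdd ζ₀ x 0 1
  obtain ⟨w₂, r₂, hw₂, e₂, e₂'⟩ := IsSol.exists_of_data hP.cont hP.bdd ζ₀ x (-1) 0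
  have h1 := key _ _ hw₁
  have h2 := key _ _ hw₂
  simp only [wronsk, e₁, e₁', e₂, e₂', mul_one, mul_zero, sub_zero, mul_neg, zero_sub,
    neg_neg] at h1 h2
  exact ⟨h1, h2⟩

/-- The derivative of the Wronskian of a family of solutions bounded on `[0, ∞)` against its
member at `ζ₀`. -/
theorem hasDerivAt_wronsk_fwdBdd (hP : Coercive a Λ A c R)
    (hs : ∀ᶠ ζ in 𝓝 ζ₀, IsSol a ζ (v ζ) (q ζ)) (hv : ContinuousAt (fun ζ => v ζ b) ζ₀)
    (hq : ContinuousAt (fun ζ => q ζ b) ζ₀) (hζ₀ : ζ₀ ∈ halfPlane Λ)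
    (hbd : ∀ᶠ ζ in 𝓝 ζ₀, FwdBdd (v ζ) (q ζ)) (hb : 0 ≤ b) :
    HasDerivAt (fun ζ => wronsk (v ζ) (q ζ) (v ζ₀) (q ζ₀) b)
      (∫ x in Ioi b, v ζ₀ x * v ζ₀ x) ζ₀ := by
  refine hasDerivAt_of_eventuallyEq_sub_mul (f := fun ζ => ∫ x in Ioi b, v ζ x * v ζ₀ x) ?_ ?_
  -- For `ζ` near `ζ₀` the decay constants and the amplitudes at `b` are uniformly bounded, which
  -- supplies one exponential majorant.
  · refine tendsto_integral_filter_of_dominated_convergence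
      (fun x => decayConst A c R (‖ζ₀‖ + 1) * (amp (v ζ₀) (q ζ₀) b + 1 + amp (v ζ₀) (q ζ₀) b) *
        Real.exp (-(2 * c * (x - b)))) ?_ ?_ (integrableOn_exp_decay hP.c_pos _ b) ?_
    · filter_upwards [hs] with ζ h
      exact (h.cont_v.mul hs.self_of_nhds.cont_v).aestronglyMeasurable
    · filter_upwards [hs, hbd, (isOpen_halfPlane Λ).mem_nhds hζ₀, eventually_norm_le ζ₀,
        eventually_amp_le hv hq] with ζ h1 h2 h3 h4 h5
      filter_upwards [ae_restrict_mem measurableSet_Ioi] with x hx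
      refine (norm_mul_le_amp (v ζ) (q ζ) (v ζ₀) (q ζ₀) x).trans
        ((amp_add_decay hP h3 hζ₀ h1 hs.self_of_nhds h2 hbd.self_of_nhds h4 (by linarith) hb
        (le_of_lt hx)).trans ?_)
      have := decayConst_pos (A := A) (R := R) (t := ‖ζ₀‖ + 1) hP.c_pos
      gcongr
    · refine ae_of_all _ fun y => ?_
      exact ((continuousAt_solution hP hs hv hq y).1.mul continuousAt_const)
  · filter_upwards [hs, hbd, (isOpen_halfPlane Λ).mem_nhds hζ₀] with ζ h1 h2 h3
    have := mul_integral_eq_neg_wronsk hP h3 hζ₀ h1 hs.self_of_nhds h2 hbd.self_of_nhds hb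
    linear_combination this

end

/-- The solution bounded on `[0, ∞)`, normalised at `R`, depends analytically on `ζ`. -/
theorem differentiableAt_normalised {a : ℝ → ℝ} {Λ A c R : ℝ} {v q : ℂ → ℝ → ℂ}
    (hP : Coercive a Λ A c R) (hs : ∀ ζ ∈ halfPlane Λ, IsSol a ζ (v ζ) (q ζ))
    (hbd : ∀ ζ ∈ halfPlane Λ, FwdBdd (v ζ) (q ζ)) (hn : ∀ ζ ∈ halfPlane Λ, v ζ R = 1)
    {ζ₀ : ℂ} (hζ₀ : ζ₀ ∈ halfPlane Λ) (x : ℝ) :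
    DifferentiableAt ℂ (fun ζ => v ζ x) ζ₀ ∧ DifferentiableAt ℂ (fun ζ => q ζ x) ζ₀ := by
  have hmem := (isOpen_halfPlane Λ).mem_nhds hζ₀
  have hs' : ∀ᶠ ζ in 𝓝 ζ₀, IsSol a ζ (v ζ) (q ζ) := mem_of_superset hmem hs
  have hbd' : ∀ᶠ ζ in 𝓝 ζ₀, FwdBdd (v ζ) (q ζ) := mem_of_superset hmem hbd
  have hn' : (fun ζ => v ζ R) =ᶠ[𝓝 ζ₀] fun _ => 1 := mem_of_superset hmem hn
  have hA : 0 ≤ A := (abs_nonneg _).trans (hP.bdd 0)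
  have hc := hP.c_pos
  have hv : DifferentiableAt ℂ (fun ζ => v ζ R) ζ₀ :=
    (differentiableAt_const _).congr_of_eventuallyEq hn'
  -- Both solutions equal `1` at `R`, so their Wronskian there is the increment of `q`; regularity
  -- of `q ζ R` is read off from it.
  have hW : (fun ζ => wronsk (v ζ) (q ζ) (v ζ₀) (q ζ₀) R) =ᶠ[𝓝 ζ₀] fun ζ => q ζ₀ R - q ζ R := by
    filter_upwards [hn'] with ζ h
    simp [wronsk, h, hn ζ₀ hζ₀]
  have hq : ContinuousAt (fun ζ => q ζ R) ζ₀ := by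
    set t := ‖ζ₀‖ + 1 with ht
    set k := c * Real.exp (-(1 + A + t)) with hk
    have hk0 : 0 < k := by positivity
    -- A locally uniform bound, available before any continuity in `ζ`: since `v ζ R = 1`, `k * (1 +
    -- |q|²) ≤ -lyap ≤ |q|` forces `k * |q| ≤ 1`.
    have hamp : ∀ ζ ∈ halfPlane Λ, ‖ζ‖ ≤ t → amp (v ζ) (q ζ) R ≤ (k⁻¹) ^ 2 := by
      intro ζ hζ hle
      have h1 := (hs ζ hζ).amp_le_neg_lyap hP hζ
        (fun _ hx => (hs ζ hζ).lyap_nonpos hP hζ (hbd ζ hζ) hx) le_rfl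
      have h2 : k ≤ c * Real.exp (-(1 + A + ‖ζ‖)) := by rw [hk]; gcongr
      have h3 : k * amp (v ζ) (q ζ) R ≤ ‖q ζ R‖ := by
        calc k * amp (v ζ) (q ζ) R ≤ c * Real.exp (-(1 + A + ‖ζ‖)) * amp (v ζ) (q ζ) R := by
              have := amp_nonneg (v ζ) (q ζ) R
              gcongr
          _ ≤ -lyap (v ζ) (q ζ) R := h1
          _ ≤ |lyap (v ζ) (q ζ) R| := neg_le_abs _
          _ ≤ ‖v ζ R‖ * ‖q ζ R‖ := abs_real_inner_le_norm _ _
          _ = ‖q ζ R‖ := by simp [hn ζ hζ]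
      have h4 : amp (v ζ) (q ζ) R = 1 + ‖q ζ R‖ ^ 2 := by simp [amp, hn ζ hζ]
      have h5 : k * ‖q ζ R‖ ≤ 1 := by
        by_contra! hcon
        have : ‖q ζ R‖ < k * ‖q ζ R‖ * ‖q ζ R‖ ∨ ‖q ζ R‖ = 0 := by
          rcases (norm_nonneg (q ζ R)).eq_or_lt with h | h
          · exact Or.inr h.symm
          · left; nlinarith
        rcases this with h | h
        · nlinarith
        · rw [h] at hcon; linarith
      have h6 : amp (v ζ) (q ζ) R * k ^ 2 ≤ 1 := by nlinarith
      rw [inv_pow, ← one_div, le_div_iff₀ (by positivity)]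
      exact h6
    have hlim : Tendsto (fun ζ => wronsk (v ζ) (q ζ) (v ζ₀) (q ζ₀) R) (𝓝 ζ₀) (𝓝 0) := by
      have h2 : Tendsto (fun ζ => (ζ - ζ₀) * ∫ x in Ioi R, v ζ x * v ζ₀ x) (𝓝 ζ₀) (𝓝 0) := by
        refine Tendsto.zero_mul_isBoundedUnder_le ?_ ?_
        · exact tendsto_sub_nhds_zero_iff.2 tendsto_id
        · refine isBoundedUnder_of_eventually_le (a := ∫ x in Ioi R,
            decayConst A c R t * ((k⁻¹) ^ 2 + (k⁻¹) ^ 2) * Real.exp (-(2 * c * (x - R)))) ?_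
          filter_upwards [hmem, eventually_norm_le ζ₀] with ζ h3 h4
          refine norm_integral_le_of_norm_le (integrableOn_exp_decay hP.c_pos _ R) ?_
          filter_upwards [ae_restrict_mem measurableSet_Ioi] with x hx
          refine (norm_mul_le_amp (v ζ) (q ζ) (v ζ₀) (q ζ₀) x).trans
            ((amp_add_decay hP h3 hζ₀ (hs ζ h3) (hs ζ₀ hζ₀) (hbd ζ h3) (hbd ζ₀ hζ₀) h4
            (by linarith) hP.R_nonneg (le_of_lt hx)).trans ?_)
          have := decayConst_pos (A := A) (R := R) (t := t) hP.c_pos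
          have := hamp ζ h3 h4
          have := hamp ζ₀ hζ₀ (by linarith)
          gcongr
      refine h2.congr' ?_
      filter_upwards [hmem] with ζ h3
      have := mul_integral_eq_neg_wronsk hP h3 hζ₀ (hs ζ h3) (hs ζ₀ hζ₀) (hbd ζ h3) (hbd ζ₀ hζ₀)
        hP.R_nonneg
      linear_combination -this
    have h1 := (hlim.congr' hW).const_sub (q ζ₀ R)
    simp only [sub_sub_cancel, sub_zero] at h1
    exact h1
  have hq' : DifferentiableAt ℂ (fun ζ => q ζ R) ζ₀ := by
    have h1 := (hasDerivAt_wronsk_fwdBdd hP hs' hv.continuousAt hq hζ₀ hbd'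
      hP.R_nonneg).differentiableAt.congr_of_eventuallyEq hW.symm
    simpa using h1.const_sub (q ζ₀ R)
  exact differentiableAt_solution hP hs' hv hq' x

/-! ### Exponential dichotomies and their characterisation by bounded solutions. -/

/-- The coefficient matrix of `v' = q`, `q' = (a(x) + ζ) v`. -/
def sysMat (a : ℝ → ℝ) (ζ : ℂ) (x : ℝ) : Matrix (Fin 2) (Fin 2) ℂ := !![0, 1; (a x : ℂ) + ζ, 0]

lemma isSolution_iff {a : ℝ → ℝ} {ζ : ℂ} {φ : ℝ → Fin 2 → ℂ} :
    IsSolution (sysMat a ζ) φ ↔ IsSol a ζ (fun x => φ x 0) (fun x => φ x 1) := by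
  have e : ∀ x, sysMat a ζ x *ᵥ φ x = ![φ x 1, (a x + ζ) * φ x 0] := fun x => by
    ext i
    fin_cases i <;> simp [sysMat, mulVec, dotProduct, Fin.sum_univ_two]
  constructor
  · intro h
    have h' : ∀ x, ∀ i, HasDerivAt (fun x => φ x i) (![φ x 1, (a x + ζ) * φ x 0] i) x := fun x =>
      hasDerivAt_pi.1 (e x ▸ h x)
    exact ⟨fun x => h' x 0, fun x => h' x 1⟩
  · intro h x
    rw [e]
    refine hasDerivAt_pi.2 fun i => ?_
    fin_cases i
    · exact h.dv x
    · exact h.dq x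

lemma IsSol.isSolution {a : ℝ → ℝ} {ζ : ℂ} {v q : ℝ → ℂ} (h : IsSol a ζ v q) :
    IsSolution (sysMat a ζ) (fun x => ![v x, q x]) := isSolution_iff.2 h

lemma norm_vec_sq_le_amp (v q : ℝ → ℂ) (x : ℝ) : ‖![v x, q x]‖ ^ 2 ≤ amp v q x := by
  have h : ‖![v x, q x]‖ ≤ Real.sqrt (amp v q x) := by
    rw [pi_norm_le_iff_of_nonneg (Real.sqrt_nonneg _), Fin.forall_fin_two]
    constructor <;> refine Real.le_sqrt_of_sq_le ?_ <;> simp [amp]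
  calc ‖![v x, q x]‖ ^ 2 ≤ Real.sqrt (amp v q x) ^ 2 := by gcongr
    _ = _ := Real.sq_sqrt (amp_nonneg _ _ _)

lemma amp_le_norm_vec_sq (v q : ℝ → ℂ) (x : ℝ) : amp v q x ≤ 2 * ‖![v x, q x]‖ ^ 2 := by
  have h0 : ‖v x‖ ≤ ‖![v x, q x]‖ := norm_le_pi_norm ![v x, q x] 0
  have h1 : ‖q x‖ ≤ ‖![v x, q x]‖ := norm_le_pi_norm ![v x, q x] 1
  unfold amp
  have e0 : ‖v x‖ ^ 2 ≤ ‖![v x, q x]‖ ^ 2 := by gcongr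
  have e1 : ‖q x‖ ^ 2 ≤ ‖![v x, q x]‖ ^ 2 := by gcongr
  linarith

/-- The combination `|v₂|² (-L₁) + |v₁|² L₂` is the real part of `conj (v₁ v₂)` times the Wronskian;
Cauchy–Schwarz and the arithmetic–geometric mean inequality finish. With Wronskian `1` this bounds
the product of a decaying and a growing amplitude. -/
lemma four_mul_lyap_le (v₁ q₁ v₂ q₂ : ℝ → ℂ) (x : ℝ) (h₁ : lyap v₁ q₁ x ≤ 0)
    (h₂ : 0 ≤ lyap v₂ q₂ x) :
    4 * (-lyap v₁ q₁ x * lyap v₂ q₂ x) ≤ ‖wronsk v₁ q₁ v₂ q₂ x‖ ^ 2 := by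
  have hid : ‖v₂ x‖ ^ 2 * -lyap v₁ q₁ x + ‖v₁ x‖ ^ 2 * lyap v₂ q₂ x =
      inner ℝ (v₁ x * v₂ x) (wronsk v₁ q₁ v₂ q₂ x) := by
    simp only [lyap, wronsk, Complex.inner, ← Complex.normSq_eq_norm_sq, Complex.normSq_apply]
    simp
    ring
  have hle := (le_abs_self _).trans
    (abs_real_inner_le_norm (v₁ x * v₂ x) (wronsk v₁ q₁ v₂ q₂ x))
  rw [← hid, norm_mul] at hle
  by_cases h0 : v₁ x = 0
  · simp [lyap, h0]
  by_cases h0' : v₂ x = 0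
  · simp [lyap, h0']
  have hp : 0 < ‖v₁ x‖ * ‖v₂ x‖ := mul_pos (norm_pos_iff.2 h0) (norm_pos_iff.2 h0')
  set α := -lyap v₁ q₁ x
  have hα : 0 ≤ α := neg_nonneg.2 h₁
  set β := lyap v₂ q₂ x
  have hL : 0 ≤ ‖v₂ x‖ ^ 2 * α + ‖v₁ x‖ ^ 2 * β := by positivity
  have h3 : (‖v₂ x‖ ^ 2 * α + ‖v₁ x‖ ^ 2 * β) ^ 2 ≤
      (‖v₁ x‖ * ‖v₂ x‖ * ‖wronsk v₁ q₁ v₂ q₂ x‖) ^ 2 := by gcongr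
  have h4 : (‖v₁ x‖ * ‖v₂ x‖) ^ 2 * (4 * (α * β)) ≤
      (‖v₁ x‖ * ‖v₂ x‖) ^ 2 * ‖wronsk v₁ q₁ v₂ q₂ x‖ ^ 2 := by
    nlinarith [sq_nonneg (‖v₂ x‖ ^ 2 * α - ‖v₁ x‖ ^ 2 * β)]
  exact le_of_mul_le_mul_left h4 (by positivity)

lemma norm_smul_vec_le {v₁ q₁ v₂ q₂ : ℝ → ℂ} {x y K μ : ℝ} (hK : 0 ≤ K)
    (h : amp v₁ q₁ x * amp v₂ q₂ y ≤ (K * Real.exp μ) ^ 2) {k : ℂ} {ξ : Fin 2 → ℂ}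
    (hk : ‖k‖ ≤ ‖q₂ y‖ * ‖ξ 0‖ + ‖v₂ y‖ * ‖ξ 1‖) :
    ‖k • ![v₁ x, q₁ x]‖ ≤ 2 * K * Real.exp μ * ‖ξ‖ := by
  have h0 := norm_le_pi_norm ξ 0
  have h1 := norm_le_pi_norm ξ 1
  have hk2 : ‖k‖ ^ 2 ≤ 4 * amp v₂ q₂ y * ‖ξ‖ ^ 2 := by
    have e1 : ‖k‖ ≤ (‖q₂ y‖ + ‖v₂ y‖) * ‖ξ‖ := by
      refine hk.trans ?_
      rw [add_mul]
      gcongr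
    calc ‖k‖ ^ 2 ≤ ((‖q₂ y‖ + ‖v₂ y‖) * ‖ξ‖) ^ 2 := by gcongr
      _ = (‖q₂ y‖ + ‖v₂ y‖) ^ 2 * ‖ξ‖ ^ 2 := by ring
      _ ≤ _ := by
        gcongr
        unfold amp
        nlinarith [sq_nonneg (‖q₂ y‖ - ‖v₂ y‖), sq_nonneg ‖q₂ y‖, sq_nonneg ‖v₂ y‖]
  refine abs_le_of_sq_le_sq' ?_ (by positivity) |>.2
  rw [norm_smul, mul_pow]
  calc ‖k‖ ^ 2 * ‖![v₁ x, q₁ x]‖ ^ 2 ≤ (4 * amp v₂ q₂ y * ‖ξ‖ ^ 2) * amp v₁ q₁ x := by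
        have := amp_nonneg v₂ q₂ y
        gcongr
        exact norm_vec_sq_le_amp v₁ q₁ x
    _ = 4 * ‖ξ‖ ^ 2 * (amp v₁ q₁ x * amp v₂ q₂ y) := by ring
    _ ≤ 4 * ‖ξ‖ ^ 2 * (K * Real.exp μ) ^ 2 := by gcongr
    _ = _ := by ring

/-- The projection runs along the growing solution onto the decaying one. No separate growth
estimate is needed: the product of the two amplitudes is bounded, so the decay of one factor drives
both bounds. -/
theorem exists_dichotomy_Ici {a : ℝ → ℝ} {Λ A c R : ℝ} {ζ : ℂ} (hP : Coercive a Λ A c R)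
    (hζ : ζ ∈ halfPlane Λ) : ∃ P K μ, HasExpDichotomyOn (sysMat a ζ) (Ici 0) K μ P := by
  obtain ⟨v₁, q₁, h₁, hb, hv₁⟩ := exists_fwdBdd hP hζ
  -- Vanishing `v₂` at `R` makes `lyap` zero there, hence non-negative afterwards; slope `1`
  -- normalises the Wronskian.
  obtain ⟨v₂, q₂, h₂, hv₂, hq₂⟩ := IsSol.exists_of_data hP.cont hP.bdd ζ R 0 1
  have hw : ∀ x, wronsk v₁ q₁ v₂ q₂ x = 1 := fun x => by
    rw [h₁.wronsk_const h₂ x R]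
    simp [wronsk, hv₁, hv₂, hq₂]
  have hc := hP.c_pos
  have hR := hP.R_nonneg
  set M := 1 + A + ‖ζ‖
  set k := c * Real.exp (-M) with hk
  have hk0 : 0 < k := by positivity
  have hneg : ∀ x, R ≤ x → lyap v₁ q₁ x ≤ 0 := fun _ hx => h₁.lyap_nonpos hP hζ hb hx
  have hpos : lyap v₂ q₂ R = 0 := by simp [lyap, hv₂]
  have hprod : ∀ x, R + 1 ≤ x → amp v₁ q₁ x * amp v₂ q₂ x ≤ (k⁻¹) ^ 2 := by
    intro x hx
    have e₁ := h₁.amp_le_neg_lyap hP hζ hneg (show R ≤ x by linarith)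
    have e₂ := h₂.amp_le_lyap hP hζ hpos.ge hx
    have n₁ := amp_nonneg v₁ q₁ x
    have n₂ := amp_nonneg v₂ q₂ x
    have e₃ := four_mul_lyap_le v₁ q₁ v₂ q₂ x (hneg x (by linarith))
      (le_trans (by positivity) e₂)
    rw [hw, norm_one, one_pow] at e₃
    have e₄ : (k * amp v₁ q₁ x) * (k * amp v₂ q₂ x) ≤ -lyap v₁ q₁ x * lyap v₂ q₂ x :=
      mul_le_mul e₁ e₂ (by positivity) (le_trans (by positivity) e₁)
    rw [inv_pow, ← one_div, le_div_iff₀ (by positivity)]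
    nlinarith
  -- Both kernels `T P` and `T (1 - P)` have rank one, and the same amplitude product, with the
  -- decaying solution taken at the later point, bounds either of them.
  have hkey : ∀ x y, 0 ≤ x → x ≤ y → amp v₁ q₁ y * amp v₂ q₂ x ≤
      (Real.sqrt (decayConst A c R ‖ζ‖) * (Real.exp (M * (R + 1)) * k⁻¹) *
        Real.exp (-c * (y - x))) ^ 2 := by
    intro x y hx hxy
    have d := h₁.amp_decay hP hζ hb hx hxy
    have c₁ := (h₁.amp_le_clip hP x hx (ρ := R + 1) (by linarith)).1
    have c₂ := (h₂.amp_le_clip hP x hx (ρ := R + 1) (by linarith)).1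
    have n₂ := amp_nonneg v₂ q₂ x
    have n₁' := amp_nonneg v₁ q₁ (max x (R + 1))
    have hD := decayConst_pos (A := A) (R := R) (t := ‖ζ‖) hc
    have p := hprod (max x (R + 1)) (le_max_right _ _)
    calc amp v₁ q₁ y * amp v₂ q₂ x ≤
        decayConst A c R ‖ζ‖ * Real.exp (-(2 * c * (y - x))) * amp v₁ q₁ x * amp v₂ q₂ x := by
          gcongr
      _ = decayConst A c R ‖ζ‖ * Real.exp (-(2 * c * (y - x))) *
          (amp v₁ q₁ x * amp v₂ q₂ x) := by ring
      _ ≤ decayConst A c R ‖ζ‖ * Real.exp (-(2 * c * (y - x))) *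
          ((Real.exp (M * (R + 1)) * amp v₁ q₁ (max x (R + 1))) *
          (Real.exp (M * (R + 1)) * amp v₂ q₂ (max x (R + 1)))) := by gcongr
      _ = decayConst A c R ‖ζ‖ * Real.exp (-(2 * c * (y - x))) * (Real.exp (M * (R + 1)) ^ 2 *
          (amp v₁ q₁ (max x (R + 1)) * amp v₂ q₂ (max x (R + 1)))) := by ring
      _ ≤ decayConst A c R ‖ζ‖ * Real.exp (-(2 * c * (y - x))) * (Real.exp (M * (R + 1)) ^ 2 *
          (k⁻¹) ^ 2) := by gcongr
      _ = _ := by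
        rw [mul_pow, mul_pow (Real.sqrt _), Real.sq_sqrt hD.le, ← Real.exp_nat_mul (-c * (y - x)),
          mul_pow]
        push_cast
        rw [show 2 * (-c * (y - x)) = -(2 * c * (y - x)) by ring]
        ring
  set K := Real.sqrt (decayConst A c R ‖ζ‖) * (Real.exp (M * (R + 1)) * k⁻¹)
  have hK : 0 < K := by
    have := decayConst_pos (A := A) (R := R) (t := ‖ζ‖) hc
    positivity
  let Φ : ℝ → Matrix (Fin 2) (Fin 2) ℂ := fun x => !![v₁ x, v₂ x; q₁ x, q₂ x]
  let Ψ : ℝ → Matrix (Fin 2) (Fin 2) ℂ := fun x => !![q₂ x, -v₂ x; -q₁ x, v₁ x]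
  let D : Matrix (Fin 2) (Fin 2) ℂ := !![1, 0; 0, 0]
  have hΦΨ : ∀ x, Φ x * Ψ x = 1 := fun x => by
    have := hw x
    unfold wronsk at this
    ext i j
    fin_cases i <;> fin_cases j <;> simp [Φ, Ψ] <;> first | ring1 | linear_combination this
  have hΨΦ : ∀ x, Ψ x * Φ x = 1 := fun x => mul_eq_one_comm.1 (hΦΨ x)
  have hDD : D * D = D := by
    ext i j
    fin_cases i <;> fin_cases j <;> simp [D]
  have hTP : ∀ x y, Φ x * Ψ y * (Φ y * D * Ψ y) = Φ x * D * Ψ y := fun x y => by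
    calc Φ x * Ψ y * (Φ y * D * Ψ y) = Φ x * (Ψ y * Φ y) * D * Ψ y := by
          simp only [Matrix.mul_assoc]
      _ = _ := by rw [hΨΦ, Matrix.mul_one]
  have hPT : ∀ x y, Φ x * D * Ψ x * (Φ x * Ψ y) = Φ x * D * Ψ y := fun x y => by
    calc Φ x * D * Ψ x * (Φ x * Ψ y) = Φ x * D * (Ψ x * Φ x) * Ψ y := by
          simp only [Matrix.mul_assoc]
      _ = _ := by rw [hΨΦ, Matrix.mul_one]
  refine ⟨fun x => Φ x * D * Ψ x, 2 * K, c, by positivity, hc, fun x _ => ?_,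
    fun x y => Φ x * Ψ y, fun y => ⟨hΦΨ y, fun ξ => ?_⟩, fun x hx y hy => ⟨?_, fun hyx ξ => ?_,
    fun hxy ξ => ?_⟩⟩
  · calc Φ x * D * Ψ x * (Φ x * D * Ψ x) = Φ x * D * (Ψ x * Φ x) * D * Ψ x := by
          simp only [Matrix.mul_assoc]
      _ = Φ x * (D * D) * Ψ x := by rw [hΨΦ, Matrix.mul_one, Matrix.mul_assoc (Φ x)]
      _ = _ := by rw [hDD]
  · have h := (h₁.const_mul (q₂ y * ξ 0 - v₂ y * ξ 1)).add
      (h₂.const_mul (-q₁ y * ξ 0 + v₁ y * ξ 1))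
    convert h.isSolution using 2 with x
    ext i
    fin_cases i <;> simp [Φ, Ψ, mulVec, dotProduct, Fin.sum_univ_two] <;> ring
  · rw [hTP, hPT]
  · rw [hTP]
    have e : (Φ x * D * Ψ y) *ᵥ ξ = (q₂ y * ξ 0 - v₂ y * ξ 1) • ![v₁ x, q₁ x] := by
      ext i
      fin_cases i <;> simp [Φ, D, Ψ, mulVec, dotProduct, Fin.sum_univ_two] <;> ring
    rw [e]
    exact norm_smul_vec_le hK.le (hkey y x hy hyx) ((norm_sub_le _ _).trans (by simp))
  · rw [Matrix.mul_sub, Matrix.mul_one, hTP]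
    have e : (Φ x * Ψ y - Φ x * D * Ψ y) *ᵥ ξ = (-q₁ y * ξ 0 + v₁ y * ξ 1) • ![v₂ x, q₂ x] := by
      ext i
      fin_cases i <;> simp [Φ, D, Ψ, mulVec, dotProduct, Fin.sum_univ_two] <;> ring
    rw [e]
    refine norm_smul_vec_le hK.le (v₂ := v₁) (q₂ := q₁) (y := y) ?_
      ((norm_add_le _ _).trans (by simp))
    rw [mul_comm]
    exact hkey x y hx hxy

/-- The reflection `(v, q) ↦ (v, -q)`. -/
def reflMat : Matrix (Fin 2) (Fin 2) ℂ := !![1, 0; 0, -1]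

lemma reflMat_mul_self : reflMat * reflMat = 1 := by
  ext i j
  fin_cases i <;> fin_cases j <;> simp [reflMat]

lemma reflMat_mulVec (ξ : Fin 2 → ℂ) : reflMat *ᵥ ξ = ![ξ 0, -ξ 1] := by
  ext i
  fin_cases i <;> simp [reflMat, mulVec, dotProduct, Fin.sum_univ_two]

lemma norm_reflMat_mulVec (ξ : Fin 2 → ℂ) : ‖reflMat *ᵥ ξ‖ = ‖ξ‖ := by
  have key : ∀ ξ : Fin 2 → ℂ, ‖reflMat *ᵥ ξ‖ ≤ ‖ξ‖ := fun ξ => by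
    rw [reflMat_mulVec, pi_norm_le_iff_of_nonneg (norm_nonneg _), Fin.forall_fin_two]
    exact ⟨norm_le_pi_norm ξ 0, by simpa using norm_le_pi_norm ξ 1⟩
  refine le_antisymm (key ξ) ?_
  have := key (reflMat *ᵥ ξ)
  rwa [mulVec_mulVec, reflMat_mul_self, one_mulVec] at this

/-- Reversing `x` exchanges forward and backward decay, so the conjugated projection must be
replaced by its complement. -/
theorem HasExpDichotomyOn.reflect {a : ℝ → ℝ} {ζ : ℂ} {J : Set ℝ} {K μ : ℝ}
    {P : ℝ → Matrix (Fin 2) (Fin 2) ℂ} (h : HasExpDichotomyOn (sysMat a ζ) J K μ P) :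
    HasExpDichotomyOn (sysMat (fun x => a (-x)) ζ) {x | -x ∈ J} K μ
      (fun x => 1 - reflMat * P (-x) * reflMat) := by
  obtain ⟨hK, hμ, hPP, T, hT, hJ⟩ := h
  have hSS := reflMat_mul_self
  have hc : ∀ X Y : Matrix (Fin 2) (Fin 2) ℂ,
      reflMat * X * reflMat * (reflMat * Y * reflMat) = reflMat * (X * Y) * reflMat := by
    intro X Y
    calc reflMat * X * reflMat * (reflMat * Y * reflMat)
        = reflMat * X * (reflMat * reflMat) * Y * reflMat := by simp only [Matrix.mul_assoc]
      _ = _ := by rw [hSS, Matrix.mul_one]; simp only [Matrix.mul_assoc]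
  have hn : ∀ (X : Matrix (Fin 2) (Fin 2) ℂ) ξ,
      ‖(reflMat * X * reflMat) *ᵥ ξ‖ = ‖X *ᵥ (reflMat *ᵥ ξ)‖ := by
    intro X ξ
    rw [← mulVec_mulVec, ← mulVec_mulVec, norm_reflMat_mulVec]
  refine ⟨hK, hμ, fun x hx => ?_, fun x y => reflMat * T (-x) (-y) * reflMat, fun y => ⟨?_,
    fun ξ => ?_⟩, fun x hx y hy => ⟨?_, fun hyx ξ => ?_, fun hxy ξ => ?_⟩⟩
  · rw [Matrix.sub_mul, Matrix.mul_sub, Matrix.mul_sub, hc, hPP _ hx]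
    simp
  · simp only [(hT (-y)).1, Matrix.mul_one, hSS]
  · have h1 := (isSolution_iff.1 ((hT (-y)).2 (reflMat *ᵥ ξ))).reflect
    convert h1.isSolution using 2 with x
    rw [← mulVec_mulVec, ← mulVec_mulVec, reflMat_mulVec]
  · rw [Matrix.sub_mul, Matrix.mul_sub, Matrix.one_mul, Matrix.mul_one, hc, hc,
      (hJ _ hx _ hy).1]
  · have := (hJ _ hx _ hy).2.2 (neg_le_neg hyx) (reflMat *ᵥ ξ)
    rw [Matrix.mul_sub, Matrix.mul_one, hc, ← Matrix.sub_mul, ← Matrix.mul_sub, hn]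
    rw [Matrix.mul_sub, Matrix.mul_one, norm_reflMat_mulVec] at this
    convert this using 4
    ring
  · have := (hJ _ hx _ hy).2.1 (neg_le_neg hxy) (reflMat *ᵥ ξ)
    rw [sub_sub_cancel, hc, hn]
    rw [norm_reflMat_mulVec] at this
    convert this using 4
    ring

/-- `(v, q)` is bounded on `(-∞, 0]`. -/
def BwdBdd (v q : ℝ → ℂ) : Prop := FwdBdd (fun x => v (-x)) (fun x => -q (-x))

lemma IsEvolution.eq_mulVec {a : ℝ → ℝ} {A : ℝ} {ζ : ℂ} {T : ℝ → ℝ → Matrix (Fin 2) (Fin 2) ℂ}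
    (hA : ∀ x, |a x| ≤ A) (hT : IsEvolution (sysMat a ζ) T) {v q : ℝ → ℂ} (h : IsSol a ζ v q)
    (x y : ℝ) : T x y *ᵥ ![v y, q y] = ![v x, q x] := by
  have h1 := isSolution_iff.1 ((hT y).2 ![v y, q y])
  have h2 := h1.eq_of_eq_at hA h (y := y) (by simp [(hT y).1]) (by simp [(hT y).1])
  ext i
  fin_cases i
  · exact congrFun h2.1 x
  · exact congrFun h2.2 x

/-- The range of the dichotomy projection on `[0, ∞)` consists of the initial data of bounded
solutions. -/
theorem HasExpDichotomyOn.mem_range_iff {a : ℝ → ℝ} {A : ℝ} {ζ : ℂ} {K μ : ℝ}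
    {P : ℝ → Matrix (Fin 2) (Fin 2) ℂ} (hA : ∀ x, |a x| ≤ A)
    (hd : HasExpDichotomyOn (sysMat a ζ) (Ici 0) K μ P) {v q : ℝ → ℂ} (h : IsSol a ζ v q) :
    ![v 0, q 0] ∈ LinearMap.range (P 0).mulVecLin ↔ FwdBdd v q := by
  obtain ⟨hK, hμ, hPP, T, hT, hJ⟩ := hd
  have hTe := fun x y => IsEvolution.eq_mulVec hA hT h x y
  constructor
  · rintro ⟨η, hη⟩
    have hfix : P 0 *ᵥ ![v 0, q 0] = ![v 0, q 0] := by
      rw [← hη, mulVecLin_apply, mulVec_mulVec, hPP 0 (mem_Ici.2 le_rfl)]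
    refine ⟨2 * (K * 1 * ‖![v 0, q 0]‖) ^ 2, fun x hx => (amp_le_norm_vec_sq v q x).trans ?_⟩
    have h1 := (hJ x hx 0 (mem_Ici.2 le_rfl)).2.1 hx ![v 0, q 0]
    rw [← mulVec_mulVec, hfix, hTe] at h1
    have h2 : Real.exp (-μ * (x - 0)) ≤ 1 := by
      rw [Real.exp_le_one_iff]
      have : 0 ≤ μ * (x - 0) := by positivity
      linarith
    have h3 : ‖![v x, q x]‖ ≤ K * 1 * ‖![v 0, q 0]‖ := h1.trans (by gcongr)
    gcongr
  · rintro ⟨C, hC⟩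
    have hC0 : 0 ≤ C := (amp_nonneg v q 0).trans (hC 0 le_rfl)
    -- The unstable component at `0` is the unstable component at `x` carried back by the flow:
    -- bounded data times an exponentially small factor.
    have key : ∀ x, 0 ≤ x →
        ‖(1 - P 0) *ᵥ ![v 0, q 0]‖ ≤ K * Real.sqrt C * Real.exp (-(μ * x)) := by
      intro x hx
      have h1 := (hJ 0 (mem_Ici.2 le_rfl) x hx).2.2 hx ![v x, q x]
      have e : T 0 x * (1 - P x) = (1 - P 0) * T 0 x := by
        rw [Matrix.mul_sub, Matrix.sub_mul, Matrix.mul_one, Matrix.one_mul,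
          (hJ 0 (mem_Ici.2 le_rfl) x hx).1]
      rw [e, ← mulVec_mulVec, hTe] at h1
      refine h1.trans ?_
      have h2 : ‖![v x, q x]‖ ≤ Real.sqrt C :=
        Real.le_sqrt_of_sq_le ((norm_vec_sq_le_amp v q x).trans (hC x hx))
      calc K * Real.exp (-μ * (x - 0)) * ‖![v x, q x]‖ ≤
          K * Real.exp (-μ * (x - 0)) * Real.sqrt C := by gcongr
        _ = _ := by rw [sub_zero, neg_mul]; ring
    have hlim : Tendsto (fun x : ℝ => K * Real.sqrt C * Real.exp (-(μ * x))) atTop (𝓝 0) := by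
      have := (Real.tendsto_exp_neg_atTop_nhds_zero.comp
        (Tendsto.const_mul_atTop hμ tendsto_id)).const_mul (K * Real.sqrt C)
      simpa using this
    have h0 : ‖(1 - P 0) *ᵥ ![v 0, q 0]‖ ≤ 0 :=
      ge_of_tendsto hlim (by filter_upwards [eventually_ge_atTop 0] with x hx using key x hx)
    have h1 : (1 - P 0) *ᵥ ![v 0, q 0] = 0 := norm_le_zero_iff.1 h0
    rw [sub_mulVec, one_mulVec, sub_eq_zero] at h1
    exact ⟨![v 0, q 0], by rw [mulVecLin_apply]; exact h1.symm⟩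

/-- The kernel of the dichotomy projection on `(-∞, 0]` consists of the initial data of bounded
solutions. -/
theorem HasExpDichotomyOn.mem_ker_iff {a : ℝ → ℝ} {A : ℝ} {ζ : ℂ} {K μ : ℝ}
    {P : ℝ → Matrix (Fin 2) (Fin 2) ℂ} (hA : ∀ x, |a x| ≤ A)
    (hd : HasExpDichotomyOn (sysMat a ζ) (Iic 0) K μ P) {v q : ℝ → ℂ} (h : IsSol a ζ v q) :
    ![v 0, q 0] ∈ LinearMap.ker (P 0).mulVecLin ↔ BwdBdd v q := by
  have hr := hd.reflect
  rw [show {x : ℝ | -x ∈ Iic (0 : ℝ)} = Ici 0 by ext x; simp] at hr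
  have h1 := hr.mem_range_iff (fun x => hA (-x)) h.reflect
  have hPP := hd.2.2.1 0 (mem_Iic.2 le_rfl)
  rw [BwdBdd, ← h1]
  simp only [neg_zero]
  have e : ![v 0, -q 0] = reflMat *ᵥ ![v 0, q 0] := by rw [reflMat_mulVec]; rfl
  rw [e, LinearMap.mem_ker, LinearMap.mem_range]
  simp only [mulVecLin_apply]
  have hS : ∀ ξ, reflMat *ᵥ (reflMat *ᵥ ξ) = ξ := fun ξ => by
    rw [mulVec_mulVec, reflMat_mul_self, one_mulVec]
  constructor
  · intro h0
    refine ⟨reflMat *ᵥ ![v 0, q 0], ?_⟩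
    rw [sub_mulVec, one_mulVec, ← mulVec_mulVec, ← mulVec_mulVec, hS, h0, mulVec_zero, sub_zero]
  · rintro ⟨η, hη⟩
    have h2 := congrArg (fun ξ => reflMat *ᵥ ξ) hη
    simp only [hS] at h2
    rw [← h2, sub_mulVec, one_mulVec, ← mulVec_mulVec, ← mulVec_mulVec, mulVec_sub, hS,
      mulVec_sub, mulVec_mulVec _ (P 0) (P 0), hPP, sub_self]

theorem exists_dichotomy_Iic {a : ℝ → ℝ} {Λ A c R : ℝ} {ζ : ℂ} (hP : Coercive a Λ A c R)
    (hζ : ζ ∈ halfPlane Λ) : ∃ P K μ, HasExpDichotomyOn (sysMat a ζ) (Iic 0) K μ P := by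
  obtain ⟨P, K, μ, h⟩ := exists_dichotomy_Ici hP.reflect hζ
  have hr := h.reflect
  simp only [neg_neg] at hr
  rw [show {x : ℝ | -x ∈ Ici (0 : ℝ)} = Iic 0 by ext x; simp] at hr
  exact ⟨_, K, μ, hr⟩

/-! ### Analytic frames of half-line bounded solutions. -/

lemma exists_eq_smul_of_det_eq_zero {α β : Fin 2 → ℂ} (hα : α ≠ 0)
    (h : α 0 * β 1 - α 1 * β 0 = 0) : ∃ k : ℂ, β = k • α := by
  by_cases h0 : α 0 = 0
  · have h1 : α 1 ≠ 0 := fun h1 => hα (by ext i; fin_cases i <;> simp [h0, h1])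
    refine ⟨β 1 / α 1, ?_⟩
    have hb : β 0 = 0 := by
      rw [h0, zero_mul, zero_sub, neg_eq_zero] at h
      exact (mul_eq_zero.1 h).resolve_left h1
    ext i
    fin_cases i
    · simp [h0, hb]
    · simp [h1]
  · refine ⟨β 0 / α 0, ?_⟩
    ext i
    fin_cases i
    · simp [h0]
    · simp only [Fin.mk_one, Fin.isValue, Pi.smul_apply, smul_eq_mul]
      field_simp
      linear_combination h

lemma fwdBdd_const_mul {v q : ℝ → ℂ} (k : ℂ) (h : FwdBdd v q) :
    FwdBdd (fun x => k * v x) (fun x => k * q x) := by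
  obtain ⟨C, hC⟩ := h
  refine ⟨‖k‖ ^ 2 * C, fun x hx => ?_⟩
  have := mul_le_mul_of_nonneg_left (hC x hx) (sq_nonneg ‖k‖)
  refine le_trans (le_of_eq ?_) this
  simp only [amp, norm_mul]
  ring

lemma bwdBdd_const_mul {v q : ℝ → ℂ} (k : ℂ) (h : BwdBdd v q) :
    BwdBdd (fun x => k * v x) (fun x => k * q x) := by
  have := fwdBdd_const_mul k h
  simpa [BwdBdd] using this

lemma fwdBdd_conj {v q : ℝ → ℂ} (h : FwdBdd v q) :
    FwdBdd (fun x => starRingEnd ℂ (v x)) (fun x => starRingEnd ℂ (q x)) := by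
  obtain ⟨C, hC⟩ := h
  exact ⟨C, fun x hx => by simpa [amp] using hC x hx⟩

lemma amp_reflect (v q : ℝ → ℂ) (x : ℝ) :
    amp (fun x => v (-x)) (fun x => -q (-x)) x = amp v q (-x) := by simp [amp]

/-- Analytic frames spanning the initial data of solutions bounded on `[0, ∞)` and on
`(-∞, 0]`. -/
structure EvansFrame (a : ℝ → ℝ) (Λ : ℝ) (Bu Bs : ℂ → Fin 2 → ℂ) : Prop where
  analytic_u : AnalyticOnNhd ℂ Bu (halfPlane Λ)
  analytic_s : AnalyticOnNhd ℂ Bs (halfPlane Λ)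
  ne_u : ∀ ζ ∈ halfPlane Λ, Bu ζ ≠ 0
  ne_s : ∀ ζ ∈ halfPlane Λ, Bs ζ ≠ 0
  fwd_iff : ∀ ζ ∈ halfPlane Λ, ∀ v q, IsSol a ζ v q →
    ((∃ k : ℂ, ![v 0, q 0] = k • Bu ζ) ↔ FwdBdd v q)
  bwd_iff : ∀ ζ ∈ halfPlane Λ, ∀ v q, IsSol a ζ v q →
    ((∃ k : ℂ, ![v 0, q 0] = k • Bs ζ) ↔ BwdBdd v q)

/-- The determinant of the frames. -/
def frameDet (Bu Bs : ℂ → Fin 2 → ℂ) (ζ : ℂ) : ℂ := Bu ζ 0 * Bs ζ 1 - Bu ζ 1 * Bs ζ 0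

/-- Eliminates the dichotomy projections: only their range and kernel matter, and these are
characterised by boundedness. -/
lemma IsFastReducedEvans.exists_frame {a : ℝ → ℝ} {Λ A : ℝ} (hA : ∀ x, |a x| ≤ A) {E : ℂ → ℂ}
    (hE : IsFastReducedEvans (fun ζ x => sysMat a ζ x) Λ E) :
    ∃ Bu Bs, EvansFrame a Λ Bu Bs ∧ ∀ ζ ∈ halfPlane Λ, E ζ = frameDet Bu Bs ζ := by
  obtain ⟨Pp, Pm, Bu, Bs, hp, hm, hu, hs, h⟩ := hE
  refine ⟨Bu, Bs, ⟨hu, hs, fun ζ hζ => (h ζ hζ).1, fun ζ hζ => (h ζ hζ).2.2.1, ?_, ?_⟩, ?_⟩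
  · intro ζ hζ v q hsol
    obtain ⟨K, μ, hd⟩ := hp ζ hζ
    rw [← HasExpDichotomyOn.mem_range_iff hA hd hsol, ← (h ζ hζ).2.1,
      Submodule.mem_span_singleton]
    simp only [eq_comm]
  · intro ζ hζ v q hsol
    obtain ⟨K, μ, hd⟩ := hm ζ hζ
    rw [← HasExpDichotomyOn.mem_ker_iff hA hd hsol, ← (h ζ hζ).2.2.2.1,
      Submodule.mem_span_singleton]
    simp only [eq_comm]
  · intro ζ hζ
    rw [(h ζ hζ).2.2.2.2, det_fin_two]
    simp [frameDet]
    ring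

/-- The projections may be chosen separately for each `ζ`, since analyticity is required of the
bases only. -/
lemma EvansFrame.isFastReducedEvans {a : ℝ → ℝ} {Λ A c R : ℝ} (hP : Coercive a Λ A c R)
    {Bu Bs : ℂ → Fin 2 → ℂ} (hF : EvansFrame a Λ Bu Bs) :
    IsFastReducedEvans (fun ζ x => sysMat a ζ x) Λ (frameDet Bu Bs) := by
  choose! Pp Kp μp hp using fun ζ (hζ : ζ ∈ halfPlane Λ) => exists_dichotomy_Ici hP hζ
  choose! Pm Km μm hm using fun ζ (hζ : ζ ∈ halfPlane Λ) => exists_dichotomy_Iic hP hζ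
  refine ⟨Pp, Pm, Bu, Bs, fun ζ hζ => ⟨_, _, hp ζ hζ⟩, fun ζ hζ => ⟨_, _, hm ζ hζ⟩,
    hF.analytic_u, hF.analytic_s, fun ζ hζ => ⟨hF.ne_u ζ hζ, ?_, hF.ne_s ζ hζ, ?_, ?_⟩⟩
  · ext ξ
    obtain ⟨v, q, h, hv, hq⟩ := IsSol.exists_of_data hP.cont hP.bdd ζ 0 (ξ 0) (ξ 1)
    have e : ξ = ![v 0, q 0] := by ext i; fin_cases i <;> simp [hv, hq]
    rw [e, HasExpDichotomyOn.mem_range_iff hP.bdd (hp ζ hζ) h, ← hF.fwd_iff ζ hζ v q h,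
      Submodule.mem_span_singleton]
    simp only [eq_comm]
  · ext ξ
    obtain ⟨v, q, h, hv, hq⟩ := IsSol.exists_of_data hP.cont hP.bdd ζ 0 (ξ 0) (ξ 1)
    have e : ξ = ![v 0, q 0] := by ext i; fin_cases i <;> simp [hv, hq]
    rw [e, HasExpDichotomyOn.mem_ker_iff hP.bdd (hm ζ hζ) h, ← hF.bwd_iff ζ hζ v q h,
      Submodule.mem_span_singleton]
    simp only [eq_comm]
  · rw [det_fin_two]
    simp [frameDet]
    ring

/-- The Wronskian of two bounded solutions is constant and tends to `0`, so the data at any single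
point are proportional. -/
lemma eq_mul_of_fwdBdd {a : ℝ → ℝ} {Λ A c R : ℝ} {ζ : ℂ} {v q w r : ℝ → ℂ}
    (hP : Coercive a Λ A c R) (hζ : ζ ∈ halfPlane Λ) (h : IsSol a ζ v q) (hw : IsSol a ζ w r)
    (hb : FwdBdd v q) (hb' : FwdBdd w r) {y : ℝ} (hne : amp v q y ≠ 0) :
    ∃ k : ℂ, w = (fun x => k * v x) ∧ r = fun x => k * q x := by
  have h0 := wronsk_eq_zero_of_fwdBdd hP hζ h hw hb hb' y
  obtain ⟨k, hk⟩ := exists_eq_smul_of_det_eq_zero (α := ![v y, q y]) (β := ![w y, r y])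
    (fun h => hne (amp_eq_zero.2 ⟨congrFun h 0, congrFun h 1⟩)) (by simpa [wronsk] using h0)
  exact ⟨k, hw.eq_of_eq_at hP.bdd (h.const_mul k) (y := y) (by simpa using congrFun hk 0)
    (by simpa using congrFun hk 1)⟩

lemma IsSol.reflect_reflect {a : ℝ → ℝ} {ζ : ℂ} {v q : ℝ → ℂ}
    (h : IsSol (fun x => a (-x)) ζ v q) : IsSol a ζ (fun x => v (-x)) (fun x => -q (-x)) := by
  simpa using h.reflect

/-- Normalised solutions bounded on a half line, with the analytic frames they induce. -/
theorem exists_normalised_frame {a : ℝ → ℝ} {Λ A c R : ℝ} (hP : Coercive a Λ A c R) :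
    ∃ vp qp vm qm : ℂ → ℝ → ℂ,
      (∀ ζ ∈ halfPlane Λ, IsSol a ζ (vp ζ) (qp ζ) ∧ FwdBdd (vp ζ) (qp ζ) ∧ vp ζ R = 1) ∧
      (∀ ζ ∈ halfPlane Λ, IsSol a ζ (vm ζ) (qm ζ) ∧ BwdBdd (vm ζ) (qm ζ) ∧ vm ζ (-R) = 1) ∧
      EvansFrame a Λ (fun ζ => ![vp ζ 0, qp ζ 0]) (fun ζ => ![vm ζ 0, qm ζ 0]) := by
  choose! vp qp hs hb hn using fun ζ (hζ : ζ ∈ halfPlane Λ) => exists_fwdBdd hP hζ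
  choose! vm qm hs' hb' hn' using fun ζ (hζ : ζ ∈ halfPlane Λ) => exists_fwdBdd hP.reflect hζ
  have hsm : ∀ ζ ∈ halfPlane Λ, IsSol a ζ (fun x => vm ζ (-x)) (fun x => -qm ζ (-x)) :=
    fun ζ hζ => (hs' ζ hζ).reflect_reflect
  have hnp : ∀ ζ ∈ halfPlane Λ, amp (vp ζ) (qp ζ) 0 ≠ 0 := fun ζ hζ =>
    (hs ζ hζ).amp_ne_zero hP.bdd (y := R) (fun h => by simpa [hn ζ hζ] using (amp_eq_zero.1 h).1) 0
  have hnm : ∀ ζ ∈ halfPlane Λ, amp (vm ζ) (qm ζ) 0 ≠ 0 := fun ζ hζ =>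
    (hs' ζ hζ).amp_ne_zero hP.reflect.bdd (y := R)
      (fun h => by simpa [hn' ζ hζ] using (amp_eq_zero.1 h).1) 0
  have hbm : ∀ ζ ∈ halfPlane Λ, BwdBdd (fun x => vm ζ (-x)) (fun x => -qm ζ (-x)) := fun ζ hζ => by
    simpa [BwdBdd] using hb' ζ hζ
  refine ⟨vp, qp, fun ζ x => vm ζ (-x), fun ζ x => -qm ζ (-x), fun ζ hζ => ⟨hs ζ hζ, hb ζ hζ,
    hn ζ hζ⟩, fun ζ hζ => ⟨hsm ζ hζ, hbm ζ hζ, by simpa using hn' ζ hζ⟩, ?_⟩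
  refine ⟨?_, ?_, ?_, ?_, ?_, ?_⟩
  · refine DifferentiableOn.analyticOnNhd (fun ζ hζ => ?_) (isOpen_halfPlane Λ)
    have hd := differentiableAt_normalised hP hs hb hn hζ 0
    refine (differentiableAt_pi.2 fun i => ?_).differentiableWithinAt
    fin_cases i
    · exact hd.1
    · exact hd.2
  · refine DifferentiableOn.analyticOnNhd (fun ζ hζ => ?_) (isOpen_halfPlane Λ)
    -- Evaluation at `-0` matches the reflected frame as written.
    have hd := differentiableAt_normalised hP.reflect hs' hb' hn' hζ (-0)
    refine (differentiableAt_pi.2 fun i => ?_).differentiableWithinAt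
    fin_cases i
    · exact hd.1
    · exact hd.2.neg
  · exact fun ζ hζ h => hnp ζ hζ (amp_eq_zero.2 ⟨congrFun h 0, congrFun h 1⟩)
  · exact fun ζ hζ h => hnm ζ hζ (amp_eq_zero.2
      ⟨by simpa using congrFun h 0, by simpa using congrFun h 1⟩)
  · intro ζ hζ v q h
    constructor
    · rintro ⟨k, hk⟩
      obtain ⟨e1, e2⟩ := h.eq_of_eq_at hP.bdd ((hs ζ hζ).const_mul k) (y := 0)
        (by simpa using congrFun hk 0) (by simpa using congrFun hk 1)
      rw [e1, e2]
      exact fwdBdd_const_mul k (hb ζ hζ)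
    · intro hbd
      obtain ⟨k, e1, e2⟩ := eq_mul_of_fwdBdd hP hζ (hs ζ hζ) h (hb ζ hζ) hbd (hnp ζ hζ)
      refine ⟨k, ?_⟩
      rw [e1, e2]
      simp
  · intro ζ hζ v q h
    constructor
    · rintro ⟨k, hk⟩
      obtain ⟨e1, e2⟩ := h.eq_of_eq_at hP.bdd ((hsm ζ hζ).const_mul k) (y := 0)
        (by simpa using congrFun hk 0) (by simpa using congrFun hk 1)
      rw [e1, e2]
      exact bwdBdd_const_mul k (hbm ζ hζ)
    · intro hbd
      obtain ⟨k, e1, e2⟩ := eq_mul_of_fwdBdd hP.reflect hζ (hs' ζ hζ) h.reflect (hb' ζ hζ) hbd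
        (hnm ζ hζ)
      refine ⟨k, ?_⟩
      have f1 := congrFun e1 0
      have f2 := congrFun e2 0
      simp only [neg_zero] at f1 f2
      ext i
      fin_cases i
      · simpa using f1
      · simpa using neg_eq_iff_eq_neg.1 f2

/-! ### Zeros as eigenvalues: reality and simplicity. -/

/-- The eigenfunctions: nontrivial solutions that are bounded on `ℝ`. -/
structure IsEigen (a : ℝ → ℝ) (ζ : ℂ) (v q : ℝ → ℂ) : Prop where
  sol : IsSol a ζ v q
  fwd : FwdBdd v q
  bwd : BwdBdd v q
  ne : amp v q 0 ≠ 0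

/-- Dependence of the two frame vectors means that one initial datum generates a solution bounded in
both directions. -/
lemma EvansFrame.eq_zero_iff {a : ℝ → ℝ} {Λ A c R : ℝ} (hP : Coercive a Λ A c R)
    {Bu Bs : ℂ → Fin 2 → ℂ} (hF : EvansFrame a Λ Bu Bs) {ζ : ℂ} (hζ : ζ ∈ halfPlane Λ) :
    frameDet Bu Bs ζ = 0 ↔ ∃ v q, IsEigen a ζ v q := by
  constructor
  · intro h0
    obtain ⟨k, hk⟩ := exists_eq_smul_of_det_eq_zero (hF.ne_u ζ hζ) h0
    have hk0 : k ≠ 0 := fun h => hF.ne_s ζ hζ (by rw [hk, h, zero_smul])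
    obtain ⟨v, q, h, hv, hq⟩ := IsSol.exists_of_data hP.cont hP.bdd ζ 0 (Bu ζ 0) (Bu ζ 1)
    have e : ![v 0, q 0] = Bu ζ := by ext i; fin_cases i <;> simp [hv, hq]
    refine ⟨v, q, h, (hF.fwd_iff ζ hζ v q h).1 ⟨1, by rw [e, one_smul]⟩,
      (hF.bwd_iff ζ hζ v q h).1 ⟨k⁻¹, by rw [hk, smul_smul, inv_mul_cancel₀ hk0, one_smul, e]⟩, ?_⟩
    intro h0
    refine hF.ne_u ζ hζ ?_
    obtain ⟨h1, h2⟩ := amp_eq_zero.1 h0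
    rw [← e, h1, h2]
    ext i
    fin_cases i <;> rfl
  · rintro ⟨v, q, h, hf, hb, hne⟩
    obtain ⟨k, hk⟩ := (hF.fwd_iff ζ hζ v q h).2 hf
    obtain ⟨l, hl⟩ := (hF.bwd_iff ζ hζ v q h).2 hb
    have hkl : k * l ≠ 0 := by
      intro h0
      refine hne (amp_eq_zero.2 ?_)
      rcases mul_eq_zero.1 h0 with h0 | h0
      · rw [h0, zero_smul] at hk
        exact ⟨congrFun hk 0, congrFun hk 1⟩
      · rw [h0, zero_smul] at hl
        exact ⟨congrFun hl 0, congrFun hl 1⟩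
    have e0 := (congrFun hk 0).symm.trans (congrFun hl 0)
    have e1 := (congrFun hk 1).symm.trans (congrFun hl 1)
    simp only [Pi.smul_apply, smul_eq_mul] at e0 e1
    refine (mul_eq_zero.1 (?_ : k * l * frameDet Bu Bs ζ = 0)).resolve_left hkl
    unfold frameDet
    linear_combination (l * Bs ζ 1) * e0 - (l * Bs ζ 0) * e1

lemma conj_mem_halfPlane {Λ : ℝ} {ζ : ℂ} (hζ : ζ ∈ halfPlane Λ) :
    starRingEnd ℂ ζ ∈ halfPlane Λ := by
  simpa [halfPlane] using hζ

lemma IsEigen.reflect {a : ℝ → ℝ} {ζ : ℂ} {v q : ℝ → ℂ} (h : IsEigen a ζ v q) :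
    IsEigen (fun x => a (-x)) ζ (fun x => v (-x)) (fun x => -q (-x)) :=
  ⟨h.sol.reflect, h.bwd, by simpa [BwdBdd] using h.fwd, by
    have := h.ne
    simpa [amp_reflect] using this⟩

section

variable {a : ℝ → ℝ} {Λ A c R : ℝ} {ζ : ℂ} {v q : ℝ → ℂ}

/-- Positivity comes from the tail: a nontrivial bounded solution has no zero of `v` beyond `R`. -/
lemma integral_normSq_pos (hP : Coercive a Λ A c R) (hζ : ζ ∈ halfPlane Λ) (h : IsSol a ζ v q)
    (hf : FwdBdd v q) (hne : amp v q 0 ≠ 0) :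
    ∃ N : ℝ, 0 < N ∧ ∫ x in Ioi (0 : ℝ), starRingEnd ℂ (v x) * v x = N := by
  refine ⟨∫ x in Ioi (0 : ℝ), Complex.normSq (v x), ?_, ?_⟩
  · have hinteg := (integrableOn_mul hP (conj_mem_halfPlane hζ) hζ h.conj h (fwdBdd_conj hf) hf
      (le_refl (0 : ℝ))).norm
    have hinteg' : IntegrableOn (fun x => Complex.normSq (v x)) (Ioi 0) := by
      refine hinteg.congr (ae_of_all _ fun x => ?_)
      simp only [norm_mul, RCLike.norm_conj, Complex.normSq_eq_norm_sq]
      ring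
    rw [setIntegral_pos_iff_support_of_nonneg_ae
      (ae_of_all _ fun x => Complex.normSq_nonneg _) hinteg']
    refine lt_of_lt_of_le ?_ (measure_mono (s := Ioi R) fun x hx => ⟨?_, ?_⟩)
    · simp
    · have := h.ne_zero_of_fwdBdd hP hζ hf (le_of_lt hx) (h.amp_ne_zero hP.bdd hne x)
      simpa using this
    · exact lt_of_le_of_lt hP.R_nonneg hx
  · rw [← integral_complex_ofReal]
    congr 1
    ext x
    rw [Complex.normSq_eq_conj_mul_self]

/-- Eigenvalues are real. -/
lemma IsEigen.im_eq_zero (hP : Coercive a Λ A c R) (hζ : ζ ∈ halfPlane Λ) (h : IsEigen a ζ v q) :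
    ζ.im = 0 := by
  have hζ' := conj_mem_halfPlane hζ
  obtain ⟨N₁, hN₁, e₁⟩ := integral_normSq_pos hP hζ h.sol h.fwd h.ne
  have h' := h.reflect
  obtain ⟨N₂, hN₂, e₂⟩ := integral_normSq_pos hP.reflect hζ h'.sol h'.fwd h'.ne
  have w₁ := mul_integral_eq_neg_wronsk hP hζ' hζ h.sol.conj h.sol (fwdBdd_conj h.fwd) h.fwd
    (le_refl (0 : ℝ))
  have w₂ := mul_integral_eq_neg_wronsk hP.reflect hζ' hζ h'.sol.conj h'.sol (fwdBdd_conj h'.fwd)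
    h'.fwd (le_refl (0 : ℝ))
  rw [e₁] at w₁
  rw [e₂] at w₂
  simp only [wronsk, neg_zero, map_neg] at w₁ w₂
  -- Reflection reverses the sign of the Wronskian, so the boundary terms at `0` of the two
  -- half-line identities cancel.
  have hsum : (ζ - starRingEnd ℂ ζ) * ((N₁ + N₂ : ℝ) : ℂ) = 0 := by
    push_cast
    linear_combination w₁ + w₂
  have h0 : ζ - starRingEnd ℂ ζ = 0 :=
    (mul_eq_zero.1 hsum).resolve_right (by exact_mod_cast (by linarith : N₁ + N₂ ≠ 0))
  exact Complex.conj_eq_iff_im.1 (sub_eq_zero.1 h0).symm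

/-- The eigenvalue is real, so `conj v` is a multiple `k * v`; then `k` times this sum is the
positive integral of `|v|²`. -/
lemma integrals_ne_zero (hP : Coercive a Λ A c R) (hζ : ζ ∈ halfPlane Λ) (h : IsEigen a ζ v q) :
    (∫ x in Ioi (0 : ℝ), v x * v x) + ∫ x in Ioi (0 : ℝ), v (-x) * v (-x) ≠ 0 := by
  have hre : starRingEnd ℂ ζ = ζ := Complex.conj_eq_iff_im.2 (h.im_eq_zero hP hζ)
  have hc := h.sol.conj
  rw [hre] at hc
  obtain ⟨k, e, -⟩ := eq_mul_of_fwdBdd hP hζ h.sol hc h.fwd (fwdBdd_conj h.fwd) h.ne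
  obtain ⟨N₁, hN₁, e₁⟩ := integral_normSq_pos hP hζ h.sol h.fwd h.ne
  have h' := h.reflect
  obtain ⟨N₂, hN₂, e₂⟩ := integral_normSq_pos hP.reflect hζ h'.sol h'.fwd h'.ne
  intro h0
  have e' : ∀ x, starRingEnd ℂ (v x) = k * v x := congrFun e
  simp only [e', mul_assoc, integral_const_mul] at e₁ e₂
  have : ((N₁ + N₂ : ℝ) : ℂ) = 0 := by
    push_cast
    rw [← e₁, ← e₂, ← mul_add, h0, mul_zero]
  have h3 : N₁ + N₂ = 0 := by exact_mod_cast this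
  linarith

end

/-- The derivative of the frame determinant at a zero. -/
theorem EvansFrame.hasDerivAt_frameDet {a : ℝ → ℝ} {Λ A c R : ℝ} (hP : Coercive a Λ A c R)
    {Bu Bs : ℂ → Fin 2 → ℂ} (hF : EvansFrame a Λ Bu Bs) {ζ₀ : ℂ} (hζ₀ : ζ₀ ∈ halfPlane Λ)
    {k : ℂ} (hk0 : k ≠ 0) (hk : Bs ζ₀ = k • Bu ζ₀) {v q : ℝ → ℂ} (h : IsSol a ζ₀ v q)
    (hv : v 0 = Bu ζ₀ 0) (hq : q 0 = Bu ζ₀ 1) :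
    HasDerivAt (frameDet Bu Bs)
      (k * ((∫ x in Ioi (0 : ℝ), v x * v x) + ∫ x in Ioi (0 : ℝ), v (-x) * v (-x))) ζ₀ := by
  choose vu qu hsu hvu hqu using fun ζ =>
    IsSol.exists_of_data hP.cont hP.bdd ζ 0 (Bu ζ 0) (Bu ζ 1)
  choose vs qs hss hvs hqs using fun ζ =>
    IsSol.exists_of_data hP.cont hP.bdd ζ 0 (Bs ζ 0) (Bs ζ 1)
  have hmem := (isOpen_halfPlane Λ).mem_nhds hζ₀
  have hdu := hasDerivAt_pi.1 (hF.analytic_u ζ₀ hζ₀).differentiableAt.hasDerivAt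
  have hds := hasDerivAt_pi.1 (hF.analytic_s ζ₀ hζ₀).differentiableAt.hasDerivAt
  have hcu := fun i => (hdu i).continuousAt
  have hcs := fun i => (hds i).continuousAt
  have hfu : ∀ᶠ ζ in 𝓝 ζ₀, FwdBdd (vu ζ) (qu ζ) := by
    filter_upwards [hmem] with ζ hζ
    refine (hF.fwd_iff ζ hζ _ _ (hsu ζ)).1 ⟨1, ?_⟩
    ext i
    fin_cases i <;> simp [hvu, hqu]
  have hbs : ∀ᶠ ζ in 𝓝 ζ₀, BwdBdd (vs ζ) (qs ζ) := by
    filter_upwards [hmem] with ζ hζ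
    refine (hF.bwd_iff ζ hζ _ _ (hss ζ)).1 ⟨1, ?_⟩
    ext i
    fin_cases i <;> simp [hvs, hqs]
  have D₁ := hasDerivAt_wronsk_fwdBdd hP (Eventually.of_forall hsu) (b := 0)
    (by simpa [hvu] using hcu 0) (by simpa [hqu] using hcu 1) hζ₀ hfu le_rfl
  have D₂ := hasDerivAt_wronsk_fwdBdd hP.reflect (Eventually.of_forall fun ζ => (hss ζ).reflect)
    (b := 0) (by simpa [hvs] using hcs 0) (by simp only [neg_zero, hqs]; exact (hcs 1).neg) hζ₀ hbs le_rfl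
  obtain ⟨eu, -⟩ := (hsu ζ₀).eq_of_eq_at hP.bdd h (y := 0) (by rw [hvu, hv]) (by rw [hqu, hq])
  obtain ⟨es, -⟩ := (hss ζ₀).eq_of_eq_at hP.bdd (h.const_mul k) (y := 0)
    (by rw [hvs, hv, hk]; rfl) (by rw [hqs, hq, hk]; rfl)
  simp only [wronsk, hvu, hqu, hvs, hqs, neg_zero, eu, es] at D₁ D₂
  -- The one-sided Wronskian derivatives are computed again by the product rule. Comparison
  -- identifies the two halves of the derivative of the determinant, because `Bs` and `Bu` are
  -- proportional at `ζ₀`.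
  have D₁' := ((hdu 0).mul_const (Bu ζ₀ 1)).sub ((hdu 1).mul_const (Bu ζ₀ 0))
  have D₂' := ((hds 0).mul_const (-Bs ζ₀ 1)).sub ((hds 1).neg.mul_const (Bs ζ₀ 0))
  have u₁ := D₁.unique D₁'
  have u₂ := D₂.unique D₂'
  have D := ((hdu 0).mul (hds 1)).sub ((hdu 1).mul (hds 0))
  refine D.congr_deriv ?_
  have hk1 : ∀ i, Bs ζ₀ i = k * Bu ζ₀ i := fun i => by rw [hk]; rfl
  have u₃ : ∫ x in Ioi (0 : ℝ), k * v (-x) * (k * v (-x)) =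
      k ^ 2 * ∫ x in Ioi (0 : ℝ), v (-x) * v (-x) := by
    rw [← integral_const_mul]
    congr 1
    ext x
    ring
  rw [u₃] at u₂
  simp only [hk1] at u₂ ⊢
  refine mul_left_cancel₀ hk0 ?_
  linear_combination (-k ^ 2) * u₁ - u₂

/-- Zeros of the frame determinant are real and simple. -/
theorem EvansFrame.simple {a : ℝ → ℝ} {Λ A c R : ℝ} (hP : Coercive a Λ A c R)
    {Bu Bs : ℂ → Fin 2 → ℂ} (hF : EvansFrame a Λ Bu Bs) {ζ₀ : ℂ} (hζ₀ : ζ₀ ∈ halfPlane Λ)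
    (h0 : frameDet Bu Bs ζ₀ = 0) :
    ζ₀.im = 0 ∧ analyticOrderAt (frameDet Bu Bs) ζ₀ = 1 := by
  obtain ⟨v', q', h'⟩ := (hF.eq_zero_iff hP hζ₀).1 h0
  refine ⟨h'.im_eq_zero hP hζ₀, ?_⟩
  obtain ⟨k, hk⟩ := exists_eq_smul_of_det_eq_zero (hF.ne_u ζ₀ hζ₀) h0
  have hk0 : k ≠ 0 := fun h => hF.ne_s ζ₀ hζ₀ (by rw [hk, h, zero_smul])
  obtain ⟨v, q, h, hv, hq⟩ := IsSol.exists_of_data hP.cont hP.bdd ζ₀ 0 (Bu ζ₀ 0) (Bu ζ₀ 1)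
  have e : ![v 0, q 0] = Bu ζ₀ := by ext i; fin_cases i <;> simp [hv, hq]
  have hE : IsEigen a ζ₀ v q := by
    refine ⟨h, (hF.fwd_iff ζ₀ hζ₀ v q h).1 ⟨1, by rw [e, one_smul]⟩,
      (hF.bwd_iff ζ₀ hζ₀ v q h).1 ⟨k⁻¹, by rw [hk, smul_smul, inv_mul_cancel₀ hk0, one_smul, e]⟩,
      fun h0 => hF.ne_u ζ₀ hζ₀ ?_⟩
    obtain ⟨h1, h2⟩ := amp_eq_zero.1 h0
    rw [← e, h1, h2]
    ext i
    fin_cases i <;> rfl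
  have hd := hF.hasDerivAt_frameDet hP hζ₀ hk0 hk h hv hq
  have hcomp : ∀ {B : ℂ → Fin 2 → ℂ}, AnalyticOnNhd ℂ B (halfPlane Λ) → ∀ i,
      AnalyticAt ℂ (fun ζ => B ζ i) ζ₀ := fun hB i => analyticAt_pi_iff.1 (hB ζ₀ hζ₀) i
  have han : AnalyticAt ℂ (frameDet Bu Bs) ζ₀ :=
    ((hcomp hF.analytic_u 0).mul (hcomp hF.analytic_s 1)).sub
      ((hcomp hF.analytic_u 1).mul (hcomp hF.analytic_s 0))
  have := han.analyticOrderAt_sub_eq_one_of_deriv_ne_zero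
    (by rw [hd.deriv]; exact mul_ne_zero hk0 (integrals_ne_zero hP hζ₀ hE))
  simpa [h0] using this

/-! ### Real eigenfunctions and Sturm comparison through the Picone identity. -/

lemma ofReal_mem_halfPlane {Λ l : ℝ} : (l : ℂ) ∈ halfPlane Λ ↔ Λ < l := by simp [halfPlane]

lemma IsEigen.amp_ne {a : ℝ → ℝ} {A : ℝ} {ζ : ℂ} {v q : ℝ → ℂ} (hA : ∀ x, |a x| ≤ A)
    (h : IsEigen a ζ v q) (x : ℝ) : amp v q x ≠ 0 := h.sol.amp_ne_zero hA h.ne x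

lemma IsEigen.const_mul {a : ℝ → ℝ} {ζ : ℂ} {v q : ℝ → ℂ} (h : IsEigen a ζ v q) {k : ℂ}
    (hk : k ≠ 0) : IsEigen a ζ (fun x => k * v x) (fun x => k * q x) := by
  refine ⟨h.sol.const_mul k, fwdBdd_const_mul k h.fwd, bwdBdd_const_mul k h.bwd, fun h0 => ?_⟩
  obtain ⟨h1, h2⟩ := amp_eq_zero.1 h0
  exact h.ne (amp_eq_zero.2 ⟨(mul_eq_zero.1 h1).resolve_left hk,
    (mul_eq_zero.1 h2).resolve_left hk⟩)

lemma eq_mul_of_bwdBdd {a : ℝ → ℝ} {Λ A c R : ℝ} {ζ : ℂ} {v q w r : ℝ → ℂ}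
    (hP : Coercive a Λ A c R) (hζ : ζ ∈ halfPlane Λ) (h : IsSol a ζ v q) (hw : IsSol a ζ w r)
    (hb : BwdBdd v q) (hb' : BwdBdd w r) {y : ℝ} (hne : amp v q y ≠ 0) :
    ∃ k : ℂ, w = (fun x => k * v x) ∧ r = fun x => k * q x := by
  obtain ⟨k, e₁, e₂⟩ := eq_mul_of_fwdBdd hP.reflect hζ h.reflect hw.reflect hb hb' (y := -y)
    (by simpa [amp_reflect] using hne)
  refine ⟨k, funext fun x => by simpa using congrFun e₁ (-x), funext fun x => ?_⟩
  simpa using congrFun e₂ (-x)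

/-- A solution at a real parameter that is bounded on `[0, ∞)` and takes a nonzero real value is
real. -/
lemma conj_eq_of_fwdBdd {a : ℝ → ℝ} {Λ A c R l : ℝ} {v q : ℝ → ℂ} (hP : Coercive a Λ A c R)
    (hl : Λ < l) (h : IsSol a l v q) (hb : FwdBdd v q) {y : ℝ} (hy : v y = 1) (x : ℝ) :
    starRingEnd ℂ (v x) = v x ∧ starRingEnd ℂ (q x) = q x := by
  have hc := h.conj
  rw [Complex.conj_ofReal] at hc
  obtain ⟨k, e₁, e₂⟩ := eq_mul_of_fwdBdd hP (ofReal_mem_halfPlane.2 hl) h hc hb (fwdBdd_conj hb)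
    (y := y) (fun h0 => by simpa [hy] using (amp_eq_zero.1 h0).1)
  have hk : k = 1 := by simpa [hy] using (congrFun e₁ y).symm
  subst hk
  exact ⟨by simpa using congrFun e₁ x, by simpa using congrFun e₂ x⟩

lemma conj_eq_of_bwdBdd {a : ℝ → ℝ} {Λ A c R l : ℝ} {v q : ℝ → ℂ} (hP : Coercive a Λ A c R)
    (hl : Λ < l) (h : IsSol a l v q) (hb : BwdBdd v q) {y : ℝ} (hy : v y = 1) (x : ℝ) :
    starRingEnd ℂ (v x) = v x ∧ starRingEnd ℂ (q x) = q x := by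
  have := conj_eq_of_fwdBdd hP.reflect hl h.reflect hb (y := -y) (by simpa using hy) (-x)
  simpa using this

/-- The Picone function of a solution `(v, q)` relative to a real solution `(u, p)`. -/
def picone (v q : ℝ → ℂ) (u p : ℝ → ℝ) (x : ℝ) : ℝ := lyap v q x - ‖v x‖ ^ 2 * (p x / u x)

lemma picone_reflect (v q : ℝ → ℂ) (u p : ℝ → ℝ) (x : ℝ) :
    picone (fun x => v (-x)) (fun x => -q (-x)) (fun x => u (-x)) (fun x => -p (-x)) x =
      -picone v q u p (-x) := by
  simp [picone, lyap]
  ring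

lemma IsSol.real {a : ℝ → ℝ} {l : ℝ} {u p : ℝ → ℝ}
    (h : IsSol a l (fun x => (u x : ℂ)) (fun x => (p x : ℂ))) (x : ℝ) :
    HasDerivAt u (p x) x ∧ HasDerivAt p ((a x + l) * u x) x := by
  have h1 := Complex.reCLM.hasFDerivAt.comp_hasDerivAt x (h.dv x)
  have h2 := Complex.reCLM.hasFDerivAt.comp_hasDerivAt x (h.dq x)
  exact ⟨h1.congr_deriv (by simp), h2.congr_deriv (by simp)⟩

section

variable {a : ℝ → ℝ} {Λ A c R l l' : ℝ} {v q : ℝ → ℂ} {u p : ℝ → ℝ}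

/-- Picone identity: the derivative is exactly `|q - (p / u) v|² + (l - l') |v|²`. -/
lemma picone_deriv (h : IsSol a l v q) (hu : IsSol a l' (fun x => (u x : ℂ)) (fun x => (p x : ℂ)))
    {x : ℝ} (hx : u x ≠ 0) : ∃ D, HasDerivAt (picone v q u p) D x ∧ (l - l') * ‖v x‖ ^ 2 ≤ D := by
  have h1 := (h.lyap_deriv x).sub ((h.dv x).norm_sq.mul ((hu.real x).2.div (hu.real x).1 hx))
  refine ⟨_, h1, ?_⟩
  have h2 : 0 ≤ ‖q x - ((p x / u x : ℝ) : ℂ) * v x‖ ^ 2 := sq_nonneg _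
  rw [show ((p x / u x : ℝ) : ℂ) * v x = (p x / u x) • v x from rfl, norm_sub_sq_real,
    norm_smul, real_inner_smul_right, real_inner_comm, mul_pow, Real.norm_eq_abs, sq_abs] at h2
  have e : ((a x + l') * u x * u x - p x * p x) / u x ^ 2 = a x + l' - (p x / u x) ^ 2 := by
    field_simp
  rw [e]
  simp only [Complex.ofReal_re, Pi.div_apply]
  nlinarith

lemma picone_monotoneOn (h : IsSol a l v q)
    (hu : IsSol a l' (fun x => (u x : ℂ)) (fun x => (p x : ℂ))) (hl : l' ≤ l) {x₁ : ℝ}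
    (hne : ∀ x, x₁ < x → u x ≠ 0) : MonotoneOn (picone v q u p) (Ioi x₁) := by
  refine monotoneOn_of_deriv_nonneg (convex_Ioi x₁) (fun x hx => ?_) (fun x hx => ?_)
    fun x hx => ?_
  · obtain ⟨D, hD, -⟩ := picone_deriv h hu (hne x hx)
    exact hD.continuousAt.continuousWithinAt
  · rw [interior_Ioi] at hx
    obtain ⟨D, hD, -⟩ := picone_deriv h hu (hne x hx)
    exact hD.differentiableAt.differentiableWithinAt
  · rw [interior_Ioi] at hx
    obtain ⟨D, hD, hle⟩ := picone_deriv h hu (hne x hx)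
    rw [hD.deriv]
    refine le_trans ?_ hle
    have : 0 ≤ l - l' := by linarith
    positivity

lemma eq_zero_of_picone_eq_zero (h : IsSol a l v q)
    (hu : IsSol a l' (fun x => (u x : ℂ)) (fun x => (p x : ℂ))) (hl : l' < l) {x : ℝ} (hx : u x ≠ 0)
    (h0 : picone v q u p =ᶠ[𝓝 x] 0) : v x = 0 := by
  obtain ⟨D, hD, hle⟩ := picone_deriv h hu hx
  have : D = 0 := hD.unique ((hasDerivAt_const x (0 : ℝ)).congr_of_eventuallyEq h0)
  rw [this] at hle
  have h1 : 0 < l - l' := by linarith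
  have h2 : ‖v x‖ ^ 2 ≤ 0 := by
    by_contra! hc
    have := mul_pos h1 hc
    linarith
  simpa using h2

/-- The Picone function increases to its limit `0` at infinity; the limit is `0` because `v` and `q`
decay while `p / u` stays bounded. -/
lemma picone_nonpos (h : IsSol a l v q) (hu : IsSol a l' (fun x => (u x : ℂ)) (fun x => (p x : ℂ)))
    (hP : Coercive a Λ A c R) (hΛ' : Λ < l') (hl : l' ≤ l) (hb : FwdBdd v q)
    (hbu : FwdBdd (fun x => (u x : ℂ)) (fun x => (p x : ℂ))) {x₁ : ℝ} (hne : ∀ x, x₁ < x → u x ≠ 0)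
    {x : ℝ} (hx : x₁ < x) : picone v q u p x ≤ 0 := by
  have hmono := picone_monotoneOn h hu hl hne
  have hζ : (l : ℂ) ∈ halfPlane Λ := ofReal_mem_halfPlane.2 (by linarith)
  have hζ' : (l' : ℂ) ∈ halfPlane Λ := ofReal_mem_halfPlane.2 hΛ'
  have hc := hP.c_pos
  set k := c * Real.exp (-(1 + A + |l'|))
  have hk : 0 < k := by positivity
  have hlim : Tendsto (picone v q u p) atTop (𝓝 0) := by
    have ht := (amp_add_tendsto hP hζ hζ h h hb hb).const_mul (1 + k⁻¹)
    rw [mul_zero] at ht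
    refine squeeze_zero_norm' ?_ ht
    filter_upwards [eventually_ge_atTop R, eventually_gt_atTop x₁] with y hy hy'
    have e1 := hu.amp_le_neg_lyap hP hζ' (fun _ hx => hu.lyap_nonpos hP hζ' hbu hx) hy
    have e2 := (neg_le_abs _).trans (abs_real_inner_le_norm (u y : ℂ) (p y : ℂ))
    have e3 := e1.trans e2
    simp only [amp, Complex.norm_real, Real.norm_eq_abs] at e3
    have hu0 : 0 < |u y| := abs_pos.2 (hne y hy')
    -- From `k * (u² + p²) ≤ |u| * |p|`, drop `u²` and cancel `|p|`.
    have e4 : |p y / u y| ≤ k⁻¹ := by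
      rw [abs_div, div_le_iff₀ hu0, ← div_eq_inv_mul, le_div_iff₀ hk]
      rcases (abs_nonneg (p y)).eq_or_lt with h0 | h0
      · rw [← h0]; simp
      · refine le_of_mul_le_mul_right ?_ h0
        change k * (|u y| ^ 2 + |p y| ^ 2) ≤ |u y| * |p y| at e3
        nlinarith [mul_nonneg hk.le (sq_nonneg |u y|)]
    have e5 := two_abs_lyap_le v q y
    have e6 : ‖v y‖ ^ 2 ≤ amp v q y := by unfold amp; nlinarith [sq_nonneg ‖q y‖]
    have e7 := amp_nonneg v q y
    calc ‖picone v q u p y‖ ≤ |lyap v q y| + |‖v y‖ ^ 2 * (p y / u y)| := abs_sub _ _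
      _ ≤ amp v q y + amp v q y * k⁻¹ := by
        rw [abs_mul, abs_of_nonneg (sq_nonneg ‖v y‖)]
        gcongr
        linarith [abs_nonneg (lyap v q y)]
      _ ≤ (1 + k⁻¹) * (amp v q y + amp v q y) := by
        have : 0 < k⁻¹ := by positivity
        nlinarith
  refine ge_of_tendsto hlim ?_
  filter_upwards [eventually_ge_atTop x] with y hy
  exact hmono hx (lt_of_lt_of_le hx hy) hy

/-- The delicate case is a common zero of `u` and `v`: the zero of `u` is simple, so the quotient
`|v|² / u` still tends to `0`. Allowing it lets the comparison start at the zero of `u` itself. -/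
lemma picone_tendsto (h : IsSol a l v q) (hu : IsSol a l' (fun x => (u x : ℂ)) (fun x => (p x : ℂ)))
    {x₁ : ℝ} (hv : v x₁ = 0) (hne : amp (fun x => (u x : ℂ)) (fun x => (p x : ℂ)) x₁ ≠ 0) :
    Tendsto (picone v q u p) (𝓝[>] x₁) (𝓝 0) := by
  have h1 : Tendsto (lyap v q) (𝓝[>] x₁) (𝓝 0) := by
    have := (h.lyap_deriv x₁).continuousAt.tendsto
    rw [show lyap v q x₁ = 0 by simp [lyap, hv]] at this
    exact this.mono_left nhdsWithin_le_nhds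
  have hp := (hu.real x₁).2.continuousAt.tendsto
  have hvt : Tendsto (fun x => ‖v x‖) (𝓝 x₁) (𝓝 0) := by
    have := (h.cont_v.tendsto x₁).norm
    rwa [hv, norm_zero] at this
  have h2 : Tendsto (fun x => ‖v x‖ ^ 2 * (p x / u x)) (𝓝[>] x₁) (𝓝 0) := by
    by_cases h0 : u x₁ = 0
    · have hp0 : p x₁ ≠ 0 := fun hp0 => hne (amp_eq_zero.2 (by simp [h0, hp0]))
      have s₁ := (hasDerivAt_iff_tendsto_slope.1 (h.dv x₁)).norm.mono_left
        (nhdsWithin_mono x₁ fun x (hx : x ∈ Ioi x₁) => ne_of_gt hx)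
      have s₂ := (hasDerivAt_iff_tendsto_slope.1 (hu.real x₁).1).mono_left
        (nhdsWithin_mono x₁ fun x (hx : x ∈ Ioi x₁) => ne_of_gt hx)
      have s := ((hvt.mono_left nhdsWithin_le_nhds).mul s₁).mul
        ((hp.mono_left nhdsWithin_le_nhds).div s₂ hp0)
      rw [zero_mul, zero_mul] at s
      refine s.congr' ?_
      filter_upwards [self_mem_nhdsWithin] with x hx
      have hx' : 0 < x - x₁ := sub_pos.2 hx
      simp only [Pi.div_apply, slope, vsub_eq_sub, hv, h0, sub_zero, norm_smul, norm_inv, Real.norm_eq_abs,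
        abs_of_pos hx', smul_eq_mul]
      field_simp
    · have := (hvt.pow 2).mul (hp.div (hu.real x₁).1.continuousAt.tendsto h0)
      rw [zero_pow two_ne_zero, zero_mul] at this
      exact this.mono_left nhdsWithin_le_nhds
  have h3 := h1.sub h2
  rw [sub_zero] at h3
  exact h3

/-- Sturm comparison on a half line: `v` cannot vanish to the right of the zeros of `u`. -/
lemma ne_zero_of_picone (h : IsSol a l v q)
    (hu : IsSol a l' (fun x => (u x : ℂ)) (fun x => (p x : ℂ))) (hP : Coercive a Λ A c R)
    (hΛ' : Λ < l') (hl : l' < l) (hb : FwdBdd v q)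
    (hbu : FwdBdd (fun x => (u x : ℂ)) (fun x => (p x : ℂ))) {x₁ : ℝ} (hne : ∀ x, x₁ < x → u x ≠ 0)
    (hv : amp v q x₁ ≠ 0) : v x₁ ≠ 0 := by
  intro h0
  have hu1 : amp (fun x => (u x : ℂ)) (fun x => (p x : ℂ)) x₁ ≠ 0 := by
    refine hu.amp_ne_zero hP.bdd (y := x₁ + 1) (fun h1 => hne (x₁ + 1) (by linarith) ?_) x₁
    exact_mod_cast (amp_eq_zero.1 h1).1
  -- An increasing function that starts at `0` and never exceeds `0` is trivial; strictness `l' < l`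
  -- then kills `v`.
  have hz : ∀ x, x₁ < x → picone v q u p x = 0 := by
    intro x hx
    refine le_antisymm (picone_nonpos h hu hP hΛ' hl.le hb hbu hne hx) ?_
    refine le_of_tendsto (picone_tendsto h hu h0 hu1) ?_
    filter_upwards [Ioo_mem_nhdsGT hx] with y hy
    exact picone_monotoneOn h hu hl.le hne hy.1 hx hy.2.le
  have hv0 : ∀ x, x₁ < x → v x = 0 := fun x hx =>
    eq_zero_of_picone_eq_zero h hu hl (hne x hx)
      (by filter_upwards [lt_mem_nhds hx] with y hy using hz y hy)
  have hx : x₁ < x₁ + 1 := by linarith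
  have hq0 : q (x₁ + 1) = 0 := (h.dv (x₁ + 1)).unique
    ((hasDerivAt_const (x₁ + 1) (0 : ℂ)).congr_of_eventuallyEq
      (by filter_upwards [lt_mem_nhds hx] with y hy using hv0 y hy))
  exact h.amp_ne_zero hP.bdd hv (x₁ + 1) (amp_eq_zero.2 ⟨hv0 _ hx, hq0⟩)

end

section

variable {a : ℝ → ℝ} {Λ A c R l l' : ℝ} {v q : ℝ → ℂ} {u p : ℝ → ℝ}

/-- An eigenfunction above one with a single zero has no zeros. -/
theorem IsEigen.ne_zero_of_single_zero (hP : Coercive a Λ A c R) (hΛ' : Λ < l') (hl : l' < l)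
    (h : IsEigen a l v q) (hu : IsEigen a l' (fun x => (u x : ℂ)) (fun x => (p x : ℂ))) {x₀ : ℝ}
    (hz : ∀ x, x ≠ x₀ → u x ≠ 0) (x : ℝ) : v x ≠ 0 := by
  -- The point `x₀` is an admissible endpoint for either half line, so the two sides cover `ℝ`.
  rcases le_total x₀ x with hx | hx
  · exact ne_zero_of_picone h.sol hu.sol hP hΛ' hl h.fwd hu.fwd
      (fun y hy => hz y (ne_of_gt (lt_of_le_of_lt hx hy))) (h.amp_ne hP.bdd x)
  · have h' := h.reflect
    have hu' : IsEigen (fun x => a (-x)) l' (fun x => ((u (-x) : ℝ) : ℂ))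
        (fun x => ((-p (-x) : ℝ) : ℂ)) := by simpa using hu.reflect
    have := ne_zero_of_picone (u := fun x => u (-x)) (p := fun x => -p (-x)) (x₁ := -x)
      h'.sol hu'.sol hP.reflect hΛ' hl h'.fwd hu'.fwd
      (fun y hy => hz (-y) (by intro e; linarith)) (h'.amp_ne hP.reflect.bdd (-x))
    simpa using this

/-- There is at most one eigenvalue with a nowhere vanishing eigenfunction. -/
theorem not_isEigen_of_lt (hP : Coercive a Λ A c R) (hΛ' : Λ < l') (hl : l' < l)
    (hu : IsEigen a l' (fun x => (u x : ℂ)) (fun x => (p x : ℂ))) (hz : ∀ x, u x ≠ 0) :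
    ¬ IsEigen a l v q := by
  intro h
  have h' := h.reflect
  have hu' : IsEigen (fun x => a (-x)) l' (fun x => ((u (-x) : ℝ) : ℂ))
      (fun x => ((-p (-x) : ℝ) : ℂ)) := by simpa using hu.reflect
  -- Half-line comparison from the right gives `≤ 0`; from the left, where reflection flips the
  -- sign, it gives `≥ 0`.
  have hzero : ∀ x, picone v q u p x = 0 := by
    intro x
    refine le_antisymm (picone_nonpos h.sol hu.sol hP hΛ' hl.le h.fwd hu.fwd (x₁ := x - 1)
      (fun y _ => hz y) (by linarith)) ?_
    have := picone_nonpos (u := fun x => u (-x)) (p := fun x => -p (-x)) h'.sol hu'.sol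
      hP.reflect hΛ' hl.le h'.fwd hu'.fwd (x₁ := -x - 1) (fun y _ => hz (-y))
      (show -x - 1 < -x by linarith)
    rw [picone_reflect, neg_neg] at this
    linarith
  have hv0 : ∀ x, v x = 0 := fun x =>
    eq_zero_of_picone_eq_zero h.sol hu.sol hl (hz x) (Eventually.of_forall hzero)
  have hq0 : q 0 = 0 := (h.sol.dv 0).unique
    ((hasDerivAt_const 0 (0 : ℂ)).congr_of_eventuallyEq (Eventually.of_forall hv0))
  exact h.ne (amp_eq_zero.2 ⟨hv0 0, hq0⟩)

/-- Dividing by `v 0` makes the eigenfunction real, as the Picone comparison requires of its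
reference solution. -/
lemma IsEigen.exists_real (hP : Coercive a Λ A c R) (hl : Λ < l) (h : IsEigen a l v q)
    (hz : ∀ x, v x ≠ 0) : ∃ u p : ℝ → ℝ,
      IsEigen a l (fun x => (u x : ℂ)) (fun x => (p x : ℂ)) ∧ ∀ x, u x ≠ 0 := by
  have h' := h.const_mul (inv_ne_zero (hz 0))
  have hr := conj_eq_of_fwdBdd hP hl h'.sol h'.fwd (y := 0) (inv_mul_cancel₀ (hz 0))
  have e1 : ∀ x, ((((v 0)⁻¹ * v x).re : ℝ) : ℂ) = (v 0)⁻¹ * v x := fun x =>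
    Complex.conj_eq_iff_re.1 (hr x).1
  have e2 : ∀ x, ((((v 0)⁻¹ * q x).re : ℝ) : ℂ) = (v 0)⁻¹ * q x := fun x =>
    Complex.conj_eq_iff_re.1 (hr x).2
  refine ⟨fun x => ((v 0)⁻¹ * v x).re, fun x => ((v 0)⁻¹ * q x).re, ?_, fun x h0 => ?_⟩
  · simp only [e1, e2]
    exact h'
  · have := e1 x
    change ((v 0)⁻¹ * v x).re = 0 at h0
    rw [h0] at this
    exact mul_ne_zero (inv_ne_zero (hz 0)) (hz x) (by simpa using this.symm)

end

/-! ### Existence of a positive eigenvalue by the intermediate value theorem. -/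

/-- In the coercive range, a solution bounded on `[0, ∞)` that is positive somewhere on `[0, ∞)` is
positive and decreasing at `0`. -/
lemma pos_of_coercive {a : ℝ → ℝ} {Λ A c l ρ : ℝ} {v q : ℝ → ℂ} (hP : Coercive a Λ A c 0)
    (hl : Λ < l) (h : IsSol a l v q) (hb : FwdBdd v q) (hρ : 0 ≤ ρ) (hv : v ρ = 1) :
    0 < (v 0).re ∧ (q 0).re < 0 := by
  have hζ := ofReal_mem_halfPlane.2 hl
  have hr := conj_eq_of_fwdBdd hP hl h hb hv
  have hamp : ∀ x, amp v q x ≠ 0 := h.amp_ne_zero hP.bdd (y := ρ)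
    (fun h0 => by simpa [hv] using (amp_eq_zero.1 h0).1)
  have hne : ∀ x, 0 ≤ x → (v x).re ≠ 0 := fun x hx h0 => by
    refine h.ne_zero_of_fwdBdd hP hζ hb hx (hamp x) ?_
    rw [← Complex.conj_eq_iff_re.1 (hr x).1, h0, Complex.ofReal_zero]
  have hpos : 0 < (v 0).re := by
    by_contra! hneg
    obtain ⟨x, hx, h0⟩ := intermediate_value_Icc hρ
      (f := fun x => (v x).re) (Complex.continuous_re.comp h.cont_v).continuousOn
      (show (0 : ℝ) ∈ Icc ((v 0).re) ((v ρ).re) from ⟨hneg, by simp [hv]⟩)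
    exact hne x hx.1 h0
  refine ⟨hpos, ?_⟩
  have h1 := h.amp_le_neg_lyap hP hζ (fun _ hx => h.lyap_nonpos hP hζ hb hx) (le_refl (0 : ℝ))
  have h2 := (amp_nonneg v q 0).lt_of_ne' (hamp 0)
  have h3 := hP.c_pos
  have h4 : 0 < -lyap v q 0 := lt_of_lt_of_le (by positivity) h1
  have h5 : lyap v q 0 = (v 0).re * (q 0).re := by
    have i1 := Complex.conj_eq_iff_im.1 (hr 0).1
    simp [lyap, Complex.inner, i1, mul_comm]
  rw [h5] at h4
  by_contra! hneg
  have := mul_nonneg hpos.le hneg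
  linarith

/-- A real eigenfunction at `0` with opposite signs near `±∞` forces a positive eigenvalue. -/
theorem exists_pos_eigenvalue {a : ℝ → ℝ} {Λ A c R : ℝ} {u p : ℝ → ℝ} (hP : Coercive a Λ A c R)
    (hΛ : Λ < 0) (hu : IsEigen a 0 (fun x => (u x : ℂ)) (fun x => (p x : ℂ)))
    (hsign : u R * u (-R) < 0) : ∃ l : ℝ, 0 < l ∧ ∃ v q, IsEigen a l v q := by
  obtain ⟨vp, qp, vm, qm, hp, hm, hF⟩ := exists_normalised_frame hP
  set E := frameDet (fun ζ => ![vp ζ 0, qp ζ 0]) (fun ζ => ![vm ζ 0, qm ζ 0]) with hE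
  have hEv : ∀ ζ, E ζ = vp ζ 0 * qm ζ 0 - qp ζ 0 * vm ζ 0 := fun ζ => by simp [hE, frameDet]
  have hmem : ∀ l : ℝ, Λ < l → (l : ℂ) ∈ halfPlane Λ := fun l hl => ofReal_mem_halfPlane.2 hl
  have hreal_p : ∀ l : ℝ, Λ < l → ∀ x, starRingEnd ℂ (vp l x) = vp l x ∧
      starRingEnd ℂ (qp l x) = qp l x := fun l hl x =>
    conj_eq_of_fwdBdd hP hl (hp l (hmem l hl)).1 (hp l (hmem l hl)).2.1 (hp l (hmem l hl)).2.2 x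
  have hreal_m : ∀ l : ℝ, Λ < l → ∀ x, starRingEnd ℂ (vm l x) = vm l x ∧
      starRingEnd ℂ (qm l x) = qm l x := fun l hl x =>
    conj_eq_of_bwdBdd hP hl (hm l (hmem l hl)).1 (hm l (hmem l hl)).2.1 (hm l (hmem l hl)).2.2 x
  have hEim : ∀ l : ℝ, Λ < l → (E l).im = 0 := fun l hl => by
    rw [← Complex.conj_eq_iff_im, hEv, map_sub, map_mul, map_mul, (hreal_p l hl 0).1,
      (hreal_p l hl 0).2, (hreal_m l hl 0).1, (hreal_m l hl 0).2]
  have hdiff : ∀ ζ ∈ halfPlane Λ, DifferentiableAt ℂ E ζ := fun ζ hζ => by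
    have d1 := differentiableAt_pi.1 (hF.analytic_u ζ hζ).differentiableAt
    have d2 := differentiableAt_pi.1 (hF.analytic_s ζ hζ).differentiableAt
    exact ((d1 0).mul (d2 1)).sub ((d1 1).mul (d2 0))
  have h0mem : (0 : ℂ) ∈ halfPlane Λ := by simpa using hmem 0 hΛ
  have hR1 : u R ≠ 0 := fun h => by simp [h] at hsign
  have hR2 : u (-R) ≠ 0 := fun h => by simp [h] at hsign
  obtain ⟨hps, hpb, hpn⟩ := hp 0 h0mem
  obtain ⟨hms, hmb, hmn⟩ := hm 0 h0mem
  obtain ⟨k₁, e₁, e₁'⟩ := eq_mul_of_fwdBdd hP h0mem hu.sol hps hu.fwd hpb hu.ne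
  obtain ⟨k₂, e₂, e₂'⟩ := eq_mul_of_bwdBdd hP h0mem hu.sol hms hu.bwd hmb hu.ne
  have hk₁ : k₁ * u R = 1 := by rw [← hpn, e₁]
  have hk₂ : k₂ * u (-R) = 1 := by rw [← hmn, e₂]
  have huR1 : (u R : ℂ) ≠ 0 := by exact_mod_cast hR1
  have huR2 : (u (-R) : ℂ) ≠ 0 := by exact_mod_cast hR2
  -- The normalisations at `R` and `-R` make the left frame `κ` times the right one at `ζ = 0`. Thus
  -- the derivative of `E` at `0` is `κ` times a positive integral, and opposite signs of `u` make
  -- it negative.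
  set κ : ℝ := u R / u (-R) with hκ
  have hκneg : κ < 0 := by
    rw [hκ, div_neg_iff]
    rcases mul_neg_iff.1 hsign with h | h
    · exact Or.inl h
    · exact Or.inr h
  have hκ12 : (κ : ℂ) * k₁ = k₂ := by
    rw [eq_div_of_mul_eq huR1 hk₁, eq_div_of_mul_eq huR2 hk₂, hκ]
    push_cast
    field_simp
  have hBs : (![vm 0 0, qm 0 0] : Fin 2 → ℂ) = (κ : ℂ) • ![vp 0 0, qp 0 0] := by
    rw [e₁, e₁', e₂, e₂']
    ext i
    fin_cases i <;> simp [← hκ12, mul_assoc]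
  have hpe : IsEigen a 0 (vp 0) (qp 0) := by
    have hk₁0 : k₁ ≠ 0 := fun h => by simp [h] at hk₁
    rw [e₁, e₁']
    exact hu.const_mul hk₁0
  have hE0 : E 0 = 0 := (hF.eq_zero_iff hP h0mem).2 ⟨_, _, hpe⟩
  have hD := hF.hasDerivAt_frameDet hP h0mem (k := κ) (by exact_mod_cast hκneg.ne) hBs hps
    (by simp) (by simp)
  obtain ⟨N₁, hN₁, i₁⟩ := integral_normSq_pos hP h0mem hps hpb hpe.ne
  have hpe' := hpe.reflect
  obtain ⟨N₂, hN₂, i₂⟩ := integral_normSq_pos hP.reflect h0mem hpe'.sol hpe'.fwd hpe'.ne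
  have hr0 : ∀ x, starRingEnd ℂ (vp 0 x) = vp 0 x := fun x => by
    simpa using (hreal_p 0 hΛ x).1
  simp only [hr0] at i₁ i₂
  rw [i₁, i₂] at hD
  have hf : HasDerivAt (fun l : ℝ => (E l).re) (κ * (N₁ + N₂)) 0 := by
    have hD' : HasDerivAt E ((κ * (N₁ + N₂) : ℝ) : ℂ) ((0 : ℝ) : ℂ) := by
      rw [Complex.ofReal_zero]
      exact hD.congr_deriv (by push_cast; ring)
    simpa using hD'.real_of_complex
  have hslope : ∀ᶠ l in 𝓝[>] (0 : ℝ), slope (fun l : ℝ => (E l).re) 0 l < 0 := by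
    have h1 := (hasDerivAt_iff_tendsto_slope.1 hf).mono_left
      (nhdsWithin_mono (0 : ℝ) fun x (hx : x ∈ Ioi (0 : ℝ)) => ne_of_gt hx)
    exact h1.eventually_lt_const (mul_neg_of_neg_of_pos hκneg (by linarith))
  have hA : 0 ≤ A := (abs_nonneg _).trans (hP.bdd 0)
  obtain ⟨ε, hε1, hε2⟩ := (hslope.and (Ioo_mem_nhdsGT (show (0 : ℝ) < A + 2 by linarith))).exists
  have hneg : (E ε).re < 0 := by
    rw [slope_def_field] at hε1
    simp only [Complex.ofReal_zero, hE0, Complex.zero_re, sub_zero] at hε1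
    have := mul_neg_of_neg_of_pos hε1 hε2.1
    rwa [div_mul_cancel₀ _ hε2.1.ne'] at this
  -- Above `A + 1` the potential is coercive on the whole line, so the threshold is `0`; the
  -- parameter `A + 2` lies in this range.
  have hP' : Coercive a (A + 1) A 1 0 := ⟨hP.cont, hP.bdd, one_pos, le_rfl, le_rfl, fun x _ => by
    linarith [(abs_le.1 (hP.bdd x)).1]⟩
  have hpos : 0 < (E ((A + 2 : ℝ) : ℂ)).re := by
    have hL : Λ < A + 2 := by linarith
    obtain ⟨s1, b1, n1⟩ := hp _ (hmem _ hL)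
    obtain ⟨s2, b2, n2⟩ := hm _ (hmem _ hL)
    obtain ⟨p1, p2⟩ := pos_of_coercive hP' (show A + 1 < A + 2 by linarith) s1 b1 hP.R_nonneg n1
    obtain ⟨m1, m2⟩ := pos_of_coercive hP'.reflect (show A + 1 < A + 2 by linarith) s2.reflect b2
      hP.R_nonneg (by simpa using n2)
    simp only [neg_zero, Complex.neg_re] at m1 m2
    have j1 := Complex.conj_eq_iff_im.1 (hreal_p _ hL 0).1
    have j2 := Complex.conj_eq_iff_im.1 (hreal_p _ hL 0).2
    rw [hEv, Complex.sub_re, Complex.mul_re, Complex.mul_re, j1, j2]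
    have t1 := mul_pos p1 (neg_neg_iff_pos.1 m2)
    have t2 := mul_pos (neg_pos.2 p2) m1
    linarith
  obtain ⟨l, hl, hl0⟩ := intermediate_value_Icc hε2.2.le (f := fun l : ℝ => (E l).re)
    (fun l hl => by
      have hl' : Λ < l := hΛ.trans (hε2.1.trans_le hl.1)
      exact (Complex.continuous_re.continuousAt.comp ((hdiff l (hmem l hl')).continuousAt.comp_of_eq
        Complex.continuous_ofReal.continuousAt rfl)).continuousWithinAt)
    (show (0 : ℝ) ∈ Icc ((E ε).re) ((E ((A + 2 : ℝ) : ℂ)).re) from ⟨hneg.le, hpos.le⟩)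
  have hl' : 0 < l := hε2.1.trans_le hl.1
  refine ⟨l, hl', (hF.eq_zero_iff hP (hmem l (hΛ.trans hl'))).1 ?_⟩
  exact Complex.ext (by simpa using hl0) (by simpa using hEim l (hΛ.trans hl'))

/-! ### The homoclinic orbit and the linearisation about it. -/

lemma exists_abs_le_of_tendsto {f : ℝ → ℝ} {L : ℝ} (hf : Continuous f)
    (h₁ : Tendsto f atTop (𝓝 L)) (h₂ : Tendsto f atBot (𝓝 L)) : ∃ C, ∀ x, |f x| ≤ C := by
  have hc : Tendsto f (cocompact ℝ) (𝓝 L) := by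
    rw [cocompact_eq_atBot_atTop]
    exact h₂.sup h₁
  obtain ⟨C, hC⟩ := (hc.isCompact_insert_range_of_cocompact hf).isBounded.exists_norm_le
  exact ⟨C, fun x => hC _ (mem_insert_of_mem _ (mem_range_self x))⟩

lemma eq_zero_of_deriv_nonneg {v q : ℝ → ℝ} (hv : ∀ x, HasDerivAt v (q x) x)
    (h₁ : Tendsto v atTop (𝓝 0)) (h₂ : Tendsto v atBot (𝓝 0)) (hq : ∀ x, 0 ≤ q x) (x : ℝ) :
    v x = 0 := by
  have hm : Monotone v := monotone_of_deriv_nonneg (fun x => (hv x).differentiableAt) fun x => by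
    rw [(hv x).deriv]
    exact hq x
  exact le_antisymm (hm.ge_of_tendsto h₁ x) (hm.le_of_tendsto h₂ x)

lemma mem_spectrum_of_sq {κ ζ μ : ℂ} (h : μ ^ 2 = κ + ζ) :
    μ ∈ spectrum ℂ (!![0, 1; κ + ζ, 0] : Matrix (Fin 2) (Fin 2) ℂ) := by
  rw [spectrum.mem_iff, Matrix.isUnit_iff_isUnit_det, isUnit_iff_ne_zero, not_not, det_fin_two]
  simp [Matrix.algebraMap_matrix_apply]
  linear_combination h

namespace IsHomoclinic

variable {V : Set ℝ} {g v q : ℝ → ℝ}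

lemma cont_v (h : IsHomoclinic V g v q) : Continuous v :=
  continuous_iff_continuousAt.2 fun x => (h.hasDerivAt_v x).continuousAt

lemma cont_q (h : IsHomoclinic V g v q) : Continuous q :=
  continuous_iff_continuousAt.2 fun x => (h.hasDerivAt_q x).continuousAt

lemma not_forall_eq_zero (h : IsHomoclinic V g v q) : ¬ ∀ x, v x = 0 := by
  intro h0
  obtain ⟨x, hx⟩ := h.nontrivial
  refine hx (Prod.ext (h0 x) ?_)
  exact (h.hasDerivAt_v x).unique
    ((hasDerivAt_const x (0 : ℝ)).congr_of_eventuallyEq (Eventually.of_forall h0))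

/-- A homoclinic orbit is symmetric about each zero of its velocity. -/
lemma symmetric (h : IsHomoclinic V g v q) (hV : IsOpen V) (hVc : IsConnected V)
    (h0 : (0 : ℝ) ∈ V) (hg : ContDiffOn ℝ 1 g V) {x₀ : ℝ} (hx₀ : q x₀ = 0) (x : ℝ) :
    v (2 * x₀ - x) = v x := by
  have hc : Tendsto v (cocompact ℝ) (𝓝 0) := by
    rw [cocompact_eq_atBot_atTop]
    exact h.v_atBot.sup h.v_atTop
  have hcomp := hc.isCompact_insert_range_of_cocompact h.cont_v
  set S := insert 0 (range v)
  have hSne : S.Nonempty := insert_nonempty _ _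
  have hSV : S ⊆ V := by
    rintro y (rfl | ⟨x, rfl⟩)
    · exact h0
    · exact h.mem x
  -- A compact interval in `V` containing the orbit, on which the `C¹` function `g` is Lipschitz;
  -- this justifies uniqueness for the nonlinear equation.
  set T := Icc (sInf S) (sSup S)
  have hTV : T ⊆ V := hVc.Icc_subset (hSV (hcomp.sInf_mem hSne)) (hSV (hcomp.sSup_mem hSne))
  have hvT : ∀ x, v x ∈ T := fun x =>
    have hx : v x ∈ S := mem_insert_of_mem _ (mem_range_self x)
    ⟨csInf_le hcomp.bddBelow hx, le_csSup hcomp.bddAbove hx⟩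
  have hgd := hg.continuousOn_deriv_of_isOpen hV le_rfl
  obtain ⟨C, hC⟩ := (isCompact_Icc (a := sInf S) (b := sSup S)).exists_bound_of_continuousOn
    (hgd.mono hTV)
  have hlip : LipschitzOnWith C.toNNReal g T :=
    (convex_Icc _ _).lipschitzOnWith_of_nnnorm_deriv_le
      (fun y hy => (hg.differentiableOn one_ne_zero).differentiableAt (hV.mem_nhds (hTV hy)))
      fun y hy => by
        rw [← NNReal.coe_le_coe]
        exact (hC y hy).trans (Real.le_coe_toNNReal C)
  have hlip2 : LipschitzOnWith (max 1 C.toNNReal) (fun z : ℝ × ℝ => (z.2, g z.1)) (T ×ˢ univ) := by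
    have l1 : LipschitzOnWith 1 (fun z : ℝ × ℝ => z.2) (T ×ˢ univ) :=
      LipschitzWith.prod_snd.lipschitzOnWith
    have l2 : LipschitzOnWith (C.toNNReal * 1) (fun z : ℝ × ℝ => g z.1) (T ×ˢ univ) :=
      hlip.comp (LipschitzWith.prod_fst.lipschitzOnWith) fun z hz => hz.1
    rw [mul_one] at l2
    exact l1.prodMk l2
  have key := ODE_solution_unique_univ (v := fun (_ : ℝ) (z : ℝ × ℝ) => (z.2, g z.1))
    (s := fun _ => T ×ˢ univ) (f := fun x => (v (2 * x₀ - x), -q (2 * x₀ - x)))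
    (g := fun x => (v x, q x)) (t₀ := x₀) (fun _ => hlip2)
    (fun x => ⟨?_, hvT _, mem_univ _⟩)
    (fun x => ⟨(h.hasDerivAt_v x).prodMk (h.hasDerivAt_q x), hvT _, mem_univ _⟩) ?_
  · exact congrArg Prod.fst (congrFun key x)
  · have hr : HasDerivAt (fun x => 2 * x₀ - x) (-1) x := by
      simpa using (hasDerivAt_id x).const_sub (2 * x₀)
    have h1 := (h.hasDerivAt_v (2 * x₀ - x)).comp x hr
    have h2 := ((h.hasDerivAt_q (2 * x₀ - x)).comp x hr).neg
    exact (h1.congr_deriv (by simp)).prodMk (h2.congr_deriv (by simp))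
  · have e : 2 * x₀ - x₀ = x₀ := by ring
    simp [e, hx₀]

/-- The velocity of a homoclinic orbit has at most one zero. -/
lemma zero_unique (h : IsHomoclinic V g v q) (hV : IsOpen V) (hVc : IsConnected V)
    (h0 : (0 : ℝ) ∈ V) (hg : ContDiffOn ℝ 1 g V) {x₀ x₁ : ℝ} (hx₀ : q x₀ = 0) (hx₁ : q x₁ = 0) :
    x₀ = x₁ := by
  wlog hlt : x₀ < x₁ generalizing x₀ x₁
  · rcases eq_or_lt_of_le (not_lt.1 hlt) with he | hlt'
    · exact he.symm
    · exact (this hx₁ hx₀ hlt').symm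
  exfalso
  have s₀ := h.symmetric hV hVc h0 hg hx₀
  have s₁ := h.symmetric hV hVc h0 hg hx₁
  -- The composite of two reflections is a translation; a periodic function tending to `0` vanishes.
  have hper : Function.Periodic v (2 * (x₁ - x₀)) := fun x => by
    rw [← s₀ x, ← s₁ (2 * x₀ - x)]
    congr 1
    ring
  refine h.not_forall_eq_zero fun x => ?_
  have ht : Tendsto (fun n : ℕ => v (x + n * (2 * (x₁ - x₀)))) atTop (𝓝 0) := by
    refine h.v_atTop.comp (tendsto_atTop_add_const_left _ _ ?_)
    exact tendsto_natCast_atTop_atTop.atTop_mul_const (by linarith)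
  refine tendsto_nhds_unique (tendsto_const_nhds.congr fun n => ?_) ht
  exact (hper.nat_mul n x).symm

/-- The velocity of a homoclinic orbit changes sign exactly once. -/
lemma exists_sign_change (h : IsHomoclinic V g v q) (hV : IsOpen V) (hVc : IsConnected V)
    (h0 : (0 : ℝ) ∈ V) (hg : ContDiffOn ℝ 1 g V) :
    ∃ x₀, (∀ x, x ≠ x₀ → q x ≠ 0) ∧ ∀ y z, y < x₀ → x₀ < z → q z * q y < 0 := by
  have hnn : ¬ ∀ x, 0 ≤ q x := fun hq =>
    h.not_forall_eq_zero (eq_zero_of_deriv_nonneg h.hasDerivAt_v h.v_atTop h.v_atBot hq)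
  have hnp : ¬ ∀ x, q x ≤ 0 := fun hq => h.not_forall_eq_zero fun x => by
    have := eq_zero_of_deriv_nonneg (v := fun x => -v x) (q := fun x => -q x)
      (fun x => (h.hasDerivAt_v x).neg) (by simpa using h.v_atTop.neg)
      (by simpa using h.v_atBot.neg) (fun x => by simpa using hq x) x
    simpa using this
  have hivt : ∀ x y, q x ≤ 0 → 0 ≤ q y → ∃ z ∈ uIcc x y, q z = 0 := fun x y hx hy => by
    have := intermediate_value_uIcc (a := x) (b := y) h.cont_q.continuousOn
    exact this (by rw [uIcc_of_le (hx.trans hy)]; exact ⟨hx, hy⟩)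
  push Not at hnn hnp
  obtain ⟨x₁, hx₁⟩ := hnn
  obtain ⟨x₂, hx₂⟩ := hnp
  obtain ⟨x₀, -, hx₀⟩ := hivt x₁ x₂ hx₁.le hx₂.le
  have hu : ∀ x, q x = 0 → x = x₀ := fun x hx => h.zero_unique hV hVc h0 hg hx hx₀
  -- Points of opposite sign must be separated by the only zero, so the sign is constant on each
  -- side of it.
  have hside : ∀ x y, q x < 0 → 0 < q y → (x < x₀ ∧ x₀ < y) ∨ (y < x₀ ∧ x₀ < x) := by
    intro x y hx hy
    obtain ⟨z, hz, hz0⟩ := hivt x y hx.le hy.le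
    obtain rfl := hu z hz0
    have hxz : x ≠ z := fun e => by rw [e] at hx; linarith
    have hyz : y ≠ z := fun e => by rw [e] at hy; linarith
    rcases mem_uIcc.1 hz with hz | hz
    · exact Or.inl ⟨lt_of_le_of_ne hz.1 hxz, lt_of_le_of_ne hz.2 hyz.symm⟩
    · exact Or.inr ⟨lt_of_le_of_ne hz.1 hyz, lt_of_le_of_ne hz.2 hxz.symm⟩
  refine ⟨x₀, fun x hx hq => hx (hu x hq), fun y z hy hz => ?_⟩
  have hqy : q y ≠ 0 := fun e => hy.ne (hu y e)
  have hqz : q z ≠ 0 := fun e => hz.ne' (hu z e)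
  rcases lt_or_gt_of_ne hqy with h1 | h1 <;> rcases lt_or_gt_of_ne hqz with h2 | h2
  · rcases hside y x₂ h1 hx₂ with h3 | h3 <;> rcases hside z x₂ h2 hx₂ with h4 | h4 <;>
      linarith [h3.1, h3.2, h4.1, h4.2]
  · exact mul_neg_of_pos_of_neg h2 h1
  · exact mul_neg_of_neg_of_pos h2 h1
  · rcases hside x₁ y hx₁ h1 with h3 | h3 <;> rcases hside x₁ z hx₁ h2 with h4 | h4 <;>
      linarith [h3.1, h3.2, h4.1, h4.2]

/-- The derivative of a homoclinic orbit is an eigenfunction at `0` of the linearisation. -/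
lemma isEigen_deriv (h : IsHomoclinic V g v q) (hV : IsOpen V) (h0 : (0 : ℝ) ∈ V)
    (hg : ContDiffOn ℝ 1 g V) (hg0 : g 0 = 0) {A : ℝ} (hA : ∀ x, |deriv g (v x)| ≤ A) :
    IsEigen (fun x => deriv g (v x)) 0 (fun x => ((q x : ℝ) : ℂ))
      (fun x => ((g (v x) : ℝ) : ℂ)) := by
  have hgd : ∀ y ∈ V, HasDerivAt g (deriv g y) y := fun y hy =>
    ((hg.differentiableOn one_ne_zero).differentiableAt (hV.mem_nhds hy)).hasDerivAt
  have hgv : ∀ x, HasDerivAt (fun x => g (v x)) (deriv g (v x) * q x) x := fun x =>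
    (hgd _ (h.mem x)).comp x (h.hasDerivAt_v x)
  have hsol : IsSol (fun x => deriv g (v x)) 0 (fun x => ((q x : ℝ) : ℂ))
      (fun x => ((g (v x) : ℝ) : ℂ)) :=
    ⟨fun x => (h.hasDerivAt_q x).ofReal_comp,
      fun x => ((hgv x).ofReal_comp).congr_deriv (by push_cast; ring)⟩
  have hcg : Continuous (fun x => g (v x)) :=
    continuous_iff_continuousAt.2 fun x => (hgv x).continuousAt
  have hg0t : Tendsto g (𝓝 0) (𝓝 0) := by
    have := (hgd 0 h0).continuousAt.tendsto
    rwa [hg0] at this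
  obtain ⟨C₁, hC₁⟩ := exists_abs_le_of_tendsto h.cont_q h.q_atTop h.q_atBot
  obtain ⟨C₂, hC₂⟩ := exists_abs_le_of_tendsto hcg (hg0t.comp h.v_atTop) (hg0t.comp h.v_atBot)
  have hb : ∀ x, amp (fun x => ((q x : ℝ) : ℂ)) (fun x => ((g (v x) : ℝ) : ℂ)) x ≤
      C₁ ^ 2 + C₂ ^ 2 := fun x => by
    simp only [amp, Complex.norm_real, Real.norm_eq_abs]
    have := hC₁ x
    have := hC₂ x
    gcongr
  refine ⟨hsol, ⟨_, fun x _ => hb x⟩, ⟨C₁ ^ 2 + C₂ ^ 2, fun x _ => ?_⟩, fun hz => ?_⟩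
  · rw [amp_reflect (fun x => ((q x : ℝ) : ℂ)) (fun x => ((g (v x) : ℝ) : ℂ))]
    exact hb (-x)
  -- Zero amplitude at `0` would force `q` to vanish identically, in particular `q ≥ 0`, and hence
  -- `v` to be trivial.
  · refine h.not_forall_eq_zero (eq_zero_of_deriv_nonneg h.hasDerivAt_v h.v_atTop h.v_atBot
      fun x => ?_)
    by_contra! hx
    refine hsol.amp_ne_zero hA (y := x) (fun h1 => ?_) 0 hz
    have h2 : (q x : ℂ) = 0 := (amp_eq_zero.1 h1).1
    have h3 : q x = 0 := by exact_mod_cast h2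
    linarith

/-- The linearisation about a homoclinic orbit is coercive near `±∞`. -/
lemma exists_coercive (h : IsHomoclinic V g v q) (hV : IsOpen V) (h0 : (0 : ℝ) ∈ V)
    (hg : ContDiffOn ℝ 1 g V) {Λ : ℝ} (hΛ : 0 < deriv g 0 + Λ) (ρ : ℝ) :
    ∃ A c R, ρ < R ∧ Coercive (fun x => deriv g (v x)) Λ A c R := by
  have hgd := hg.continuousOn_deriv_of_isOpen hV le_rfl
  have hcont : Continuous (fun x => deriv g (v x)) := continuous_iff_continuousAt.2 fun x =>
    (hgd.continuousAt (hV.mem_nhds (h.mem x))).comp h.cont_v.continuousAt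
  have ht : Tendsto (deriv g) (𝓝 0) (𝓝 (deriv g 0)) := hgd.continuousAt (hV.mem_nhds h0)
  have h₁ := ht.comp h.v_atTop
  have h₂ := ht.comp h.v_atBot
  obtain ⟨A, hA⟩ := exists_abs_le_of_tendsto hcont h₁ h₂
  have hc : deriv g 0 - (deriv g 0 + Λ) / 2 < deriv g 0 := by linarith
  obtain ⟨R₁, hR₁⟩ := eventually_atTop.1 (h₁.eventually_const_lt hc)
  obtain ⟨R₂, hR₂⟩ := eventually_atBot.1 (h₂.eventually_const_lt hc)
  have m1 := le_max_left (max R₁ (-R₂)) (max 0 (ρ + 1))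
  have m2 := le_max_right (max R₁ (-R₂)) (max 0 (ρ + 1))
  -- Half of the asymptotic gap survives far out, capped at `1` so that `c` also bounds the
  -- coefficient of `|q|²`. The radius may be taken beyond any prescribed `ρ`.
  refine ⟨A, min 1 ((deriv g 0 + Λ) / 2), max (max R₁ (-R₂)) (max 0 (ρ + 1)), ?_, hcont, hA,
    lt_min one_pos (by linarith), min_le_left _ _, (le_max_left _ _).trans m2, fun x hx => ?_⟩
  · have := (le_max_right 0 (ρ + 1)).trans m2
    linarith
  · refine (min_le_right _ _).trans ?_
    have r1 := ((le_max_left R₁ (-R₂)).trans m1).trans hx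
    have r2 := ((le_max_right R₁ (-R₂)).trans m1).trans hx
    rcases le_total 0 x with hx0 | hx0
    · rw [abs_of_nonneg hx0] at r1
      have := hR₁ x r1
      simp only [Function.comp] at this
      linarith
    · rw [abs_of_nonpos hx0] at r2
      have := hR₂ x (by linarith)
      simp only [Function.comp] at this
      linarith

end IsHomoclinic

/-! ### Translating the hypotheses and the space of bounded solutions. -/

/-- If the sum were `≤ 0`, the parameter `(δ / 2)² - κ` would lie in the half plane and have the
eigenvalue `δ / 2`, violating the gap `δ`. -/
lemma UniformlyHyperbolic.add_pos {m : ℕ} {G : EuclideanSpace ℝ (Fin m) → ℝ → ℝ → ℝ}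
    {u : EuclideanSpace ℝ (Fin m)} {Λ : ℝ} (h : UniformlyHyperbolic G u Λ) :
    0 < deriv (fun w => G u w 0) 0 + Λ := by
  obtain ⟨δ, hδ, h⟩ := h
  by_contra! hle
  set κ := deriv (fun w => G u w 0) 0
  have h1 := h (((δ / 2) ^ 2 - κ : ℝ) : ℂ) (ofReal_mem_halfPlane.2 (by nlinarith))
    ((δ / 2 : ℝ) : ℂ) (mem_spectrum_of_sq (by push_cast; ring))
  rw [Complex.ofReal_re, abs_of_pos (by linarith)] at h1
  linarith

lemma mem_boundedSolutions_iff {a : ℝ → ℝ} {ζ : ℂ} {φ : ℝ → Fin 2 → ℂ} :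
    φ ∈ boundedSolutions (fun x => sysMat a ζ x) ↔
      IsSol a ζ (fun x => φ x 0) (fun x => φ x 1) ∧
        FwdBdd (fun x => φ x 0) (fun x => φ x 1) ∧ BwdBdd (fun x => φ x 0) (fun x => φ x 1) := by
  have e : ∀ x, φ x = ![φ x 0, φ x 1] := fun x => by ext i; fin_cases i <;> rfl
  have hmem : φ ∈ boundedSolutions (fun x => sysMat a ζ x) ↔
    IsSolution (sysMat a ζ) φ ∧ ∃ C : ℝ, ∀ x, ‖φ x‖ ≤ C := Iff.rfl
  rw [hmem, isSolution_iff]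
  refine and_congr_right fun _ => ⟨?_, ?_⟩
  · rintro ⟨C, hC⟩
    have hb : ∀ x, amp (fun x => φ x 0) (fun x => φ x 1) x ≤ 2 * C ^ 2 := fun x => by
      refine (amp_le_norm_vec_sq _ _ x).trans ?_
      have := hC x
      rw [← e x]
      gcongr
    refine ⟨⟨_, fun x _ => hb x⟩, ⟨2 * C ^ 2, fun x _ => ?_⟩⟩
    rw [amp_reflect (fun x => φ x 0) (fun x => φ x 1)]
    exact hb (-x)
  · rintro ⟨⟨C₁, h₁⟩, ⟨C₂, h₂⟩⟩
    refine ⟨Real.sqrt (max C₁ C₂), fun x => Real.le_sqrt_of_sq_le ?_⟩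
    have h3 := norm_vec_sq_le_amp (fun x => φ x 0) (fun x => φ x 1) x
    simp only [← e x] at h3
    refine h3.trans ?_
    rcases le_total 0 x with hx | hx
    · exact (h₁ x hx).trans (le_max_left _ _)
    · have := h₂ (-x) (by linarith)
      rw [amp_reflect (fun x => φ x 0) (fun x => φ x 1), neg_neg] at this
      exact this.trans (le_max_right _ _)

lemma isEigen_of_mem_boundedSolutions {a : ℝ → ℝ} {A : ℝ} (hA : ∀ x, |a x| ≤ A) {ζ : ℂ}
    {φ : ℝ → Fin 2 → ℂ} (h : φ ∈ boundedSolutions (fun x => sysMat a ζ x)) (hφ : φ ≠ 0) :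
    IsEigen a ζ (fun x => φ x 0) (fun x => φ x 1) := by
  obtain ⟨h1, h2, h3⟩ := mem_boundedSolutions_iff.1 h
  refine ⟨h1, h2, h3, fun h0 => hφ ?_⟩
  funext x
  have hx : amp (fun x => φ x 0) (fun x => φ x 1) x = 0 := by
    by_contra hne
    exact h1.amp_ne_zero hA hne 0 h0
  obtain ⟨e0, e1⟩ := amp_eq_zero.1 hx
  ext i
  fin_cases i
  · exact e0
  · exact e1

lemma IsEigen.span_eq_boundedSolutions {a : ℝ → ℝ} {Λ A c R : ℝ} {ζ : ℂ} {v q : ℝ → ℂ}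
    (hP : Coercive a Λ A c R) (hζ : ζ ∈ halfPlane Λ) (h : IsEigen a ζ v q) :
    Submodule.span ℂ {fun x => ![v x, q x]} = boundedSolutions (fun x => sysMat a ζ x) := by
  refine le_antisymm ?_ fun φ hφ => ?_
  · rw [Submodule.span_singleton_le_iff_mem]
    exact mem_boundedSolutions_iff.2 ⟨h.sol, h.fwd, h.bwd⟩
  · obtain ⟨h1, h2, -⟩ := mem_boundedSolutions_iff.1 hφ
    obtain ⟨k, e1, e2⟩ := eq_mul_of_fwdBdd hP hζ h.sol h1 h.fwd h2 h.ne
    rw [Submodule.mem_span_singleton]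
    refine ⟨k, ?_⟩
    funext x
    ext i
    fin_cases i
    · simpa using (congrFun e1 x).symm
    · simpa using (congrFun e2 x).symm

lemma ReactionTerm.contDiffOn_fast {m : ℕ} {U : Set (EuclideanSpace ℝ (Fin m))} {V I : Set ℝ}
    {G : EuclideanSpace ℝ (Fin m) → ℝ → ℝ → ℝ} (hG : ReactionTerm U V I G)
    {u₀ : EuclideanSpace ℝ (Fin m)} (hu₀ : u₀ ∈ U) : ContDiffOn ℝ 1 (fun w => G u₀ w 0) V := by
  have h1 : ContDiffOn ℝ 2 (fun w : ℝ => (u₀, w, (0 : ℝ))) V :=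
    (contDiff_const.prodMk (contDiff_id.prodMk contDiff_const)).contDiffOn
  exact (hG.contDiffOn.comp h1 fun w hw => ⟨hu₀, hw, hG.zero_mem_I⟩).of_le one_le_two

end FastEvans

end

/-! ### Assembly. -/

open FastEvans in
theorem mainTheorem10 {m : ℕ} (U : Set (EuclideanSpace ℝ (Fin m))) (V I : Set ℝ)
    (G : EuclideanSpace ℝ (Fin m) → ℝ → ℝ → ℝ) (hG : FastEvans.ReactionTerm U V I G)
    (u₀ : EuclideanSpace ℝ (Fin m)) (hu₀ : u₀ ∈ U) (v_h q_h : ℝ → ℝ)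
    (hh : FastEvans.IsHomoclinic V (fun v => G u₀ v 0) v_h q_h)
    (Λ : ℝ) (hΛ : Λ < 0) (hyp : FastEvans.UniformlyHyperbolic G u₀ Λ) :
    (∃ E : ℂ → ℂ,
      FastEvans.IsFastReducedEvans (fun ζ x => FastEvans.fastMatrix G u₀ (v_h x) ζ) Λ E) ∧
    ∀ E : ℂ → ℂ,
      FastEvans.IsFastReducedEvans (fun ζ x => FastEvans.fastMatrix G u₀ (v_h x) ζ) Λ E →
      -- all zeros are real and simple
      (∀ ζ ∈ FastEvans.halfPlane Λ, E ζ = 0 → ζ.im = 0 ∧ analyticOrderAt E ζ = 1) ∧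
      -- precisely one positive zero, and its bounded solutions have no zeros
      (∃ l₀ : ℝ, 0 < l₀ ∧ E l₀ = 0 ∧ (∀ l : ℝ, 0 < l → E l = 0 → l = l₀) ∧
        ∀ φ ∈ FastEvans.boundedSolutions (fun x => FastEvans.fastMatrix G u₀ (v_h x) l₀),
          φ ≠ 0 → ∀ x, φ x 0 ≠ 0) ∧
      -- zero is a zero, and its bounded solutions are spanned by the derivative of the homoclinic
      E 0 = 0 ∧
      Submodule.span ℂ
          {fun x => ![((deriv v_h x : ℝ) : ℂ), ((deriv q_h x : ℝ) : ℂ)]} =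
        FastEvans.boundedSolutions (fun x => FastEvans.fastMatrix G u₀ (v_h x) 0) := by
  set g : ℝ → ℝ := fun w => G u₀ w 0 with hg_def
  have hg : ContDiffOn ℝ 1 g V := hG.contDiffOn_fast hu₀
  have hg0 : g 0 = 0 := hG.vanish u₀ hu₀ 0 hG.zero_mem_I
  obtain ⟨x₀, hz, hs⟩ := hh.exists_sign_change hG.isOpen_V hG.isConnected_V hG.zero_mem_V hg
  -- Taking `R > |x₀|` puts the zero of `q_h` strictly between `-R` and `R`, so `q_h` has opposite
  -- signs at the normalisation points.
  obtain ⟨A, c, R, hR, hP⟩ := hh.exists_coercive hG.isOpen_V hG.zero_mem_V hg hyp.add_pos |x₀|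
  have hE0 := hh.isEigen_deriv hG.isOpen_V hG.zero_mem_V hg hg0 hP.bdd
  set a : ℝ → ℝ := fun x => deriv g (v_h x) with ha_def
  have hsign : q_h R * q_h (-R) < 0 :=
    hs (-R) R (by linarith [neg_abs_le x₀]) (by linarith [le_abs_self x₀])
  have h0mem : (0 : ℂ) ∈ halfPlane Λ := by simpa [halfPlane] using hΛ
  have hmat : ∀ ζ : ℂ, (fun x => fastMatrix G u₀ (v_h x) ζ) = fun x => sysMat a ζ x :=
    fun ζ => rfl
  have hmat' : (fun ζ x => fastMatrix G u₀ (v_h x) ζ) = fun ζ x => sysMat a ζ x := rfl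
  simp only [hmat, hmat']
  refine ⟨?_, fun E hE => ?_⟩
  · obtain ⟨vp, qp, vm, qm, -, -, hF⟩ := exists_normalised_frame hP
    exact ⟨_, hF.isFastReducedEvans hP⟩
  obtain ⟨Bu, Bs, hF, hEF⟩ := hE.exists_frame hP.bdd
  -- Comparison with the eigenfunction at `0`, whose `v`-component `q_h` vanishes only at `x₀`.
  have hne : ∀ l : ℝ, 0 < l → ∀ v q, IsEigen a l v q → ∀ x, v x ≠ 0 := fun l hl v q h =>
    h.ne_zero_of_single_zero hP hΛ hl (by simpa using hE0) hz
  have hzero : ∀ l : ℝ, 0 < l → (E l = 0 ↔ ∃ v q, IsEigen a l v q) := fun l hl => by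
    have hl' : (l : ℂ) ∈ halfPlane Λ := ofReal_mem_halfPlane.2 (hΛ.trans hl)
    rw [hEF _ hl', hF.eq_zero_iff hP hl']
  -- The eigenfunction at the smaller positive zero has no zeros, which excludes every eigenvalue
  -- above it.
  have hlt : ∀ l l' : ℝ, 0 < l' → l' < l → E l = 0 → E l' = 0 → False := by
    intro l l' hl' hll h1 h2
    obtain ⟨v, q, h⟩ := (hzero l (hl'.trans hll)).1 h1
    obtain ⟨v', q', h'⟩ := (hzero l' hl').1 h2
    obtain ⟨u, p, hu, huz⟩ := h'.exists_real hP (hΛ.trans hl') (hne l' hl' v' q' h')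
    exact not_isEigen_of_lt hP (hΛ.trans hl') hll hu huz h
  refine ⟨fun ζ hζ h0 => ?_, ?_, ?_, ?_⟩
  -- The values of `E` are prescribed only on the half plane; openness makes the agreement local,
  -- which suffices for the order of vanishing.
  · have hcongr : E =ᶠ[𝓝 ζ] frameDet Bu Bs :=
      mem_of_superset ((isOpen_halfPlane Λ).mem_nhds hζ) hEF
    rw [analyticOrderAt_congr hcongr]
    exact hF.simple hP hζ (by rw [← hEF ζ hζ, h0])
  · obtain ⟨l₀, hl₀, v, q, h⟩ := exists_pos_eigenvalue hP hΛ hE0 hsign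
    refine ⟨l₀, hl₀, (hzero l₀ hl₀).2 ⟨v, q, h⟩, fun l hl h1 => ?_, fun φ hφ hφ0 x => ?_⟩
    · have h2 := (hzero l₀ hl₀).2 ⟨v, q, h⟩
      rcases lt_trichotomy l l₀ with h3 | h3 | h3
      · exact (hlt l₀ l hl h3 h2 h1).elim
      · exact h3
      · exact (hlt l l₀ hl₀ h3 h1 h2).elim
    · exact hne l₀ hl₀ _ _ (isEigen_of_mem_boundedSolutions hP.bdd hφ hφ0) x
  · rw [hEF 0 h0mem]
    exact (hF.eq_zero_iff hP h0mem).2 ⟨_, _, hE0⟩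
  · have e1 : deriv v_h = q_h := funext fun x => (hh.hasDerivAt_v x).deriv
    have e2 : deriv q_h = fun x => g (v_h x) := funext fun x => (hh.hasDerivAt_q x).deriv
    rw [e1, e2]
    exact hE0.span_eq_boundedSolutions hP h0mem
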